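/- \textbf{Proposition.} Write the nontrivial zeros of the Riemann zeta function (those with $0<\operatorname{Re}\rho<1$), repeated according to multiplicity, as $\rho_j=\tfrac12+i\gamma_j$; the Riemann Hypothesis is not assumed, so the $\gamma_j$ may be non-real. Let $f:\mathbb R\to\mathbb C$ be continuous and integrable with $\hat f(u)=\int_{-\infty}^\infty f(x)e^{-2\pi i xu}\,dx\in C_c^\infty(\mathbb R)$ (for example $f$ real-valued and even), extended to an entire function by $f(z)=\int_{-\infty}^\infty \hat f(u)e^{2\pi i uz}\,du$. For $T>1$ and $\tau\in\mathbb R$ put $$N_f(\tau)=\sum_j f\Big(\frac{\log T}{2\pi}(\gamma_j-\tau)\Big).$$ Let $w:\mathbb R\to[0,\infty)$ be integrable with $\int_{-\infty}^\infty w(x)\,dx=1$, with $\hat w$ compactly supported, and with $\int_{-\infty}^\infty w(x)\log(1+|x|)\,dx<\infty$, and for $H>0$ put $$\langle W\rangle_{T,H}=\int_{-\infty}^\infty W(\tau)\,w\Big(\frac{\tau-T}{H}\Big)\frac{d\tau}{H}.$$ Then, for all $T>1$ and $H>0$, the series $N_f(\tau)$ converges absolutely for every $\tau$ and the integral $\langle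 N_f\rangle_{T,H}$ converges absolutely. Moreover, if $H=H(T)$ satisfies $H\to\infty$ and $H=O(T)$ as $T\to\infty$ (for example $H=T^a$ with $0<a\le 1$), then $$\langle N_f\rangle_{T,H}=\int_{-\infty}^\infty f(x)\,dx+O\Big(\frac1{\log T}\Big),\qquad T\to\infty .$$ -/

import Mathlib

open Filter MeasureTheory Asymptotics
open scoped FourierTransform ContDiff

namespace LinearStatistics

/-- The nontrivial zeros of the Riemann zeta function. -/
def nontrivialZeros : Set ℂ :=
  {ρ : ℂ | riemannZeta ρ = 0 ∧ 0 < ρ.re ∧ ρ.re < 1}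

/-- The (possibly non-real) ordinate `γ` of a zero written as `ρ = 1/2 + iγ`. -/
noncomputable def ordinate (ρ : ℂ) : ℂ := (ρ - 1 / 2) / Complex.I

/-- The multiplicity of `ρ` as a zero of the Riemann zeta function. -/
noncomputable def multiplicity (ρ : ℂ) : ℕ := analyticOrderNatAt riemannZeta ρ

/-- The entire extension `f(z) = ∫ 𝓕f(u) e^{2πiuz} du` of a function on the real line whose
Fourier transform `𝓕f(u) = ∫ f(x) e^{-2πixu} dx` is smooth and compactly supported. -/
noncomputable def entireExt (f : ℝ → ℂ) (z : ℂ) : ℂ :=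
  ∫ u : ℝ, 𝓕 f u * Complex.exp (2 * Real.pi * Complex.I * u * z)

/-- `f` is a continuous integrable function with Fourier transform in `C_c^∞(ℝ)`. -/
structure IsTestFunction (f : ℝ → ℂ) : Prop where
  continuous : Continuous f
  integrable : Integrable f
  smooth_fourier : ContDiff ℝ ∞ (𝓕 f)
  compact_fourier : HasCompactSupport (𝓕 f)

/-- The extension does extend `f`. -/
theorem entireExt_ofReal {f : ℝ → ℂ} (hf : IsTestFunction f) (x : ℝ) :
    entireExt f x = f x := by
  have hint : Integrable (𝓕 f) :=
    hf.smooth_fourier.continuous.integrable_of_hasCompactSupport hf.compact_fourier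
  have h := congrFun (hf.continuous.fourierInv_fourier_eq hf.integrable hint) x
  rw [← h, Real.fourierInv_eq']
  unfold entireExt
  congr 1
  funext u
  simp only [smul_eq_mul]
  rw [mul_comm]
  congr 2
  simp
  ring

/-- The summand of `N_f(τ)` at the zero `ρ`, repeated according to multiplicity. -/
noncomputable def zeroTerm (f : ℝ → ℂ) (T τ : ℝ) (ρ : nontrivialZeros) : ℂ :=
  (multiplicity ρ : ℂ) *
    entireExt f (((Real.log T / (2 * Real.pi) : ℝ) : ℂ) * (ordinate ρ - τ))

/-- The linear statistic `N_f(τ) = ∑_j f((log T / 2π)(γ_j - τ))`, over all nontrivial zeros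
`1/2 + iγ_j` counted with multiplicity. -/
noncomputable def linearStatistic (f : ℝ → ℂ) (T τ : ℝ) : ℂ :=
  ∑' ρ : nontrivialZeros, zeroTerm f T τ ρ

/-- The integrand of the averaging operator. -/
noncomputable def averageIntegrand (w : ℝ → ℝ) (T H : ℝ) (W : ℝ → ℂ) (τ : ℝ) : ℂ :=
  W τ * ((w ((τ - T) / H) / H : ℝ) : ℂ)

/-- The averaging operator `⟨W⟩_{T,H} = ∫ W(τ) w((τ - T)/H) dτ/H`. -/
noncomputable def average (w : ℝ → ℝ) (T H : ℝ) (W : ℝ → ℂ) : ℂ :=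
  ∫ τ : ℝ, averageIntegrand w T H W τ

/-- Admissible weights: `w ≥ 0`, `∫ w = 1`, the Fourier transform of `w` has compact support,
and `w` has a finite logarithmic moment. -/
structure IsWeight (w : ℝ → ℝ) : Prop where
  nonneg : ∀ x, 0 ≤ w x
  integrable : Integrable w
  integral_eq_one : ∫ x, w x = 1
  compact_fourier : HasCompactSupport (𝓕 (fun x : ℝ => (w x : ℂ)))
  log_moment : Integrable (fun x : ℝ => w x * Real.log (1 + |x|))

end LinearStatistics

namespace LinearStatistics

section EntireFunctions

open Complex Metric Topology Set

variable {F : ℂ → ℂ}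

theorem analyticOrderAt_ne_top_of_entire (hF : Differentiable ℂ F) (h0 : F 0 ≠ 0) (z : ℂ) :
    analyticOrderAt F z ≠ ⊤ := by
  rw [ne_eq, analyticOrderAt_eq_top]
  intro h
  have hA : AnalyticOnNhd ℂ F univ := fun w _ => hF.analyticAt w
  have := hA.eqOn_zero_of_preconnected_of_eventuallyEq_zero isPreconnected_univ (mem_univ z) h
  exact h0 (this (mem_univ 0))

theorem finite_zeros_inter_closedBall (hF : Differentiable ℂ F) (h0 : F 0 ≠ 0) (R : ℝ) :
    {z : ℂ | F z = 0 ∧ ‖z‖ ≤ R}.Finite := by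
  have hA : AnalyticOnNhd ℂ F univ := fun w _ => hF.analyticAt w
  have h1 : F ⁻¹' {0}ᶜ ∈ codiscrete ℂ :=
    hA.preimage_zero_mem_codiscreteWithin h0 (mem_univ 0) isConnected_univ
  have h2 := mem_codiscrete'.mp h1
  rw [← preimage_compl, compl_compl] at h2
  have hc : IsCompact (closedBall (0 : ℂ) R ∩ F ⁻¹' {0}) :=
    (isCompact_closedBall 0 R).inter_right (isClosed_singleton.preimage hF.continuous)
  refine (hc.finite (h2.2.mono inter_subset_right)).subset ?_
  rintro z ⟨hz, hz'⟩
  exact ⟨by simpa using hz', hz⟩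

theorem exists_eq_pow_mul (hF : Differentiable ℂ F) (a : ℂ) (ha : analyticOrderAt F a ≠ ⊤) :
    ∃ G : ℂ → ℂ, Differentiable ℂ G ∧ G a ≠ 0 ∧
      ∀ z, F z = (z - a) ^ analyticOrderNatAt F a * G z := by
  obtain ⟨g, hg, hga, hfg⟩ := (hF.analyticAt a).analyticOrderAt_ne_top.1 ha
  set m := analyticOrderNatAt F a
  let G : ℂ → ℂ := fun z => if z = a then g a else F z / (z - a) ^ m
  have hGg : G =ᶠ[𝓝 a] g := by
    filter_upwards [hfg] with z hz
    by_cases hza : z = a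
    · simp [G, hza]
    · have : (z - a) ^ m ≠ 0 := pow_ne_zero _ (sub_ne_zero.2 hza)
      simp only [G, hza, if_false, hz, smul_eq_mul]
      field_simp
  refine ⟨G, fun z => ?_, ?_, fun z => ?_⟩
  · by_cases hza : z = a
    · subst hza
      exact hg.differentiableAt.congr_of_eventuallyEq hGg
    · have h1 : G =ᶠ[𝓝 z] fun w => F w / (w - a) ^ m := by
        filter_upwards [isOpen_ne.mem_nhds hza] with w hw
        simp only [G, if_neg hw]
      refine DifferentiableAt.congr_of_eventuallyEq ?_ h1
      exact (hF z).div (by fun_prop) (pow_ne_zero _ (sub_ne_zero.2 hza))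
  · simpa [G] using hga
  · by_cases hza : z = a
    · subst hza
      have := hfg.self_of_nhds
      simpa [G] using this
    · have : (z - a) ^ m ≠ 0 := pow_ne_zero _ (sub_ne_zero.2 hza)
      simp only [G, hza, if_false]
      field_simp

theorem exists_eq_prod_mul (hF : Differentiable ℂ F) (h0 : F 0 ≠ 0) (S : Finset ℂ)
    (hS : (0 : ℂ) ∉ S) :
    ∃ G : ℂ → ℂ, Differentiable ℂ G ∧ (∀ a ∈ S, G a ≠ 0) ∧
      ∀ z, F z = (∏ a ∈ S, (1 - z / a) ^ analyticOrderNatAt F a) * G z := by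
  induction S using Finset.induction_on with
  | empty => exact ⟨F, hF, by simp, by simp⟩
  | insert b S hb ih =>
    obtain ⟨G, hG, hGS, hFG⟩ := ih (fun h => hS (Finset.mem_insert_of_mem h))
    have hb0 : b ≠ 0 := fun h => hS (by simp [h])
    have hG0 : G 0 ≠ 0 := by
      have := hFG 0
      intro h
      rw [h, mul_zero] at this
      exact h0 this
    let p : ℂ → ℂ := fun z => ∏ a ∈ S, (1 - z / a) ^ analyticOrderNatAt F a
    have hp : Differentiable ℂ p := by
      intro z
      simp only [p]
      fun_prop
    have hpb : p b ≠ 0 := by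
      simp only [p]
      rw [Finset.prod_ne_zero_iff]
      intro a ha
      have ha0 : a ≠ 0 := fun h => hS (Finset.mem_insert_of_mem (h ▸ ha))
      have hab : b ≠ a := fun h => hb (h ▸ ha)
      refine pow_ne_zero _ ?_
      rw [sub_ne_zero, ne_comm, ne_eq, div_eq_one_iff_eq ha0]
      exact hab
    have hGt := analyticOrderAt_ne_top_of_entire hG hG0 b
    have hpt : analyticOrderAt p b = 0 := (hp.analyticAt b).analyticOrderAt_eq_zero.2 hpb
    have hord : analyticOrderNatAt F b = analyticOrderNatAt G b := by
      have hFpG : F = p * G := funext hFG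
      rw [hFpG, analyticOrderNatAt_mul (hp.analyticAt b) (hG.analyticAt b) (by simp [hpt]) hGt]
      simp [analyticOrderNatAt, hpt]
    obtain ⟨G₁, hG₁, hG₁b, hGG₁⟩ := exists_eq_pow_mul hG b hGt
    refine ⟨fun z => (-b) ^ analyticOrderNatAt G b * G₁ z, hG₁.const_mul _, ?_, fun z => ?_⟩
    · intro a ha
      refine mul_ne_zero (pow_ne_zero _ (neg_ne_zero.2 hb0)) ?_
      rcases Finset.mem_insert.1 ha with rfl | ha
      · exact hG₁b
      · intro h
        apply hGS a ha
        rw [hGG₁, h, mul_zero]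
    · rw [Finset.prod_insert hb, hFG z, hGG₁ z, hord]
      have : (z - b) ^ analyticOrderNatAt G b
          = (1 - z / b) ^ analyticOrderNatAt G b * (-b) ^ analyticOrderNatAt G b := by
        rw [← mul_pow]
        congr 1
        field_simp
        ring
      rw [this]
      ring

/-- A zero-free entire function with value `1` at `0` and bounded by `exp M` on a ball of radius
`R` has logarithmic derivative of small variation well inside the ball. -/
theorem norm_logDeriv_sub_le {G : ℂ → ℂ} (hG : Differentiable ℂ G) (hG0 : G 0 = 1) {R M : ℝ}
    (hR : 0 < R) (hM : 0 < M) (hne : ∀ z ∈ ball (0 : ℂ) R, G z ≠ 0)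
    (hle : ∀ z ∈ ball (0 : ℂ) R, ‖G z‖ ≤ Real.exp M) {s t : ℂ} (hs : ‖s‖ < R / 8)
    (ht : ‖t‖ < R / 8) :
    ‖logDeriv G s - logDeriv G t‖ ≤ 64 * M / R ^ 2 * ‖s - t‖ := by
  have hd : DifferentiableOn ℂ (logDeriv G) (ball 0 R) := by
    intro z hz
    have h1 : DifferentiableAt ℂ (deriv G) z := (hG.analyticAt z).deriv.differentiableAt
    exact (h1.div (hG z) (hne z hz)).differentiableWithinAt
  obtain ⟨h, hh⟩ := hd.isExactOn_ball
  let g : ℂ → ℂ := fun z => h z - h 0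
  have hg : ∀ z ∈ ball (0 : ℂ) R, HasDerivAt g (logDeriv G z) z := fun z hz =>
    (hh z hz).sub_const _
  have hgd : DifferentiableOn ℂ g (ball 0 R) := fun z hz =>
    (hg z hz).differentiableAt.differentiableWithinAt
  have h0mem : (0 : ℂ) ∈ ball (0 : ℂ) R := mem_ball_self hR
  have hexp : ∀ z ∈ ball (0 : ℂ) R, G z = Complex.exp (g z) := by
    have hder : ∀ z ∈ ball (0 : ℂ) R,
        HasDerivAt (fun z => G z * Complex.exp (-g z)) 0 z := by
      intro z hz
      have h1 : HasDerivAt (fun z => G z * Complex.exp (-g z))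
          (deriv G z * Complex.exp (-g z) + G z * (Complex.exp (-g z) * -logDeriv G z)) z :=
        (hG z).hasDerivAt.mul (hg z hz).neg.cexp
      refine h1.congr_deriv ?_
      rw [logDeriv_apply]
      have := hne z hz
      field_simp
      ring
    have hconst := fun z hz => (convex_ball (0 : ℂ) R).is_const_of_fderivWithin_eq_zero (𝕜 := ℂ)
      (x := z) (y := 0)
      (f := fun z => G z * Complex.exp (-g z))
      (fun z hz => (hder z hz).differentiableAt.differentiableWithinAt) (fun z hz => by
        rw [fderivWithin_of_isOpen isOpen_ball hz]
        have := (hder z hz).hasFDerivAt.fderiv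
        rw [this]
        ext
        simp) hz h0mem
    intro z hz
    have h2 := hconst z hz
    simp only [g, sub_self, neg_zero, Complex.exp_zero, hG0, mul_one] at h2
    rw [Complex.exp_neg] at h2
    have h3 := Complex.exp_ne_zero (h z - h 0)
    field_simp at h2
    simpa [g] using h2
  have hre : MapsTo g (ball 0 R) {z | z.re ≤ M} := by
    intro z hz
    have h1 := hle z hz
    rw [hexp z hz, Complex.norm_exp, Real.exp_le_exp] at h1
    exact h1
  have hgb : ∀ z ∈ closedBall (0 : ℂ) (R / 2), ‖g z‖ ≤ 2 * M := by
    intro z hz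
    have hz' : ‖z‖ ≤ R / 2 := by simpa using hz
    have h1 := borelCaratheodory_zero hM hgd hre hR (z := z) (by simp; linarith) (by simp [g])
    refine h1.trans ?_
    rw [div_le_iff₀ (by linarith)]
    nlinarith
  have hderiv : ∀ z ∈ ball (0 : ℂ) R, deriv g z = logDeriv G z := fun z hz => (hg z hz).deriv
  have hlb : ∀ z ∈ closedBall (0 : ℂ) (R / 4), ‖logDeriv G z‖ ≤ 2 * M / (R / 4) := by
    intro z hz
    have hz' : ‖z‖ ≤ R / 4 := by simpa using hz
    have hsub : closedBall z (R / 4) ⊆ closedBall 0 (R / 2) :=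
      closedBall_subset_closedBall' (by simp only [dist_zero_right]; linarith)
    have hsub' : closedBall (0 : ℂ) (R / 2) ⊆ ball 0 R :=
      closedBall_subset_ball (by linarith)
    rw [← hderiv z (by simp; linarith)]
    refine norm_deriv_le_of_forall_mem_sphere_norm_le (by linarith) ?_ (fun w hw =>
      hgb w (hsub (sphere_subset_closedBall hw)))
    exact (hgd.mono (hsub.trans hsub')).diffContOnCl_ball subset_rfl
  have hl2 : ∀ z ∈ ball (0 : ℂ) (R / 8), ‖deriv (logDeriv G) z‖ ≤ 64 * M / R ^ 2 := by
    intro z hz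
    have hz' : ‖z‖ < R / 8 := by simpa using hz
    have hsub : closedBall z (R / 8) ⊆ closedBall 0 (R / 4) :=
      closedBall_subset_closedBall' (by simp only [dist_zero_right]; linarith)
    have hsub' : closedBall (0 : ℂ) (R / 4) ⊆ ball 0 R :=
      closedBall_subset_ball (by linarith)
    have := norm_deriv_le_of_forall_mem_sphere_norm_le (c := z) (R := R / 8) (f := logDeriv G)
      (by linarith) ((hd.mono (hsub.trans hsub')).diffContOnCl_ball subset_rfl)
      (fun w hw => hlb w (hsub (sphere_subset_closedBall hw)))
    refine this.trans (le_of_eq ?_)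
    field_simp
    norm_num
  refine (convex_ball (0 : ℂ) (R / 8)).norm_image_sub_le_of_norm_deriv_le (𝕜 := ℂ)
    (fun z hz => ?_) hl2 (by simpa using ht) (by simpa using hs)
  exact (hd z (ball_subset_ball (by linarith) hz)).differentiableAt
    (isOpen_ball.mem_nhds (ball_subset_ball (by linarith) hz))

end EntireFunctions

end LinearStatistics

namespace LinearStatistics

section EntireFunctionsOfFiniteOrder

open Complex Metric Topology Set

variable {F : ℂ → ℂ}

/-- Dividing out finitely many zeros in a disc of radius `R` gains a factor `3` for each zero. -/
theorem norm_quotient_mul_le {C : ℝ}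
    (hC : ∀ z, ‖F z‖ ≤ Real.exp (C * (1 + ‖z‖) ^ (3 / 2 : ℝ)))
    {R : ℝ} (hR : 0 < R) {S : Finset ℂ} (hS0 : (0 : ℂ) ∉ S) (hS : ∀ a ∈ S, ‖a‖ ≤ R)
    {G : ℂ → ℂ} (hG : Differentiable ℂ G)
    (hFG : ∀ z, F z = (∏ a ∈ S, (1 - z / a) ^ analyticOrderNatAt F a) * G z)
    {z : ℂ} (hz : ‖z‖ ≤ 4 * R) :
    3 ^ (∑ a ∈ S, analyticOrderNatAt F a) * ‖G z‖
      ≤ Real.exp (C * (1 + 4 * R) ^ (3 / 2 : ℝ)) := by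
  set n := ∑ a ∈ S, analyticOrderNatAt F a
  rw [mul_comm, ← le_div_iff₀ (by positivity)]
  refine norm_le_of_forall_mem_frontier_norm_le (U := ball 0 (4 * R)) isBounded_ball
    hG.diffContOnCl (fun w hw => ?_) ?_
  · rw [frontier_ball _ (by positivity)] at hw
    have hw' : ‖w‖ = 4 * R := by simpa using hw
    have h1 := hC w
    rw [hFG w, hw', norm_mul] at h1
    rw [le_div_iff₀ (by positivity), mul_comm]
    refine le_trans (mul_le_mul_of_nonneg_right ?_ (norm_nonneg _)) h1
    rw [norm_prod, ← Finset.prod_pow_eq_pow_sum]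
    refine Finset.prod_le_prod (fun _ _ => by positivity) (fun a ha => ?_)
    rw [norm_pow]
    refine pow_le_pow_left₀ (by norm_num) ?_ _
    have ha0 : a ≠ 0 := fun h => hS0 (h ▸ ha)
    have h2 : 4 ≤ ‖w / a‖ := by
      rw [norm_div, le_div_iff₀ (norm_pos_iff.2 ha0), hw']
      linarith [hS a ha]
    have h3 := norm_sub_norm_le (w / a) 1
    rw [norm_one, norm_sub_rev] at h3
    linarith
  · rw [closure_ball _ (by positivity)]
    simpa using hz

theorem sum_order_le {C : ℝ} (hF : Differentiable ℂ F) (h0 : F 0 = 1)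
    (hC : ∀ z, ‖F z‖ ≤ Real.exp (C * (1 + ‖z‖) ^ (3 / 2 : ℝ)))
    {R : ℝ} (hR : 0 < R) {S : Finset ℂ} (hS0 : (0 : ℂ) ∉ S) (hS : ∀ a ∈ S, ‖a‖ ≤ R) :
    ((∑ a ∈ S, analyticOrderNatAt F a : ℕ) : ℝ) ≤ C * (1 + 4 * R) ^ (3 / 2 : ℝ) := by
  obtain ⟨G, hG, -, hFG⟩ := exists_eq_prod_mul hF (by simp [h0]) S hS0
  have hG0 : G 0 = 1 := by
    have := hFG 0
    simpa [h0] using this.symm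
  have h1 := norm_quotient_mul_le hC hR hS0 hS hG hFG (z := 0) (by simp; positivity)
  rw [hG0, norm_one, mul_one] at h1
  have h3 : Real.exp 1 ≤ 3 := by linarith [Real.exp_one_lt_d9]
  have h4 := (pow_le_pow_left₀ (Real.exp_pos 1).le h3 (∑ a ∈ S, analyticOrderNatAt F a)).trans h1
  rwa [← Real.exp_nat_mul, mul_one, Real.exp_le_exp] at h4

theorem summable_order_div_sq {C : ℝ} (hF : Differentiable ℂ F) (h0 : F 0 = 1)
    (hC : ∀ z, ‖F z‖ ≤ Real.exp (C * (1 + ‖z‖) ^ (3 / 2 : ℝ))) :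
    Summable fun ρ : {z : ℂ | F z = 0} =>
      (analyticOrderNatAt F ρ : ℝ) / (1 + ‖(ρ : ℂ)‖) ^ 2 := by
  classical
  have hC0 : 0 ≤ C := by
    have := sum_order_le hF h0 hC one_pos (S := ∅) (by simp) (by simp)
    have h5 : (0 : ℝ) < (1 + 4 * 1) ^ (3 / 2 : ℝ) := by positivity
    simp only [Finset.sum_empty, Nat.cast_zero] at this
    exact nonneg_of_mul_nonneg_left this h5
  let k : {z : ℂ | F z = 0} → ℕ := fun ρ => Nat.log 2 ⌊1 + ‖(ρ : ℂ)‖⌋₊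
  have hk1 : ∀ ρ : {z : ℂ | F z = 0}, (2 : ℝ) ^ k ρ ≤ 1 + ‖(ρ : ℂ)‖ := by
    intro ρ
    have h1 : ⌊1 + ‖(ρ : ℂ)‖⌋₊ ≠ 0 := by
      have : 1 ≤ ⌊1 + ‖(ρ : ℂ)‖⌋₊ := Nat.le_floor (by simp)
      omega
    have h2 := Nat.pow_log_le_self 2 h1
    calc (2 : ℝ) ^ k ρ = ((2 ^ k ρ : ℕ) : ℝ) := by push_cast; rfl
      _ ≤ (⌊1 + ‖(ρ : ℂ)‖⌋₊ : ℝ) := by exact_mod_cast h2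
      _ ≤ _ := Nat.floor_le (by positivity)
  have hk2 : ∀ ρ : {z : ℂ | F z = 0}, ‖(ρ : ℂ)‖ ≤ (2 : ℝ) ^ (k ρ + 1) := by
    intro ρ
    have h2 := Nat.lt_pow_succ_log_self (b := 2) (by norm_num) ⌊1 + ‖(ρ : ℂ)‖⌋₊
    have h3 := Nat.lt_floor_add_one (1 + ‖(ρ : ℂ)‖)
    have h4 : (⌊1 + ‖(ρ : ℂ)‖⌋₊ : ℝ) + 1 ≤ (2 : ℝ) ^ (k ρ + 1) := by
      exact_mod_cast h2
    linarith
  let q : ℝ := 2 ^ (3 / 2 : ℝ) / 4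
  have hq0 : 0 < q := by positivity
  have hq1 : q < 1 := by
    rw [div_lt_one (by norm_num)]
    calc (2 : ℝ) ^ (3 / 2 : ℝ) < 2 ^ (2 : ℝ) :=
          Real.rpow_lt_rpow_of_exponent_lt (by norm_num) (by norm_num)
      _ = 4 := by norm_num
  let D : ℝ := C * 10 ^ (3 / 2 : ℝ)
  have hsumq : Summable fun j : ℕ => D * q ^ j :=
    (summable_geometric_of_lt_one hq0.le hq1).mul_left _
  refine summable_of_sum_le (c := ∑' j, D * q ^ j) (fun _ => by positivity) (fun S => ?_)
  let N := S.sup k + 1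
  have hmap : ∀ ρ ∈ S, k ρ ∈ Finset.range N := fun ρ hρ => by
    rw [Finset.mem_range, Nat.lt_succ_iff]
    exact Finset.le_sup hρ
  rw [← Finset.sum_fiberwise_of_maps_to hmap]
  refine le_trans (Finset.sum_le_sum fun j _ => ?_)
    (hsumq.sum_le_tsum (Finset.range N) (fun j _ => by positivity))
  let A : Finset {z : ℂ | F z = 0} := S.filter fun ρ => k ρ = j
  have h1 : ∑ ρ ∈ A, (analyticOrderNatAt F ρ : ℝ) / (1 + ‖(ρ : ℂ)‖) ^ 2
      ≤ ∑ ρ ∈ A, (analyticOrderNatAt F ρ : ℝ) / 4 ^ j := by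
    refine Finset.sum_le_sum fun ρ hρ => ?_
    have hkj : k ρ = j := (Finset.mem_filter.1 hρ).2
    have h2 := hk1 ρ
    rw [hkj] at h2
    have h3 : (4 : ℝ) ^ j ≤ (1 + ‖(ρ : ℂ)‖) ^ 2 := by
      calc (4 : ℝ) ^ j = (2 ^ j) ^ 2 := by rw [← pow_mul, mul_comm, pow_mul]; norm_num
        _ ≤ _ := pow_le_pow_left₀ (by positivity) h2 2
    exact div_le_div_of_nonneg_left (by positivity) (by positivity) h3
  refine h1.trans ?_
  rw [← Finset.sum_div, div_le_iff₀ (by positivity)]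
  have h4 := sum_order_le hF h0 hC (R := 2 ^ (j + 1)) (by positivity)
    (S := A.map (Function.Embedding.subtype _)) (by simp [h0]) (by
      intro a ha
      obtain ⟨ρ, hρ, rfl⟩ := Finset.mem_map.1 ha
      have := hk2 ρ
      rwa [(Finset.mem_filter.1 hρ).2] at this)
  rw [Finset.sum_map] at h4
  push_cast at h4
  refine h4.trans ?_
  have h5 : (1 + 4 * 2 ^ (j + 1) : ℝ) ≤ 10 * 2 ^ j := by
    have : (1 : ℝ) ≤ 2 ^ j := one_le_pow₀ (by norm_num)
    rw [pow_succ]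
    linarith
  have h6 : (1 + 4 * 2 ^ (j + 1) : ℝ) ^ (3 / 2 : ℝ)
      ≤ 10 ^ (3 / 2 : ℝ) * (2 ^ (3 / 2 : ℝ)) ^ j := by
    refine (Real.rpow_le_rpow (by positivity) h5 (by norm_num)).trans (le_of_eq ?_)
    rw [Real.mul_rpow (by norm_num) (by positivity)]
    congr 1
    rw [← Real.rpow_natCast, ← Real.rpow_natCast, ← Real.rpow_mul (by norm_num),
      ← Real.rpow_mul (by norm_num), mul_comm]
  have h7 : D * q ^ j * 4 ^ j = C * (10 ^ (3 / 2 : ℝ) * (2 ^ (3 / 2 : ℝ)) ^ j) := by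
    simp only [D, q]
    rw [div_pow]
    field_simp
  rw [h7]
  exact mul_le_mul_of_nonneg_left h6 hC0

theorem summable_order_mul_sub {C : ℝ} (hF : Differentiable ℂ F) (h0 : F 0 = 1)
    (hC : ∀ z, ‖F z‖ ≤ Real.exp (C * (1 + ‖z‖) ^ (3 / 2 : ℝ))) (s t : ℂ) :
    Summable fun ρ : {z : ℂ | F z = 0} =>
      (analyticOrderNatAt F ρ : ℂ) * (1 / (s - ρ) - 1 / (t - ρ)) := by
  refine Summable.of_norm_bounded_eventually
    ((summable_order_div_sq hF h0 hC).mul_left (‖t - s‖ * (2 * 2))) ?_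
  let B : ℝ := 2 * (‖s‖ + ‖t‖) + 1
  have hfin : {ρ : {z : ℂ | F z = 0} | ‖(ρ : ℂ)‖ ≤ B}.Finite := by
    refine Set.Finite.of_finite_image (f := Subtype.val)
      ((finite_zeros_inter_closedBall hF (by simp [h0]) B).subset ?_)
      Subtype.val_injective.injOn
    rintro _ ⟨ρ, hρ, rfl⟩
    exact ⟨ρ.2, hρ⟩
  filter_upwards [hfin.compl_mem_cofinite] with ρ hρ
  have hρ' : B < ‖(ρ : ℂ)‖ := not_le.1 hρ
  have key : ∀ u : ℂ, ‖u‖ ≤ ‖s‖ + ‖t‖ → (1 + ‖(ρ : ℂ)‖) / 2 ≤ ‖u - ρ‖ := by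
    intro u hu
    have h1 := norm_sub_norm_le (ρ : ℂ) u
    rw [norm_sub_rev] at h1
    simp only [B] at hρ'
    linarith
  have hs := key s (by linarith [norm_nonneg t])
  have ht := key t (by linarith [norm_nonneg s])
  have hpos : 0 < (1 + ‖(ρ : ℂ)‖) / 2 := by positivity
  have hs0 : s - ρ ≠ 0 := norm_pos_iff.1 (hpos.trans_le hs)
  have ht0 : t - ρ ≠ 0 := norm_pos_iff.1 (hpos.trans_le ht)
  have heq : 1 / (s - (ρ : ℂ)) - 1 / (t - ρ) = (t - s) / ((s - ρ) * (t - ρ)) := by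
    field_simp
    ring
  rw [norm_mul, Complex.norm_natCast, heq, norm_div, norm_mul]
  have h2 : ‖t - s‖ / (‖s - (ρ : ℂ)‖ * ‖t - ρ‖)
      ≤ ‖t - s‖ / ((1 + ‖(ρ : ℂ)‖) / 2 * ((1 + ‖(ρ : ℂ)‖) / 2)) := by
    gcongr
  refine (mul_le_mul_of_nonneg_left h2 (by positivity)).trans (le_of_eq ?_)
  field_simp

theorem hasSum_order_mul_sub {C : ℝ} (hF : Differentiable ℂ F) (h0 : F 0 = 1)
    (hC : ∀ z, ‖F z‖ ≤ Real.exp (C * (1 + ‖z‖) ^ (3 / 2 : ℝ))) {s t : ℂ} (hs : F s ≠ 0)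
    (ht : F t ≠ 0) :
    HasSum (fun ρ : {z : ℂ | F z = 0} =>
      (analyticOrderNatAt F ρ : ℂ) * (1 / (s - ρ) - 1 / (t - ρ)))
      (logDeriv F s - logDeriv F t) := by
  classical
  have hsum := summable_order_mul_sub hF h0 hC s t
  let a : {z : ℂ | F z = 0} → ℂ := fun ρ =>
    (analyticOrderNatAt F ρ : ℂ) * (1 / (s - ρ) - 1 / (t - ρ))
  have hfin : ∀ n : ℕ, {ρ : {z : ℂ | F z = 0} | ‖(ρ : ℂ)‖ ≤ (n : ℝ)}.Finite := fun n => by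
    refine Set.Finite.of_finite_image (f := Subtype.val)
      ((finite_zeros_inter_closedBall hF (by simp [h0]) n).subset ?_)
      Subtype.val_injective.injOn
    rintro _ ⟨ρ, hρ, rfl⟩
    exact ⟨ρ.2, hρ⟩
  let S : ℕ → Finset {z : ℂ | F z = 0} := fun n => (hfin n).toFinset
  have hS : Tendsto S atTop atTop := by
    refine tendsto_atTop_finset_of_monotone (fun n m hnm ρ hρ => ?_) (fun ρ => ?_)
    · simp only [S, Set.Finite.mem_toFinset, mem_ofPred_eq] at hρ ⊢
      exact hρ.trans (by exact_mod_cast hnm)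
    · obtain ⟨n, hn⟩ := exists_nat_ge ‖(ρ : ℂ)‖
      exact ⟨n, by simpa [S] using hn⟩
  have h1 : Tendsto (fun n => ∑ ρ ∈ S n, a ρ) atTop (𝓝 (∑' ρ, a ρ)) := hsum.hasSum.comp hS
  suffices h2 : Tendsto (fun n => ∑ ρ ∈ S n, a ρ) atTop (𝓝 (logDeriv F s - logDeriv F t)) by
    rw [← tendsto_nhds_unique h1 h2]
    exact hsum.hasSum
  have hC0 : 0 ≤ C := by
    have := sum_order_le hF h0 hC one_pos (S := ∅) (by simp) (by simp)
    have h5 : (0 : ℝ) < (1 + 4 * 1) ^ (3 / 2 : ℝ) := by positivity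
    simp only [Finset.sum_empty, Nat.cast_zero] at this
    exact nonneg_of_mul_nonneg_left this h5
  rw [tendsto_iff_norm_sub_tendsto_zero]
  have hlim : Tendsto (fun n : ℕ => 64 * ((C + 1) * 5 ^ (3 / 2 : ℝ)) * ‖s - t‖ *
      (n : ℝ) ^ (-(1 / 2) : ℝ)) atTop (𝓝 0) := by
    have := (tendsto_rpow_neg_atTop (y := 1 / 2) (by norm_num)).comp
      (tendsto_natCast_atTop_atTop (R := ℝ))
    simpa using this.const_mul (64 * ((C + 1) * 5 ^ (3 / 2 : ℝ)) * ‖s - t‖)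
  refine squeeze_zero' (Eventually.of_forall fun _ => norm_nonneg _) ?_ hlim
  obtain ⟨n₀, hn₀⟩ := exists_nat_gt (8 * (‖s‖ + ‖t‖) + 1)
  filter_upwards [eventually_ge_atTop n₀] with n hn
  have hnR : 8 * (‖s‖ + ‖t‖) + 1 < (n : ℝ) := hn₀.trans_le (by exact_mod_cast hn)
  have hn1 : 1 < (n : ℝ) := by linarith [norm_nonneg s, norm_nonneg t]
  have hnpos : 0 < (n : ℝ) := by linarith
  let A : Finset ℂ := (S n).map (Function.Embedding.subtype _)
  have hA : ∀ z, z ∈ A ↔ F z = 0 ∧ ‖z‖ ≤ n := by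
    intro z
    rw [Finset.mem_map]
    constructor
    · rintro ⟨ρ, hρ, rfl⟩
      exact ⟨ρ.2, (hfin n).mem_toFinset.1 hρ⟩
    · rintro ⟨h3, h4⟩
      exact ⟨⟨z, h3⟩, (hfin n).mem_toFinset.2 h4, rfl⟩
  have hA0 : (0 : ℂ) ∉ A := by simp [hA, h0]
  obtain ⟨G, hG, hGA, hFG⟩ := exists_eq_prod_mul hF (by simp [h0]) A hA0
  have hG0 : G 0 = 1 := by
    have := hFG 0
    simpa [h0] using this.symm
  have hGne : ∀ z ∈ ball (0 : ℂ) n, G z ≠ 0 := by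
    intro z hz hGz
    have hz' : ‖z‖ < n := by simpa using hz
    have hFz : F z = 0 := by rw [hFG, hGz, mul_zero]
    exact hGA z ((hA z).2 ⟨hFz, hz'.le⟩) hGz
  have hGle : ∀ z ∈ ball (0 : ℂ) n,
      ‖G z‖ ≤ Real.exp ((C + 1) * (1 + 4 * (n : ℝ)) ^ (3 / 2 : ℝ)) := by
    intro z hz
    have hz' : ‖z‖ < n := by simpa using hz
    have h3 := norm_quotient_mul_le hC hnpos hA0 (fun a ha => ((hA a).1 ha).2) hG hFG
      (z := z) (by linarith)
    have h4 : (1 : ℝ) ≤ 3 ^ (∑ a ∈ A, analyticOrderNatAt F a) := one_le_pow₀ (by norm_num)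
    refine (le_mul_of_one_le_left (norm_nonneg _) h4).trans (h3.trans ?_)
    rw [Real.exp_le_exp]
    gcongr
    linarith
  have hlog : ∀ u, F u ≠ 0 → logDeriv F u
      = (∑ ρ ∈ S n, (analyticOrderNatAt F ρ : ℂ) * (1 / (u - ρ))) + logDeriv G u := by
    intro u hu
    have hFu := hFG u
    have hp : (∏ a ∈ A, (1 - u / a) ^ analyticOrderNatAt F a) ≠ 0 := by
      intro h
      rw [h, zero_mul] at hFu
      exact hu hFu
    have hGu : G u ≠ 0 := by
      intro h
      rw [h, mul_zero] at hFu
      exact hu hFu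
    have hd : ∀ a ∈ A, DifferentiableAt ℂ (fun z => (1 - z / a) ^ analyticOrderNatAt F a) u :=
      fun a _ => by fun_prop
    have hFeq : F = fun z => (∏ a ∈ A, (1 - z / a) ^ analyticOrderNatAt F a) * G z :=
      funext hFG
    have hstep : logDeriv F u
        = logDeriv (fun z => (∏ a ∈ A, (1 - z / a) ^ analyticOrderNatAt F a) * G z) u :=
      congrArg (fun f => logDeriv f u) hFeq
    rw [hstep, logDeriv_mul u hp hGu (DifferentiableAt.fun_finsetProd hd) (hG u)]
    congr 1
    rw [logDeriv_prod (fun a ha => (Finset.prod_ne_zero_iff.1 hp) a ha) hd, Finset.sum_map]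
    refine Finset.sum_congr rfl fun ρ hρ => ?_
    rw [logDeriv_fun_pow (by fun_prop)]
    congr 1
    have hρ0 : (ρ : ℂ) ≠ 0 := by
      intro h
      have := ρ.2
      rw [h] at this
      simp [h0] at this
    have huρ : u - ρ ≠ 0 := by
      intro h
      rw [sub_eq_zero] at h
      exact hu (h ▸ ρ.2)
    have hderiv : HasDerivAt (fun z : ℂ => 1 - z / (ρ : ℂ)) (-(1 / (ρ : ℂ))) u := by
      simpa using ((hasDerivAt_id u).div_const (ρ : ℂ)).const_sub 1
    have hne : 1 - u / (ρ : ℂ) ≠ 0 := by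
      intro h
      apply huρ
      field_simp at h
      linear_combination -h
    change logDeriv (fun z : ℂ => 1 - z / (ρ : ℂ)) u = _
    rw [logDeriv_apply, hderiv.deriv]
    rw [div_eq_div_iff hne huρ]
    field_simp
    ring
  have hdiff : ∑ ρ ∈ S n, a ρ - (logDeriv F s - logDeriv F t)
      = -(logDeriv G s - logDeriv G t) := by
    rw [hlog s hs, hlog t ht]
    simp only [a, mul_sub, Finset.sum_sub_distrib]
    ring
  rw [hdiff, norm_neg]
  refine (norm_logDeriv_sub_le hG hG0 hnpos (M := (C + 1) * (1 + 4 * (n : ℝ)) ^ (3 / 2 : ℝ))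
    (by positivity) hGne hGle (by linarith [norm_nonneg t]) (by linarith [norm_nonneg s])).trans ?_
  have h5 : (1 + 4 * (n : ℝ)) ^ (3 / 2 : ℝ) ≤ 5 ^ (3 / 2 : ℝ) * (n : ℝ) ^ (3 / 2 : ℝ) := by
    rw [← Real.mul_rpow (by norm_num) hnpos.le]
    exact Real.rpow_le_rpow (by positivity) (by linarith) (by norm_num)
  have h6 : (n : ℝ) ^ (3 / 2 : ℝ) / (n : ℝ) ^ 2 = (n : ℝ) ^ (-(1 / 2) : ℝ) := by
    rw [← Real.rpow_natCast, ← Real.rpow_sub hnpos]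
    norm_num
  calc 64 * ((C + 1) * (1 + 4 * (n : ℝ)) ^ (3 / 2 : ℝ)) / (n : ℝ) ^ 2 * ‖s - t‖
      ≤ 64 * ((C + 1) * (5 ^ (3 / 2 : ℝ) * (n : ℝ) ^ (3 / 2 : ℝ))) / (n : ℝ) ^ 2 * ‖s - t‖ := by
        gcongr
    _ = 64 * ((C + 1) * 5 ^ (3 / 2 : ℝ)) * ‖s - t‖ *
        ((n : ℝ) ^ (3 / 2 : ℝ) / (n : ℝ) ^ 2) := by ring
    _ = _ := by rw [h6]

end EntireFunctionsOfFiniteOrder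

end LinearStatistics

namespace LinearStatistics

section Xi

open Complex Metric Topology Set

/-- The entire function `s(s-1)π^{-s/2}Γ(s/2)ζ(s)`. -/
noncomputable def xi (s : ℂ) : ℂ := s * (s - 1) * completedRiemannZeta₀ s + 1

theorem differentiable_xi : Differentiable ℂ xi := by
  have := differentiable_completedZeta₀
  unfold xi
  fun_prop

theorem xi_zero : xi 0 = 1 := by simp [xi]

theorem xi_one_sub (s : ℂ) : xi (1 - s) = xi s := by
  simp only [xi, completedRiemannZeta₀_one_sub]
  ring

theorem xi_eq_mul_riemannZeta {s : ℂ} (hs : 0 < s.re) (hs1 : s ≠ 1) :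
    xi s = s * (s - 1) * Gammaℝ s * riemannZeta s := by
  have h0 : s ≠ 0 := by
    rintro rfl
    simp at hs
  have h1 : 1 - s ≠ 0 := sub_ne_zero.2 (Ne.symm hs1)
  rw [riemannZeta_def_of_ne_zero h0, mul_assoc _ (Gammaℝ s),
    mul_div_cancel₀ _ (Gammaℝ_ne_zero_of_re_pos hs), completedRiemannZeta_eq, xi]
  field_simp
  ring

theorem xi_ne_zero_of_one_le_re {s : ℂ} (hs : 1 ≤ s.re) : xi s ≠ 0 := by
  by_cases hs1 : s = 1
  · simp [hs1, xi]
  · have h0 : s ≠ 0 := by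
      rintro rfl
      norm_num at hs
    have hpos : 0 < s.re := by linarith
    rw [xi_eq_mul_riemannZeta hpos hs1]
    exact mul_ne_zero (mul_ne_zero (mul_ne_zero h0 (sub_ne_zero.2 hs1))
      (Gammaℝ_ne_zero_of_re_pos hpos)) (riemannZeta_ne_zero_of_one_le_re hs)

theorem xi_eq_zero_iff (s : ℂ) : xi s = 0 ↔ s ∈ nontrivialZeros := by
  constructor
  · intro h
    have h1 : s.re < 1 := by
      by_contra h1
      exact xi_ne_zero_of_one_le_re (not_lt.1 h1) h
    have h2 : 0 < s.re := by
      by_contra h2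
      have : xi (1 - s) ≠ 0 := xi_ne_zero_of_one_le_re (by simp; linarith)
      rw [xi_one_sub] at this
      exact this h
    have hs1 : s ≠ 1 := by
      rintro rfl
      simp at h1
    have h0 : s ≠ 0 := by
      rintro rfl
      simp at h2
    rw [xi_eq_mul_riemannZeta h2 hs1] at h
    refine ⟨(mul_eq_zero.1 h).resolve_left ?_, h2, h1⟩
    exact mul_ne_zero (mul_ne_zero h0 (sub_ne_zero.2 hs1)) (Gammaℝ_ne_zero_of_re_pos h2)
  · rintro ⟨h, h2, h1⟩
    have hs1 : s ≠ 1 := by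
      rintro rfl
      simp at h1
    rw [xi_eq_mul_riemannZeta h2 hs1, h, mul_zero]

theorem setOf_xi_eq_zero : {z : ℂ | xi z = 0} = nontrivialZeros := by
  ext s
  exact xi_eq_zero_iff s

theorem differentiableAt_Gammaℝ {s : ℂ} (hs : 0 < s.re) : DifferentiableAt ℂ Gammaℝ s := by
  have h1 : DifferentiableAt ℂ Gamma (s / 2) := by
    refine differentiableAt_Gamma _ fun m h => ?_
    have := congrArg Complex.re h
    simp at this
    linarith [(Nat.cast_nonneg m : (0 : ℝ) ≤ m)]
  have h2 : DifferentiableAt ℂ (fun s : ℂ => (Real.pi : ℂ) ^ (-s / 2)) s := by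
    refine DifferentiableAt.const_cpow (by fun_prop) (Or.inl ?_)
    exact_mod_cast Real.pi_ne_zero
  exact h2.mul (h1.comp (f := fun s : ℂ => s / 2) s (by fun_prop))

theorem multiplicity_eq_order_xi {ρ : ℂ} (hρ : ρ ∈ nontrivialZeros) :
    multiplicity ρ = analyticOrderNatAt xi ρ := by
  obtain ⟨hz, h0, h1⟩ := hρ
  have hρ1 : ρ ≠ 1 := by
    rintro rfl
    simp at h1
  have hρ0 : ρ ≠ 0 := by
    rintro rfl
    simp at h0
  have hopen : IsOpen {s : ℂ | 0 < s.re ∧ s ≠ 1} :=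
    (isOpen_lt continuous_const continuous_re).inter isOpen_ne
  have hmem : {s : ℂ | 0 < s.re ∧ s ≠ 1} ∈ 𝓝 ρ := hopen.mem_nhds ⟨h0, hρ1⟩
  let u : ℂ → ℂ := fun s => s * (s - 1) * Gammaℝ s
  have hu : AnalyticAt ℂ u ρ := by
    have : DifferentiableOn ℂ u {s : ℂ | 0 < s.re ∧ s ≠ 1} := fun s hs =>
      (DifferentiableAt.mul (by fun_prop) (differentiableAt_Gammaℝ hs.1)).differentiableWithinAt
    exact this.analyticAt hmem
  have hζ : AnalyticAt ℂ riemannZeta ρ := by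
    have : DifferentiableOn ℂ riemannZeta {s : ℂ | 0 < s.re ∧ s ≠ 1} := fun s hs =>
      (differentiableAt_riemannZeta hs.2).differentiableWithinAt
    exact this.analyticAt hmem
  have huρ : u ρ ≠ 0 :=
    mul_ne_zero (mul_ne_zero hρ0 (sub_ne_zero.2 hρ1)) (Gammaℝ_ne_zero_of_re_pos h0)
  have heq : xi =ᶠ[𝓝 ρ] u * riemannZeta := by
    filter_upwards [hmem] with s hs
    exact xi_eq_mul_riemannZeta hs.1 hs.2
  simp only [multiplicity, analyticOrderNatAt]
  rw [analyticOrderAt_congr heq, analyticOrderAt_mul hu hζ, hu.analyticOrderAt_eq_zero.2 huρ,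
    zero_add]

theorem one_sub_mem_nontrivialZeros {ρ : ℂ} (hρ : ρ ∈ nontrivialZeros) :
    1 - ρ ∈ nontrivialZeros := by
  rw [← xi_eq_zero_iff, xi_one_sub, xi_eq_zero_iff]
  exact hρ

theorem multiplicity_one_sub {ρ : ℂ} (hρ : ρ ∈ nontrivialZeros) :
    multiplicity (1 - ρ) = multiplicity ρ := by
  rw [multiplicity_eq_order_xi hρ, multiplicity_eq_order_xi (one_sub_mem_nontrivialZeros hρ)]
  have hd : HasDerivAt (fun s : ℂ => 1 - s) (-1) ρ := (hasDerivAt_id ρ).const_sub 1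
  have h1 : analyticOrderAt (xi ∘ fun s : ℂ => 1 - s) ρ = analyticOrderAt xi (1 - ρ) :=
    analyticOrderAt_comp_of_deriv_ne_zero (g := fun s : ℂ => 1 - s) (by fun_prop)
      (by rw [hd.deriv]; norm_num)
  have h2 : (xi ∘ fun s : ℂ => 1 - s) = xi := funext xi_one_sub
  rw [h2] at h1
  simp only [analyticOrderNatAt, h1]

/-- The symmetry `ρ ↦ 1 - ρ` of the zeros. -/
noncomputable def reflectZero : nontrivialZeros ≃ nontrivialZeros where
  toFun ρ := ⟨1 - ρ, one_sub_mem_nontrivialZeros ρ.2⟩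
  invFun ρ := ⟨1 - ρ, one_sub_mem_nontrivialZeros ρ.2⟩
  left_inv ρ := Subtype.ext (by simp)
  right_inv ρ := Subtype.ext (by simp)

theorem norm_Gamma_le_Gamma_re {s : ℂ} (hs : 0 < s.re) : ‖Gamma s‖ ≤ Real.Gamma s.re := by
  rw [Complex.Gamma_eq_integral hs, Real.Gamma_eq_integral hs, GammaIntegral]
  refine (norm_integral_le_integral_norm _).trans (le_of_eq ?_)
  refine setIntegral_congr_fun measurableSet_Ioi fun x hx => ?_
  simp only [norm_mul, norm_cpow_eq_rpow_re_of_pos hx]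
  rw [Complex.norm_real, Real.norm_of_nonneg (Real.exp_pos _).le]
  simp

theorem Gamma_le_exp {x : ℝ} (hx : 2 ≤ x) :
    Real.Gamma x ≤ Real.exp (2 * (1 + x) ^ (3 / 2 : ℝ)) := by
  set n := ⌈x⌉₊
  have hn : x ≤ n := Nat.le_ceil x
  have hn2 : (n : ℝ) ≤ 1 + x := by
    have := Nat.ceil_lt_add_one (show 0 ≤ x by linarith)
    linarith
  have hn0 : (0 : ℝ) < n := by linarith
  have h1 : Real.Gamma x ≤ Real.Gamma (n + 1) :=
    Real.Gamma_strictMonoOn_Ici.monotoneOn hx (show (2 : ℝ) ≤ n + 1 by linarith) (by linarith)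
  rw [Real.Gamma_nat_eq_factorial] at h1
  have h2 : (n.factorial : ℝ) ≤ (n : ℝ) ^ n := by exact_mod_cast Nat.factorial_le_pow n
  have h3 : (n : ℝ) ^ n = Real.exp (n * Real.log n) := by
    rw [mul_comm, Real.exp_mul, Real.exp_log hn0, Real.rpow_natCast]
  have h4 : Real.log n ≤ (n : ℝ) ^ (1 / 2 : ℝ) / (1 / 2) :=
    Real.log_le_rpow_div hn0.le (by norm_num)
  have h5 : (n : ℝ) * (n : ℝ) ^ (1 / 2 : ℝ) = (n : ℝ) ^ (3 / 2 : ℝ) := by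
    rw [← Real.rpow_one_add' hn0.le (by norm_num)]
    norm_num
  refine h1.trans (h2.trans ?_)
  rw [h3, Real.exp_le_exp]
  calc (n : ℝ) * Real.log n ≤ n * ((n : ℝ) ^ (1 / 2 : ℝ) / (1 / 2)) := by gcongr
    _ = 2 * (n : ℝ) ^ (3 / 2 : ℝ) := by rw [← h5]; ring
    _ ≤ _ := by gcongr

theorem exists_norm_completedRiemannZeta₀_le :
    ∃ B : ℝ, ∀ s : ℂ, 0 ≤ s.re → s.re ≤ 4 → ‖completedRiemannZeta₀ s‖ ≤ B := by
  let P := HurwitzZeta.hurwitzEvenFEPair 0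
  let φ := P.f_modif
  have hconv : ∀ s : ℂ, MellinConvergent φ s := fun s =>
    (P.isStrongFEPair_toStrongFEPair.hasMellin s).1
  have h0 := (hconv 0).norm
  have h2 := (hconv 2).norm
  refine ⟨∫ t in Ioi (0 : ℝ), (‖(t : ℂ) ^ ((0 : ℂ) - 1) • φ t‖ + ‖(t : ℂ) ^ ((2 : ℂ) - 1) • φ t‖),
    fun s hs0 hs4 => ?_⟩
  have heq : completedRiemannZeta₀ s = mellin φ (s / 2) / 2 := rfl
  have h5 : ‖mellin φ (s / 2)‖ ≤
      ∫ t in Ioi (0 : ℝ), (‖(t : ℂ) ^ ((0 : ℂ) - 1) • φ t‖ + ‖(t : ℂ) ^ ((2 : ℂ) - 1) • φ t‖) := by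
    refine norm_integral_le_of_norm_le (h0.add h2) ?_
    filter_upwards [ae_restrict_mem measurableSet_Ioi] with t ht
    have ht' : 0 < t := ht
    simp only [norm_smul, norm_cpow_eq_rpow_re_of_pos ht']
    rw [← add_mul]
    refine mul_le_mul_of_nonneg_right ?_ (norm_nonneg _)
    simp only [sub_re, one_re, zero_sub, div_ofNat_re, re_ofNat]
    rcases le_total 1 t with h | h
    · refine (Real.rpow_le_rpow_of_exponent_le h (show s.re / 2 - 1 ≤ 2 - 1 by linarith)).trans ?_
      exact le_add_of_nonneg_left (Real.rpow_nonneg ht'.le _)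
    · refine (Real.rpow_le_rpow_of_exponent_ge ht' h
        (show -1 ≤ s.re / 2 - 1 by linarith)).trans ?_
      exact le_add_of_nonneg_right (Real.rpow_nonneg ht'.le _)
  rw [heq, norm_div]
  have : ‖(2 : ℂ)‖ = 2 := by simp
  rw [this]
  linarith [norm_nonneg (mellin φ (s / 2))]

theorem norm_riemannZeta_le {s : ℂ} (hs : 2 ≤ s.re) :
    ‖riemannZeta s‖ ≤ ∑' n : ℕ, 1 / ((n : ℝ) + 1) ^ 2 := by
  rw [zeta_eq_tsum_one_div_nat_add_one_cpow (by linarith)]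
  have hsum : Summable fun n : ℕ => 1 / ((n : ℝ) + 1) ^ 2 := by
    have := (summable_nat_add_iff 1).2 (Real.summable_one_div_nat_pow.2 (one_lt_two))
    simpa using this
  refine tsum_of_norm_bounded hsum.hasSum fun n => ?_
  have hn : (0 : ℝ) < n + 1 := by positivity
  have h1 : ‖((n : ℂ) + 1) ^ s‖ = ((n : ℝ) + 1) ^ s.re := by
    have := norm_cpow_eq_rpow_re_of_pos hn s
    push_cast at this
    exact this
  rw [norm_div, norm_one, h1]
  refine one_div_le_one_div_of_le (by positivity) ?_
  rw [← Real.rpow_natCast]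
  exact Real.rpow_le_rpow_of_exponent_le (by linarith [(Nat.cast_nonneg n : (0 : ℝ) ≤ n)])
    (by simpa using hs)

theorem exists_norm_xi_le :
    ∃ C : ℝ, ∀ z, ‖xi z‖ ≤ Real.exp (C * (1 + ‖z‖) ^ (3 / 2 : ℝ)) := by
  obtain ⟨B, hB⟩ := exists_norm_completedRiemannZeta₀_le
  have hB0 : 0 ≤ B := (norm_nonneg _).trans (hB 0 (by simp) (by simp))
  set D := ∑' n : ℕ, 1 / ((n : ℝ) + 1) ^ 2
  have hD0 : 0 ≤ D := tsum_nonneg fun n => by positivity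
  have hpow : ∀ z : ℂ, 1 + ‖z‖ ≤ (1 + ‖z‖) ^ (3 / 2 : ℝ) := fun z =>
    Real.self_le_rpow_of_one_le (by linarith [norm_nonneg z]) (by norm_num)
  have hlin : ∀ z : ℂ, ‖z‖ * ‖z - 1‖ ≤ Real.exp (2 * (1 + ‖z‖)) := by
    intro z
    have h1 : ‖z - 1‖ ≤ ‖z‖ + 1 := by simpa using norm_sub_le z 1
    have h2 := Real.add_one_le_exp ‖z‖
    calc ‖z‖ * ‖z - 1‖ ≤ (1 + ‖z‖) * (1 + ‖z‖) := by gcongr <;> linarith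
      _ ≤ Real.exp (1 + ‖z‖) * Real.exp (1 + ‖z‖) := by
          have := Real.add_one_le_exp (1 + ‖z‖)
          gcongr <;> linarith
      _ = _ := by rw [← Real.exp_add]; ring_nf
  have hright : ∀ z : ℂ, 0 ≤ z.re →
      ‖xi z‖ ≤ Real.exp ((4 + B + 1 + D) * (1 + ‖z‖) ^ (3 / 2 : ℝ)) := by
    intro z hz
    have hp := hpow z
    have hz1 : 1 ≤ 1 + ‖z‖ := by linarith [norm_nonneg z]
    set Y := (1 + ‖z‖) ^ (3 / 2 : ℝ)
    rcases le_total z.re 4 with h4 | h4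
    · have h1 : ‖xi z‖ ≤ Real.exp (2 * (1 + ‖z‖)) * B + 1 := by
        refine (norm_add_le _ _).trans ?_
        rw [norm_one, norm_mul, norm_mul]
        gcongr
        · exact hlin z
        · exact hB z hz h4
      have h2 : Real.exp (2 * (1 + ‖z‖)) * B + 1 ≤ Real.exp (2 * (1 + ‖z‖)) * (B + 1) := by
        have := Real.one_le_exp (show 0 ≤ 2 * (1 + ‖z‖) by positivity)
        nlinarith
      have h3 : B + 1 ≤ Real.exp B := Real.add_one_le_exp B
      refine h1.trans (h2.trans ?_)
      calc Real.exp (2 * (1 + ‖z‖)) * (B + 1) ≤ Real.exp (2 * (1 + ‖z‖)) * Real.exp B := by gcongr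
        _ = Real.exp (2 * (1 + ‖z‖) + B) := by rw [Real.exp_add]
        _ ≤ _ := by
          rw [Real.exp_le_exp]
          nlinarith
    · have hz1' : z ≠ 1 := by
        rintro rfl
        norm_num at h4
      rw [xi_eq_mul_riemannZeta (by linarith) hz1', norm_mul, norm_mul, norm_mul]
      have hG : ‖Gammaℝ z‖ ≤ Real.exp (2 * Y) := by
        rw [Gammaℝ_def, norm_mul, norm_cpow_eq_rpow_re_of_pos Real.pi_pos]
        have h1 : Real.pi ^ (-z / 2).re ≤ 1 := by
          refine Real.rpow_le_one_of_one_le_of_nonpos (by linarith [Real.pi_gt_three]) ?_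
          simp
          linarith
        have h2 : ‖Gamma (z / 2)‖ ≤ Real.Gamma (z / 2).re :=
          norm_Gamma_le_Gamma_re (by simp; linarith)
        have h3 : Real.Gamma (z / 2).re ≤ Real.exp (2 * (1 + (z / 2).re) ^ (3 / 2 : ℝ)) :=
          Gamma_le_exp (by simp; linarith)
        have h5 : (z / 2).re ≤ ‖z‖ := by
          simp
          linarith [Complex.re_le_norm z]
        have h6 : (1 + (z / 2).re) ^ (3 / 2 : ℝ) ≤ Y := by
          refine Real.rpow_le_rpow ?_ (by linarith) (by norm_num)
          simp
          linarith
        calc Real.pi ^ (-z / 2).re * ‖Gamma (z / 2)‖ ≤ 1 * ‖Gamma (z / 2)‖ := by gcongr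
          _ ≤ Real.exp (2 * (1 + (z / 2).re) ^ (3 / 2 : ℝ)) := by
            rw [one_mul]
            exact h2.trans h3
          _ ≤ _ := by
            rw [Real.exp_le_exp]
            linarith
      have hZ : ‖riemannZeta z‖ ≤ Real.exp D := by
        refine (norm_riemannZeta_le (by linarith)).trans ?_
        linarith [Real.add_one_le_exp D]
      calc ‖z‖ * ‖z - 1‖ * ‖Gammaℝ z‖ * ‖riemannZeta z‖
          ≤ Real.exp (2 * (1 + ‖z‖)) * Real.exp (2 * Y) * Real.exp D := by
            gcongr
            exact hlin z
        _ = Real.exp (2 * (1 + ‖z‖) + 2 * Y + D) := by rw [Real.exp_add, Real.exp_add]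
        _ ≤ _ := by
          rw [Real.exp_le_exp]
          nlinarith
  refine ⟨(4 + B + 1 + D) * 2 ^ (3 / 2 : ℝ), fun z => ?_⟩
  have hY : (1 + ‖1 - z‖) ^ (3 / 2 : ℝ) ≤ 2 ^ (3 / 2 : ℝ) * (1 + ‖z‖) ^ (3 / 2 : ℝ) := by
    rw [← Real.mul_rpow (by norm_num) (by positivity)]
    refine Real.rpow_le_rpow (by positivity) ?_ (by norm_num)
    have : ‖1 - z‖ ≤ 1 + ‖z‖ := by simpa using norm_sub_le 1 z
    linarith [norm_nonneg z]
  have h2 : (1 : ℝ) ≤ 2 ^ (3 / 2 : ℝ) := Real.one_le_rpow (by norm_num) (by norm_num)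
  have hY0 : 0 ≤ (1 + ‖z‖) ^ (3 / 2 : ℝ) := by positivity
  have hE : 0 ≤ 4 + B + 1 + D := by positivity
  rcases le_total 0 z.re with hz | hz
  · refine (hright z hz).trans ?_
    rw [Real.exp_le_exp, mul_assoc]
    exact mul_le_mul_of_nonneg_left (le_mul_of_one_le_left hY0 h2) hE
  · rw [← xi_one_sub]
    refine (hright (1 - z) (by simp; linarith)).trans ?_
    rw [Real.exp_le_exp, mul_assoc]
    exact mul_le_mul_of_nonneg_left hY hE

theorem summable_multiplicity_div_sq :
    Summable fun ρ : nontrivialZeros => (multiplicity ρ : ℝ) / (1 + ‖(ρ : ℂ)‖) ^ 2 := by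
  obtain ⟨C, hC⟩ := exists_norm_xi_le
  have h := summable_order_div_sq differentiable_xi xi_zero hC
  rw [setOf_xi_eq_zero] at h
  refine h.congr fun ρ => ?_
  rw [multiplicity_eq_order_xi ρ.2]

theorem logDeriv_xi_one_sub (s : ℂ) : logDeriv xi (1 - s) = -logDeriv xi s := by
  have h1 : HasDerivAt (fun z => xi (1 - z)) (-deriv xi (1 - s)) s :=
    (differentiable_xi (1 - s)).hasDerivAt.comp_const_sub 1 s
  have h2 : (fun z => xi (1 - z)) = xi := funext xi_one_sub
  rw [h2] at h1
  rw [logDeriv_apply, logDeriv_apply, h1.deriv, xi_one_sub]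
  ring

theorem hasSum_logDeriv_xi {s : ℂ} (hs : 1 ≤ s.re) :
    HasSum (fun ρ : nontrivialZeros =>
      (multiplicity ρ : ℂ) * (1 / (s - ρ) + 1 / (s - (1 - ρ)))) (2 * logDeriv xi s) := by
  obtain ⟨C, hC⟩ := exists_norm_xi_le
  have hxs := xi_ne_zero_of_one_le_re hs
  have h := hasSum_order_mul_sub differentiable_xi xi_zero hC (s := s) (t := 1 - s) hxs
    (by rwa [xi_one_sub])
  rw [setOf_xi_eq_zero, logDeriv_xi_one_sub, sub_neg_eq_add, ← two_mul] at h
  refine h.congr_fun fun ρ => ?_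
  rw [multiplicity_eq_order_xi ρ.2]
  congr 1
  rw [show 1 - s - (ρ : ℂ) = -(s - (1 - ρ)) by ring, div_neg, sub_neg_eq_add]

theorem logDeriv_xi_eq {s : ℂ} (hs : 1 < s.re) :
    logDeriv xi s = 1 / s + 1 / (s - 1) - Real.log Real.pi / 2 + digamma (s / 2) / 2
      - LSeries (fun n => (ArithmeticFunction.vonMangoldt n : ℂ)) s := by
  have h0 : s ≠ 0 := by
    rintro rfl
    norm_num at hs
  have hs1 : s ≠ 1 := by
    rintro rfl
    norm_num at hs
  have hpos : 0 < s.re := by linarith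
  have hopen : IsOpen {s : ℂ | 0 < s.re ∧ s ≠ 1} :=
    (isOpen_lt continuous_const continuous_re).inter isOpen_ne
  have heq : xi =ᶠ[𝓝 s] fun z => z * (z - 1) * Gammaℝ z * riemannZeta z := by
    filter_upwards [hopen.mem_nhds ⟨hpos, hs1⟩] with z hz
    exact xi_eq_mul_riemannZeta hz.1 hz.2
  have hs1' := sub_ne_zero.2 hs1
  have hΓ := Gammaℝ_ne_zero_of_re_pos hpos
  have hdΓ := differentiableAt_Gammaℝ hpos
  have hΓ2 : DifferentiableAt ℂ Gamma (s / 2) := by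
    refine differentiableAt_Gamma _ fun m h => ?_
    have := congrArg Complex.re h
    simp at this
    linarith [(Nat.cast_nonneg m : (0 : ℝ) ≤ m)]
  have hπ : (Real.pi : ℂ) ≠ 0 := by exact_mod_cast Real.pi_ne_zero
  have hlogΓ : logDeriv Gammaℝ s = -(Real.log Real.pi / 2) + digamma (s / 2) / 2 := by
    have h1 : HasDerivAt (fun z : ℂ => (Real.pi : ℂ) ^ (-z / 2))
        ((Real.pi : ℂ) ^ (-s / 2) * Complex.log Real.pi * (-1 / 2)) s :=
      (((hasDerivAt_id s).neg.div_const 2).const_cpow (Or.inl hπ))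
    have hne : (Real.pi : ℂ) ^ (-s / 2) ≠ 0 := by simp [cpow_eq_zero_iff, hπ]
    have h2 : logDeriv (fun z : ℂ => Gamma (z / 2)) s = digamma (s / 2) / 2 := by
      have h3 : HasDerivAt (fun z : ℂ => z / 2) (1 / 2) s := (hasDerivAt_id s).div_const 2
      have := logDeriv_comp (f := Gamma) (g := fun z : ℂ => z / 2) hΓ2 h3.differentiableAt
      rw [h3.deriv] at this
      rw [digamma_def]
      change logDeriv (Gamma ∘ fun z : ℂ => z / 2) s = _
      rw [this]
      ring
    have hΓne : Gamma (s / 2) ≠ 0 := Gamma_ne_zero_of_re_pos (by simp; linarith)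
    have h4 : Gammaℝ = fun z : ℂ => (Real.pi : ℂ) ^ (-z / 2) * Gamma (z / 2) := by
      ext z
      exact Gammaℝ_def z
    rw [h4, logDeriv_mul (f := fun z : ℂ => (Real.pi : ℂ) ^ (-z / 2))
      (g := fun z : ℂ => Gamma (z / 2)) s hne hΓne h1.differentiableAt
      (hΓ2.comp (f := fun s : ℂ => s / 2) s (by fun_prop)), h2, logDeriv_apply, h1.deriv,
      Complex.ofReal_log Real.pi_pos.le]
    field_simp
  rw [(logDeriv_congr_nhds heq).self_of_nhds,
    logDeriv_mul (f := fun z => z * (z - 1) * Gammaℝ z) (g := riemannZeta) s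
      (mul_ne_zero (mul_ne_zero h0 hs1') hΓ)
      (riemannZeta_ne_zero_of_one_le_re hs.le) (DifferentiableAt.mul (by fun_prop) hdΓ)
      (differentiableAt_riemannZeta hs1),
    logDeriv_mul (f := fun z => z * (z - 1)) (g := Gammaℝ) s (mul_ne_zero h0 hs1') hΓ (by fun_prop) hdΓ,
    logDeriv_mul (f := fun z => z) (g := fun z => z - 1) s h0 hs1' (by fun_prop) (by fun_prop), hlogΓ,
    ArithmeticFunction.LSeries_vonMangoldt_eq_deriv_riemannZeta_div hs]
  have h5 : HasDerivAt (fun z : ℂ => z - 1) 1 s := (hasDerivAt_id s).sub_const 1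
  have h6 : logDeriv (fun z : ℂ => z) s = 1 / s := logDeriv_id s
  rw [h6, logDeriv_apply (fun z : ℂ => z - 1), h5.deriv, logDeriv_apply riemannZeta]
  ring

end Xi

end LinearStatistics

namespace LinearStatistics

section Digamma

open Complex Metric Topology Set

/-- Pointwise bounded convergence of holomorphic functions on a circle implies convergence of the
derivatives at the centre. -/
theorem tendsto_deriv_of_bounded {f : ℕ → ℂ → ℂ} {g : ℂ → ℂ} {c : ℂ} {r B : ℝ} (hr : 0 < r)
    (hf : ∀ᶠ n in atTop, DifferentiableOn ℂ (f n) (closedBall c r))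
    (hg : DifferentiableOn ℂ g (closedBall c r))
    (hB : ∀ᶠ n in atTop, ∀ z ∈ sphere c r, ‖f n z‖ ≤ B)
    (hlim : ∀ z ∈ sphere c r, Tendsto (fun n => f n z) atTop (𝓝 (g z))) :
    Tendsto (fun n => deriv (f n) c) atTop (𝓝 (deriv g c)) := by
  have hpi : (2 * Real.pi * I : ℂ) ≠ 0 := by simp [Real.pi_ne_zero]
  have hformula : ∀ h : ℂ → ℂ, DifferentiableOn ℂ h (closedBall c r) →
      deriv h c = (2 * Real.pi * I)⁻¹ * ∮ z in C(c, r), (1 / (z - c) ^ 2) • h z := by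
    intro h hh
    rw [hh.deriv_eq_smul_circleIntegral hr, smul_eq_mul, inv_mul_cancel_left₀ hpi]
  rw [hformula g hg]
  have hmem : ∀ θ, circleMap c r θ ∈ sphere c r := fun θ => circleMap_mem_sphere c hr.le θ
  have hmain : Tendsto (fun n => ∮ z in C(c, r), (1 / (z - c) ^ 2) • f n z) atTop
      (𝓝 (∮ z in C(c, r), (1 / (z - c) ^ 2) • g z)) := by
    unfold circleIntegral
    refine intervalIntegral.tendsto_integral_filter_of_dominated_convergence
      (fun _ => r * (1 / r ^ 2 * B)) ?_ ?_ (by simp) ?_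
    · filter_upwards [hf] with n hn
      have hci : CircleIntegrable (fun z => (1 / (z - c) ^ 2) • f n z) c r := by
        refine ContinuousOn.circleIntegrable hr.le ?_
        refine ContinuousOn.smul (f := fun z => 1 / (z - c) ^ 2) (ContinuousOn.div continuousOn_const (by fun_prop) ?_)
          (hn.continuousOn.mono sphere_subset_closedBall)
        intro z hz
        refine pow_ne_zero _ (sub_ne_zero.2 (ne_of_mem_sphere hz hr.ne'))
      exact hci.out.def'.aestronglyMeasurable
    · filter_upwards [hB] with n hn
      refine Eventually.of_forall fun θ _ => ?_
      have h1 : ‖circleMap c r θ - c‖ = r := by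
        have := hmem θ
        rwa [mem_sphere_iff_norm] at this
      rw [norm_smul, norm_smul, norm_div, norm_one, norm_pow, h1, deriv_circleMap]
      have h2 : ‖circleMap 0 r θ * I‖ = r := by simp [abs_of_pos hr]
      rw [h2]
      gcongr
      exact hn _ (hmem θ)
    · refine Eventually.of_forall fun θ _ => ?_
      exact ((hlim _ (hmem θ)).const_smul _).const_smul _
  refine (hmain.const_mul _).congr' ?_
  filter_upwards [hf] with n hn
  rw [hformula (f n) hn]

theorem norm_GammaSeq_le {s : ℂ} (hs : 0 < s.re) {n : ℕ} (hn : n ≠ 0) :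
    ‖GammaSeq s n‖ ≤ Real.Gamma s.re := by
  rw [GammaSeq_eq_approx_Gamma_integral hs hn, Real.Gamma_eq_integral hs,
    intervalIntegral.integral_of_le (by positivity)]
  have hint := Real.GammaIntegral_convergent hs
  refine (norm_integral_le_of_norm_le (hint.mono_set Ioc_subset_Ioi_self) ?_).trans
    (setIntegral_mono_set hint ?_ (Ioc_subset_Ioi_self.eventuallyLE))
  · filter_upwards [ae_restrict_mem measurableSet_Ioc] with x hx
    have hn0 : (0 : ℝ) < n := by positivity
    have h1 : 0 ≤ 1 - x / n := by
      rw [sub_nonneg, div_le_one hn0]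
      exact hx.2
    rw [norm_mul, norm_cpow_eq_rpow_re_of_pos hx.1, Complex.norm_real,
      Real.norm_of_nonneg (by positivity)]
    simp only [sub_re, one_re]
    exact mul_le_mul_of_nonneg_right (Real.one_sub_div_pow_le_exp_neg hx.2)
      (Real.rpow_nonneg hx.1.le _)
  · filter_upwards [ae_restrict_mem measurableSet_Ioi] with x hx
    exact mul_nonneg (Real.exp_pos _).le (Real.rpow_nonneg (le_of_lt hx) _)

theorem add_natCast_ne_zero {s : ℂ} (hs : 0 < s.re) (j : ℕ) : s + j ≠ 0 := by
  intro h
  have := congrArg Complex.re h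
  simp at this
  linarith [(Nat.cast_nonneg j : (0 : ℝ) ≤ j)]

theorem differentiableAt_GammaSeq {s : ℂ} (hs : 0 < s.re) {n : ℕ} (hn : n ≠ 0) :
    DifferentiableAt ℂ (fun s => GammaSeq s n) s := by
  unfold GammaSeq
  have hn' : (n : ℂ) ≠ 0 := Nat.cast_ne_zero.2 hn
  refine DifferentiableAt.div ?_ (by fun_prop) ?_
  · exact (DifferentiableAt.const_cpow differentiableAt_id (Or.inl hn')).mul_const _
  · rw [Finset.prod_ne_zero_iff]
    exact fun j _ => add_natCast_ne_zero hs j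

theorem logDeriv_GammaSeq {s : ℂ} (hs : 0 < s.re) {n : ℕ} (hn : n ≠ 0) :
    logDeriv (fun s => GammaSeq s n) s
      = Real.log n - ∑ j ∈ Finset.range (n + 1), 1 / (s + j) := by
  have hn' : (n : ℂ) ≠ 0 := Nat.cast_ne_zero.2 hn
  have h1 : HasDerivAt (fun s : ℂ => (n : ℂ) ^ s) ((n : ℂ) ^ s * Complex.log n * 1) s :=
    (hasDerivAt_id s).const_cpow (Or.inl hn')
  have hne1 : (n : ℂ) ^ s ≠ 0 := by simp [cpow_eq_zero_iff, hn']
  have hfac : (n.factorial : ℂ) ≠ 0 := Nat.cast_ne_zero.2 n.factorial_ne_zero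
  have hprod : ∏ j ∈ Finset.range (n + 1), (s + j) ≠ 0 :=
    Finset.prod_ne_zero_iff.2 fun j _ => add_natCast_ne_zero hs j
  unfold GammaSeq
  rw [logDeriv_div (f := fun s : ℂ => (n : ℂ) ^ s * n.factorial)
    (g := fun s : ℂ => ∏ j ∈ Finset.range (n + 1), (s + j)) s (mul_ne_zero hne1 hfac) hprod
    (h1.differentiableAt.mul_const _) (by fun_prop),
    logDeriv_mul_const s _ hfac, logDeriv_apply, h1.deriv]
  congr 1
  · rw [← Complex.natCast_log]
    field_simp
  · rw [logDeriv_prod (fun j _ => add_natCast_ne_zero hs j) (fun j _ => by fun_prop)]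
    refine Finset.sum_congr rfl fun j _ => ?_
    have : HasDerivAt (fun s : ℂ => s + j) 1 s := (hasDerivAt_id s).add_const _
    rw [logDeriv_apply, this.deriv]

theorem tendsto_log_sub_sum_digamma {s : ℂ} (hs : 0 < s.re) :
    Tendsto (fun n : ℕ => (Real.log n : ℂ) - ∑ j ∈ Finset.range (n + 1), 1 / (s + j)) atTop
      (𝓝 (digamma s)) := by
  set r := s.re / 2
  have hr : 0 < r := by positivity
  have hre : ∀ z ∈ closedBall s r, r ≤ z.re ∧ z.re ≤ 3 * r := by
    intro z hz
    have h1 : |(z - s).re| ≤ r := (abs_re_le_norm _).trans (by simpa [dist_eq_norm] using hz)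
    rw [abs_le, sub_re] at h1
    constructor <;> simp only [r] at * <;> linarith
  have hcont : ContinuousOn Real.Gamma (Icc r (3 * r)) := by
    intro x hx
    refine (Real.differentiableAt_Gamma fun m h => ?_).continuousAt.continuousWithinAt
    have : 0 < x := hr.trans_le hx.1
    linarith [(Nat.cast_nonneg m : (0 : ℝ) ≤ m)]
  obtain ⟨B, hB⟩ := isCompact_Icc.exists_bound_of_continuousOn hcont
  have hderiv : Tendsto (fun n => deriv (fun s => GammaSeq s n) s) atTop
      (𝓝 (deriv Gamma s)) := by
    refine tendsto_deriv_of_bounded (f := fun n s => GammaSeq s n) (B := B) hr ?_ ?_ ?_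
      (fun z _ => GammaSeq_tendsto_Gamma z)
    · filter_upwards [eventually_ne_atTop 0] with n hn z hz
      exact (differentiableAt_GammaSeq (hr.trans_le (hre z hz).1) hn).differentiableWithinAt
    · intro z hz
      refine (differentiableAt_Gamma _ fun m h => ?_).differentiableWithinAt
      have := (hre z hz).1
      rw [h] at this
      simp at this
      linarith [(Nat.cast_nonneg m : (0 : ℝ) ≤ m)]
    · filter_upwards [eventually_ne_atTop 0] with n hn z hz
      have hz' := hre z (sphere_subset_closedBall hz)
      exact (norm_GammaSeq_le (hr.trans_le hz'.1) hn).trans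
        ((le_abs_self _).trans (hB _ hz'))
  have hdiv := hderiv.div (GammaSeq_tendsto_Gamma s) (Gamma_ne_zero_of_re_pos hs)
  refine hdiv.congr' ?_
  filter_upwards [eventually_ne_atTop 0] with n hn
  rw [← logDeriv_GammaSeq hs hn, logDeriv_apply]
  rfl

theorem norm_digamma_term_le {s : ℂ} (hs : 1 ≤ s.re) (n : ℕ) :
    ‖1 / ((n : ℂ) + 1) - 1 / (s + n)‖ ≤ (1 + ‖s‖) * (1 / ((n : ℝ) + 1) ^ 2) := by
  have h1 : (n : ℝ) + 1 ≤ ‖s + n‖ := by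
    refine le_trans ?_ (re_le_norm _)
    simp
    linarith
  have h2 : ((n : ℂ) + 1) ≠ 0 := by exact_mod_cast Nat.succ_ne_zero n
  have h3 : s + n ≠ 0 := add_natCast_ne_zero (by linarith) n
  have h4 : ‖(n : ℂ) + 1‖ = n + 1 := by
    have := Complex.norm_natCast (n + 1)
    push_cast at this
    exact this
  have h5 : 1 / ((n : ℂ) + 1) - 1 / (s + n) = (s - 1) / (((n : ℂ) + 1) * (s + n)) := by
    field_simp
    ring
  rw [h5, norm_div, norm_mul, h4]
  have h6 : ‖s - 1‖ ≤ 1 + ‖s‖ := by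
    have := norm_sub_le s 1
    rw [norm_one] at this
    linarith
  calc ‖s - 1‖ / (((n : ℝ) + 1) * ‖s + n‖) ≤ (1 + ‖s‖) / (((n : ℝ) + 1) * ((n : ℝ) + 1)) := by
        gcongr
    _ = _ := by ring

theorem summable_one_div_succ_sq : Summable fun n : ℕ => 1 / ((n : ℝ) + 1) ^ 2 := by
  have := (summable_nat_add_iff 1).2 (Real.summable_one_div_nat_pow.2 (one_lt_two))
  simpa using this

theorem hasSum_digamma {s : ℂ} (hs : 1 ≤ s.re) :
    HasSum (fun n : ℕ => 1 / ((n : ℂ) + 1) - 1 / (s + n))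
      (digamma s + Real.eulerMascheroniConstant) := by
  have hsum : Summable (fun n : ℕ => 1 / ((n : ℂ) + 1) - 1 / (s + n)) :=
    Summable.of_norm_bounded (summable_one_div_succ_sq.mul_left (1 + ‖s‖))
      (norm_digamma_term_le hs)
  have h1 := hsum.hasSum.tendsto_sum_nat
  suffices h2 : Tendsto (fun N => ∑ n ∈ Finset.range N, (1 / ((n : ℂ) + 1) - 1 / (s + n))) atTop
      (𝓝 (digamma s + Real.eulerMascheroniConstant)) by
    rw [← tendsto_nhds_unique h1 h2]
    exact hsum.hasSum
  have h3 := tendsto_log_sub_sum_digamma (s := s) (by linarith)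
  have h4 : Tendsto (fun n : ℕ => ((harmonic n - Real.log n : ℝ) : ℂ)) atTop
      (𝓝 (Real.eulerMascheroniConstant : ℂ)) :=
    (continuous_ofReal.tendsto _).comp Real.tendsto_harmonic_sub_log
  have h5 : Tendsto (fun n : ℕ => 1 / (s + n)) atTop (𝓝 0) := by
    rw [tendsto_zero_iff_norm_tendsto_zero]
    refine squeeze_zero (fun _ => norm_nonneg _) (fun n => ?_)
      (tendsto_one_div_add_atTop_nhds_zero_nat (𝕜 := ℝ))
    rw [norm_div, norm_one]
    refine one_div_le_one_div_of_le (by positivity) (le_trans ?_ (re_le_norm _))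
    simp
    linarith
  have h6 := (h3.add h4).add h5
  rw [add_zero] at h6
  refine h6.congr fun n => ?_
  rw [Finset.sum_range_succ, Finset.sum_sub_distrib, harmonic]
  push_cast
  simp only [one_div]
  ring

end Digamma

end LinearStatistics

namespace LinearStatistics

section LineIntegrals

open Complex Topology Set
open scoped SchwartzMap

/-- Termwise integration of a series dominated by `u i * B x`. -/
theorem integrable_and_hasSum_integral {ι : Type*} [Countable ι] {F : ι → ℝ → ℂ} {G : ℝ → ℂ}
    {u : ι → ℝ} {B : ℝ → ℝ} (hF : ∀ i, Continuous (F i)) (hu : Summable u) (hB : Integrable B)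
    (hle : ∀ i x, ‖F i x‖ ≤ u i * B x) (hG : ∀ x, HasSum (fun i => F i x) (G x)) :
    Integrable G ∧ HasSum (fun i => ∫ x, F i x) (∫ x, G x) := by
  have hint : ∀ i, Integrable (F i) := fun i =>
    (hB.const_mul (u i)).mono' (hF i).aestronglyMeasurable (Eventually.of_forall (hle i))
  have hGm : AEStronglyMeasurable G := by
    refine aestronglyMeasurable_of_tendsto_ae (atTop : Filter (Finset ι))
      (f := fun (s : Finset ι) x => ∑ i ∈ s, F i x) (fun s => ?_)
      (Eventually.of_forall fun x => hG x)
    exact (continuous_finsetSum s fun i _ => hF i).aestronglyMeasurable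
  constructor
  · refine (hB.const_mul (∑' i, u i)).mono' hGm (Eventually.of_forall fun x => ?_)
    rw [← (hG x).tsum_eq]
    exact tsum_of_norm_bounded (hu.hasSum.mul_right (B x)) fun i => hle i x
  · have h1 : Summable fun i => ∫ x, ‖F i x‖ := by
      refine Summable.of_nonneg_of_le (fun i => integral_nonneg fun x => norm_nonneg _)
        (fun i => ?_) (hu.mul_right (∫ x, B x))
      rw [← integral_const_mul]
      exact integral_mono (hint i).norm (hB.const_mul _) (hle i)
    have h2 := hasSum_integral_of_summable_integral_norm hint h1
    simpa only [(hG _).tsum_eq] using h2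

instance countable_nontrivialZeros : Countable nontrivialZeros := by
  have h : nontrivialZeros ⊆ ⋃ n : ℕ, {z : ℂ | xi z = 0 ∧ ‖z‖ ≤ n} := by
    intro z hz
    obtain ⟨n, hn⟩ := exists_nat_ge ‖z‖
    exact mem_iUnion.2 ⟨n, (xi_eq_zero_iff z).2 hz, hn⟩
  exact ((countable_iUnion fun n : ℕ => (finite_zeros_inter_closedBall differentiable_xi
    (by simp [xi_zero]) n).countable).mono h).to_subtype

/-- A parametrisation of the line `Re s = 2`. -/
noncomputable def linePt (ξ : ℝ) : ℂ := 2 - 2 * Real.pi * I * ξ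

theorem linePt_re (ξ : ℝ) : (linePt ξ).re = 2 := by simp [linePt]

theorem continuous_linePt : Continuous linePt := by
  unfold linePt
  fun_prop

theorem norm_linePt_le (ξ : ℝ) : ‖linePt ξ‖ ≤ 2 + 7 * ‖ξ‖ := by
  refine (norm_sub_le _ _).trans ?_
  have h1 : ‖(2 : ℂ) * Real.pi * I * ξ‖ = 2 * Real.pi * ‖ξ‖ := by
    simp [abs_of_pos Real.pi_pos]
  rw [h1]
  have h2 : 2 * Real.pi ≤ 7 := by linarith [Real.pi_lt_d2]
  have h3 : ‖(2 : ℂ)‖ = 2 := by simp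
  rw [h3]
  gcongr

/-- The one-sided Laplace transform. -/
noncomputable def halfLaplace (φ : ℝ → ℂ) (b : ℂ) : ℂ :=
  ∫ v in Ioi (0 : ℝ), φ v * cexp (-b * v)

variable (φ : 𝓢(ℝ, ℂ))

theorem integrable_cube_mul_norm (ψ : 𝓢(ℝ, ℂ)) :
    Integrable fun ξ : ℝ => (1 + ‖ξ‖) ^ 3 * ‖ψ ξ‖ := by
  have h0 := ψ.integrable_pow_mul volume 0
  have h1 := (ψ.integrable_pow_mul volume 1).const_mul 3
  have h2 := (ψ.integrable_pow_mul volume 2).const_mul 3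
  have h3 := ψ.integrable_pow_mul volume 3
  refine (((h0.add h1).add h2).add h3).congr (Eventually.of_forall fun ξ => ?_)
  simp only [Pi.add_apply]
  ring

theorem fourier_schwartz_eq (ξ : ℝ) : 𝓕 φ ξ = 𝓕 (φ : ℝ → ℂ) ξ := by
  rw [SchwartzMap.fourier_coe]

theorem integral_fourier_mul_exp (v : ℝ) :
    ∫ ξ, 𝓕 φ ξ * cexp (2 * Real.pi * I * ξ * v) = φ v := by
  have h1 : 𝓕⁻ (𝓕 φ) = φ := FourierTransform.fourierInv_fourier_eq φ
  have h2 : 𝓕⁻ (𝓕 φ) v = φ v := by rw [h1]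
  rw [SchwartzMap.fourierInv_coe, Real.fourierInv_eq'] at h2
  rw [← h2]
  congr 1
  funext ξ
  rw [smul_eq_mul, mul_comm]
  congr 2
  simp
  ring

theorem integral_fourier : ∫ ξ, 𝓕 φ ξ = φ 0 := by
  have := integral_fourier_mul_exp φ 0
  simpa using this

theorem fourier_fourier_apply (v : ℝ) : 𝓕 (𝓕 φ) v = φ (-v) := by
  have h1 : 𝓕⁻ (𝓕 φ) = φ := FourierTransform.fourierInv_fourier_eq φ
  have h2 : 𝓕⁻ (𝓕 φ) (-v) = φ (-v) := by rw [h1]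
  rw [SchwartzMap.fourierInv_coe, Real.fourierInv_eq_fourier_neg, neg_neg] at h2
  rw [← h2, fourier_schwartz_eq]

theorem integral_fourier_div {b : ℂ} (hb : 0 < b.re) :
    ∫ ξ, 𝓕 φ ξ * (1 / (b - 2 * Real.pi * I * ξ)) = halfLaplace φ b := by
  let h : ℝ → ℂ := indicator (Iic 0) fun v : ℝ => cexp (b * v)
  have hint : Integrable h := by
    rw [integrable_indicator_iff measurableSet_Iic]
    exact integrableOn_exp_mul_complex_Iic hb 0
  have hF : ∀ ξ : ℝ, 𝓕 h ξ = 1 / (b - 2 * Real.pi * I * ξ) := by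
    intro ξ
    rw [Real.fourier_real_eq_integral_exp_smul]
    have h1 : ∀ v : ℝ, cexp (↑(-2 * Real.pi * v * ξ) * I) • h v
        = indicator (Iic 0) (fun v : ℝ => cexp ((b - 2 * Real.pi * I * ξ) * v)) v := by
      intro v
      simp only [h]
      by_cases hv : v ∈ Iic (0 : ℝ)
      · rw [indicator_of_mem hv, indicator_of_mem hv, smul_eq_mul, ← Complex.exp_add]
        congr 1
        push_cast
        ring
      · rw [indicator_of_notMem hv, indicator_of_notMem hv, smul_zero]
    simp_rw [h1]
    rw [integral_indicator measurableSet_Iic, integral_exp_mul_complex_Iic (by simpa using hb)]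
    simp
  have hflip := VectorFourier.integral_fourierIntegral_smul_eq_flip (L := innerₗ ℝ)
    (μ := volume) (ν := volume) Real.continuous_fourierChar continuous_inner hint
    (𝓕 φ).integrable
  have hflip' : ∫ ξ, 𝓕 h ξ * 𝓕 φ ξ = ∫ x, h x * 𝓕 (𝓕 φ) x := by
    simpa using! hflip
  have h3 : ∫ ξ, 𝓕 φ ξ * (1 / (b - 2 * Real.pi * I * ξ)) = ∫ ξ, 𝓕 h ξ * 𝓕 φ ξ := by
    congr 1
    funext ξ
    rw [hF, mul_comm]
  rw [h3, hflip', halfLaplace]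
  simp_rw [fourier_fourier_apply]
  have h4 : ∀ x : ℝ, h x * φ (-x) = indicator (Iic 0) (fun v : ℝ => cexp (b * v) * φ (-v)) x := by
    intro x
    by_cases hv : x ∈ Iic (0 : ℝ)
    · simp only [h]
      rw [indicator_of_mem hv, indicator_of_mem hv]
    · simp only [h]
      rw [indicator_of_notMem hv, indicator_of_notMem hv, zero_mul]
  simp_rw [h4]
  rw [integral_indicator measurableSet_Iic]
  have h5 := integral_comp_neg_Iic (0 : ℝ) (fun v : ℝ => φ v * cexp (-b * v))
  rw [neg_zero] at h5
  rw [← h5]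
  congr 1
  funext v
  rw [mul_comm]
  congr 2
  push_cast
  ring

theorem line_sub_ne_zero {a : ℂ} (ha : a.re < 2) (ξ : ℝ) : linePt ξ - a ≠ 0 := by
  intro h
  have := congrArg Complex.re h
  simp [linePt_re] at this
  linarith

theorem continuous_line_div {a : ℂ} (ha : a.re < 2) :
    Continuous fun ξ : ℝ => 1 / (linePt ξ - a) :=
  continuous_const.div (continuous_linePt.sub continuous_const) (line_sub_ne_zero ha)

theorem integral_fourier_line_div {a : ℂ} (ha : a.re < 2) :
    ∫ ξ, 𝓕 φ ξ * (1 / (linePt ξ - a)) = halfLaplace φ (2 - a) := by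
  rw [← integral_fourier_div φ (b := 2 - a) (by simpa using ha)]
  congr 1
  funext ξ
  congr 2
  rw [linePt]
  ring

theorem integrable_fourier_line_div {a : ℂ} (ha : a.re ≤ 1) :
    Integrable fun ξ => 𝓕 φ ξ * (1 / (linePt ξ - a)) := by
  refine (𝓕 φ).integrable.norm.mono'
    ((𝓕 φ).continuous.mul (continuous_line_div (by linarith))).aestronglyMeasurable
    (Eventually.of_forall fun ξ => ?_)
  rw [norm_mul, norm_div, norm_one]
  refine mul_le_of_le_one_right (norm_nonneg _) ?_
  have h1 : 1 ≤ ‖linePt ξ - a‖ := by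
    refine le_trans ?_ (re_le_norm _)
    rw [sub_re, linePt_re]
    linarith
  rw [div_le_one (by linarith)]
  exact h1

theorem norm_zero_term_le {ρ : ℂ} (hρ : ρ ∈ nontrivialZeros) (ξ : ℝ) :
    ‖1 / (linePt ξ - ρ) + 1 / (linePt ξ - (1 - ρ))‖
      ≤ 1 / (1 + ‖ρ‖) ^ 2 * (2 * 7 ^ 3 * (1 + ‖ξ‖) ^ 3) := by
  obtain ⟨-, h0, h1⟩ := hρ
  set s := linePt ξ
  have hs := norm_linePt_le ξ
  have hb1 : 1 ≤ ‖s - ρ‖ := by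
    refine le_trans ?_ (re_le_norm _)
    rw [sub_re, linePt_re]
    linarith
  have hb2 : 1 ≤ ‖s - (1 - ρ)‖ := by
    refine le_trans ?_ (re_le_norm _)
    rw [sub_re, linePt_re, sub_re, one_re]
    linarith
  have hne1 : s - ρ ≠ 0 := norm_pos_iff.1 (by linarith)
  have hne2 : s - (1 - ρ) ≠ 0 := norm_pos_iff.1 (by linarith)
  set X := 5 + 7 * ‖ξ‖
  have hX : 0 < X := by positivity
  have hsX : ‖s‖ + 3 ≤ X := by
    simp only [X]
    linarith
  have hr1 : 1 + ‖ρ‖ ≤ X * ‖s - ρ‖ := by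
    have h2 : ‖ρ‖ ≤ ‖s‖ + ‖s - ρ‖ := by
      have := norm_sub_le s (s - ρ)
      rwa [sub_sub_cancel] at this
    nlinarith [norm_nonneg s]
  have hr2 : 1 + ‖ρ‖ ≤ X * ‖s - (1 - ρ)‖ := by
    have h2 : ‖ρ‖ ≤ ‖s - (1 - ρ)‖ + (‖s‖ + 1) := by
      have h3 := norm_sub_le (s - (1 - ρ)) (s - 1)
      have h4 := norm_sub_le s 1
      rw [norm_one] at h4
      rw [show s - (1 - ρ) - (s - 1) = ρ by ring] at h3
      linarith
    nlinarith [norm_nonneg s]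
  have heq : 1 / (s - ρ) + 1 / (s - (1 - ρ)) = (2 * s - 1) / ((s - ρ) * (s - (1 - ρ))) := by
    rw [div_add_div _ _ hne1 hne2]
    congr 1
    ring
  have hnum : ‖2 * s - 1‖ ≤ 2 * X := by
    have h4 := norm_sub_le (2 * s) 1
    rw [norm_one, norm_mul] at h4
    have : ‖(2 : ℂ)‖ = 2 := by simp
    rw [this] at h4
    linarith [norm_nonneg s]
  rw [heq, norm_div, norm_mul, div_le_iff₀ (by positivity)]
  have hprod : (1 + ‖ρ‖) ^ 2 ≤ X ^ 2 * (‖s - ρ‖ * ‖s - (1 - ρ)‖) := by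
    calc (1 + ‖ρ‖) ^ 2 = (1 + ‖ρ‖) * (1 + ‖ρ‖) := sq _
      _ ≤ (X * ‖s - ρ‖) * (X * ‖s - (1 - ρ)‖) := by gcongr
      _ = _ := by ring
  have hX7 : X ≤ 7 * (1 + ‖ξ‖) := by
    simp only [X]
    linarith [norm_nonneg ξ]
  calc ‖2 * s - 1‖ ≤ 2 * X := hnum
    _ = 2 * X * ((1 + ‖ρ‖) ^ 2 / (1 + ‖ρ‖) ^ 2) := by rw [div_self (by positivity), mul_one]
    _ ≤ 2 * X * (X ^ 2 * (‖s - ρ‖ * ‖s - (1 - ρ)‖) / (1 + ‖ρ‖) ^ 2) := by gcongr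
    _ = 1 / (1 + ‖ρ‖) ^ 2 * (2 * X ^ 3) * (‖s - ρ‖ * ‖s - (1 - ρ)‖) := by ring
    _ ≤ 1 / (1 + ‖ρ‖) ^ 2 * (2 * (7 * (1 + ‖ξ‖)) ^ 3) * (‖s - ρ‖ * ‖s - (1 - ρ)‖) := by gcongr
    _ = _ := by ring

/-- The spectral side of the integral of `ξ'/ξ` against a Fourier transform. -/
theorem hasSum_halfLaplace_zeros :
    HasSum (fun ρ : nontrivialZeros => (multiplicity ρ : ℂ) *
      (halfLaplace φ (2 - ρ) + halfLaplace φ (2 - (1 - ρ))))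
      (2 * ∫ ξ, 𝓕 φ ξ * logDeriv xi (linePt ξ)) := by
  have hlt : ∀ ρ : nontrivialZeros, (ρ : ℂ).re < 2 ∧ (1 - (ρ : ℂ)).re < 2 := by
    rintro ⟨ρ, -, h0, h1⟩
    simp only [sub_re, one_re]
    constructor <;> linarith
  have hle : ∀ ρ : nontrivialZeros, (ρ : ℂ).re ≤ 1 ∧ (1 - (ρ : ℂ)).re ≤ 1 := by
    rintro ⟨ρ, -, h0, h1⟩
    simp only [sub_re, one_re]
    constructor <;> linarith
  have h := (integrable_and_hasSum_integral
    (F := fun (ρ : nontrivialZeros) ξ => 𝓕 φ ξ * ((multiplicity ρ : ℂ) *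
      (1 / (linePt ξ - ρ) + 1 / (linePt ξ - (1 - ρ)))))
    (G := fun ξ => 𝓕 φ ξ * (2 * logDeriv xi (linePt ξ)))
    (B := fun ξ => 2 * 7 ^ 3 * ((1 + ‖ξ‖) ^ 3 * ‖𝓕 φ ξ‖))
    (fun ρ => (𝓕 φ).continuous.mul (continuous_const.mul
      ((continuous_line_div (hlt ρ).1).add (continuous_line_div (hlt ρ).2))))
    summable_multiplicity_div_sq ((integrable_cube_mul_norm (𝓕 φ)).const_mul _)
    (fun ρ ξ => by
      rw [norm_mul, norm_mul, Complex.norm_natCast]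
      calc ‖𝓕 φ ξ‖ * ((multiplicity ρ : ℝ) *
            ‖1 / (linePt ξ - ρ) + 1 / (linePt ξ - (1 - ρ))‖)
          ≤ ‖𝓕 φ ξ‖ * ((multiplicity ρ : ℝ) *
            (1 / (1 + ‖(ρ : ℂ)‖) ^ 2 * (2 * 7 ^ 3 * (1 + ‖ξ‖) ^ 3))) := by
            gcongr
            exact norm_zero_term_le ρ.2 ξ
        _ = _ := by ring)
    (fun ξ => (hasSum_logDeriv_xi (by rw [linePt_re]; norm_num)).mul_left _)).2
  have h2 : (∫ ξ, 𝓕 φ ξ * (2 * logDeriv xi (linePt ξ)))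
      = 2 * ∫ ξ, 𝓕 φ ξ * logDeriv xi (linePt ξ) := by
    rw [← integral_const_mul]
    congr 1
    funext ξ
    ring
  rw [h2] at h
  refine h.congr_fun fun ρ => ?_
  rw [← integral_fourier_line_div φ (hlt ρ).1, ← integral_fourier_line_div φ (hlt ρ).2,
    ← integral_add (integrable_fourier_line_div φ (hle ρ).1)
      (integrable_fourier_line_div φ (hle ρ).2), ← integral_const_mul]
  congr 1
  funext ξ
  ring

theorem hasSum_digamma_line :
    Integrable (fun ξ => 𝓕 φ ξ * ((digamma (linePt ξ / 2) + Real.eulerMascheroniConstant) / 2)) ∧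
    HasSum (fun n : ℕ => φ 0 / (2 * ((n : ℂ) + 1)) - halfLaplace φ (2 + 2 * n))
      (∫ ξ, 𝓕 φ ξ * ((digamma (linePt ξ / 2) + Real.eulerMascheroniConstant) / 2)) := by
  have hre : ∀ ξ, 1 ≤ (linePt ξ / 2).re := fun ξ => by simp [linePt_re]
  have hneg : ∀ n : ℕ, (-(2 * n : ℂ)).re ≤ 1 := fun n => by
    simp
    linarith [(Nat.cast_nonneg n : (0 : ℝ) ≤ n)]
  have hterm : ∀ (n : ℕ) (ξ : ℝ), 1 / (linePt ξ / 2 + n) / 2 = 1 / (linePt ξ - (-(2 * n))) := by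
    intro n ξ
    have h1 := line_sub_ne_zero (a := -(2 * n)) (by linarith [hneg n]) ξ
    have h2 : linePt ξ / 2 + n = (linePt ξ - (-(2 * n))) / 2 := by ring
    rw [h2]
    field_simp
  have h := integrable_and_hasSum_integral
    (F := fun (n : ℕ) ξ => 𝓕 φ ξ *
      ((1 / ((n : ℂ) + 1) - 1 / (linePt ξ / 2 + n)) / 2))
    (G := fun ξ => 𝓕 φ ξ * ((digamma (linePt ξ / 2) + Real.eulerMascheroniConstant) / 2))
    (B := fun ξ => 7 * ((1 + ‖ξ‖) ^ 3 * ‖𝓕 φ ξ‖))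
    (fun n => by
      simp_rw [sub_div, hterm]
      exact (𝓕 φ).continuous.mul (continuous_const.sub
        (continuous_line_div (by linarith [hneg n]))))
    summable_one_div_succ_sq ((integrable_cube_mul_norm (𝓕 φ)).const_mul _)
    (fun n ξ => by
      rw [norm_mul, norm_div]
      have h1 := norm_digamma_term_le (hre ξ) n
      have h2 : 1 + ‖linePt ξ / 2‖ ≤ 7 * (1 + ‖ξ‖) ^ 3 := by
        have h3 := norm_linePt_le ξ
        have h4 : ‖linePt ξ / 2‖ ≤ ‖linePt ξ‖ := by
          rw [norm_div]
          have : ‖(2 : ℂ)‖ = 2 := by simp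
          rw [this]
          linarith [norm_nonneg (linePt ξ)]
        have h5 : 1 + ‖ξ‖ ≤ (1 + ‖ξ‖) ^ 3 := le_self_pow₀ (by linarith [norm_nonneg ξ]) (by norm_num)
        linarith
      have h6 : ‖(2 : ℂ)‖ = 2 := by simp
      rw [h6]
      calc ‖𝓕 φ ξ‖ * (‖1 / ((n : ℂ) + 1) - 1 / (linePt ξ / 2 + n)‖ / 2)
          ≤ ‖𝓕 φ ξ‖ * ‖1 / ((n : ℂ) + 1) - 1 / (linePt ξ / 2 + n)‖ := by
            gcongr
            linarith [norm_nonneg (1 / ((n : ℂ) + 1) - 1 / (linePt ξ / 2 + n))]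
        _ ≤ ‖𝓕 φ ξ‖ * ((7 * (1 + ‖ξ‖) ^ 3) * (1 / ((n : ℝ) + 1) ^ 2)) := by
            gcongr
            exact h1.trans (by gcongr)
        _ = _ := by ring)
    (fun ξ => ((hasSum_digamma (hre ξ)).div_const 2).mul_left _)
  refine ⟨h.1, h.2.congr_fun fun n => ?_⟩
  have h1 : halfLaplace φ (2 + 2 * n) = ∫ ξ, 𝓕 φ ξ * (1 / (linePt ξ - (-(2 * n)))) := by
    rw [integral_fourier_line_div φ (by linarith [hneg n]), sub_neg_eq_add]
  rw [h1]
  have h2 : φ 0 / (2 * ((n : ℂ) + 1)) = ∫ ξ, 𝓕 φ ξ * (1 / ((n : ℂ) + 1) / 2) := by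
    rw [integral_mul_const, integral_fourier]
    field_simp
  rw [h2, ← integral_sub ((𝓕 φ).integrable.mul_const _) (integrable_fourier_line_div φ (hneg n))]
  congr 1
  funext ξ
  rw [← hterm]
  ring

theorem hasSum_vonMangoldt_line :
    Integrable (fun ξ => 𝓕 φ ξ *
      LSeries (fun n => (ArithmeticFunction.vonMangoldt n : ℂ)) (linePt ξ)) ∧
    HasSum (fun n : ℕ => (ArithmeticFunction.vonMangoldt n : ℂ) / (n : ℂ) ^ 2 * φ (Real.log n))
      (∫ ξ, 𝓕 φ ξ * LSeries (fun n => (ArithmeticFunction.vonMangoldt n : ℂ)) (linePt ξ)) := by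
  set Λ : ℕ → ℂ := fun n => (ArithmeticFunction.vonMangoldt n : ℂ)
  have hsum : ∀ s : ℂ, 1 < s.re → LSeriesSummable Λ s := fun s hs =>
    ArithmeticFunction.LSeriesSummable_vonMangoldt hs
  have hterm : ∀ (n : ℕ) (ξ : ℝ), LSeries.term Λ (linePt ξ) n
      = Λ n / (n : ℂ) ^ 2 * cexp (2 * Real.pi * I * ξ * Real.log n) := by
    intro n ξ
    rcases eq_or_ne n 0 with rfl | hn
    · simp [Λ]
    · have hn' : (n : ℂ) ≠ 0 := Nat.cast_ne_zero.2 hn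
      rw [LSeries.term_of_ne_zero hn, linePt, cpow_sub _ _ hn', div_div_eq_mul_div,
        cpow_def_of_ne_zero hn' (2 * Real.pi * I * ξ), ← natCast_log, mul_div_right_comm]
      congr 2
      · norm_cast
      · ring_nf
  have h := integrable_and_hasSum_integral
    (F := fun (n : ℕ) ξ => 𝓕 φ ξ * LSeries.term Λ (linePt ξ) n)
    (G := fun ξ => 𝓕 φ ξ * LSeries Λ (linePt ξ))
    (u := fun n => ‖LSeries.term Λ 2 n‖)
    (B := fun ξ => ‖𝓕 φ ξ‖)
    (fun n => by
      simp_rw [hterm]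
      exact (𝓕 φ).continuous.mul (by fun_prop))
    (hsum 2 (by norm_num)).norm (𝓕 φ).integrable.norm
    (fun n ξ => by
      rw [norm_mul, mul_comm]
      refine mul_le_mul_of_nonneg_right (le_of_eq ?_) (norm_nonneg _)
      rw [LSeries.norm_term_eq, LSeries.norm_term_eq, linePt_re]
      simp)
    (fun ξ => ((hsum (linePt ξ) (by rw [linePt_re]; norm_num)).hasSum).mul_left _)
  refine ⟨h.1, h.2.congr_fun fun n => ?_⟩
  rw [← integral_fourier_mul_exp φ (Real.log n), ← integral_const_mul]
  congr 1
  funext ξ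
  rw [hterm]
  ring

/-- The arithmetic side of the integral of `ξ'/ξ` against a Fourier transform. -/
theorem integral_logDeriv_xi_eq :
    ∫ ξ, 𝓕 φ ξ * logDeriv xi (linePt ξ)
      = halfLaplace φ 2 + halfLaplace φ 1
        - (Real.log Real.pi + Real.eulerMascheroniConstant) / 2 * φ 0
        + ∑' n : ℕ, (φ 0 / (2 * ((n : ℂ) + 1)) - halfLaplace φ (2 + 2 * n))
        - ∑' n : ℕ, (ArithmeticFunction.vonMangoldt n : ℂ) / (n : ℂ) ^ 2 * φ (Real.log n) := by
  obtain ⟨hdi, hds⟩ := hasSum_digamma_line φ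
  obtain ⟨hvi, hvs⟩ := hasSum_vonMangoldt_line φ
  rw [hds.tsum_eq, hvs.tsum_eq]
  have h0 := integrable_fourier_line_div φ (a := 0) (by simp)
  have h1 := integrable_fourier_line_div φ (a := 1) (by simp)
  have hA2 := integral_fourier_line_div φ (a := 0) (by simp)
  have hA1 := integral_fourier_line_div φ (a := 1) (by simp)
  rw [sub_zero] at hA2
  rw [show (2 : ℂ) - 1 = 1 by norm_num] at hA1
  have hc := (𝓕 φ).integrable (μ := volume) |>.mul_const
    (((Real.log Real.pi : ℂ) + Real.eulerMascheroniConstant) / 2)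
  have hc' : ((Real.log Real.pi : ℂ) + Real.eulerMascheroniConstant) / 2 * φ 0
      = ∫ ξ, 𝓕 φ ξ * (((Real.log Real.pi : ℂ) + Real.eulerMascheroniConstant) / 2) := by
    rw [integral_mul_const, integral_fourier, mul_comm]
  rw [hc', ← hA2, ← hA1, ← integral_add' h0 h1, ← integral_sub' (h0.add h1) hc,
    ← integral_add' ((h0.add h1).sub hc) hdi, ← integral_sub' (((h0.add h1).sub hc).add hdi) hvi]
  congr 1
  funext ξ
  simp only [Pi.add_apply, Pi.sub_apply]
  rw [logDeriv_xi_eq (by rw [linePt_re]; norm_num), sub_zero]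
  ring

end LineIntegrals

end LinearStatistics

namespace LinearStatistics

section ExplicitFormula

open Complex Topology Set
open scoped SchwartzMap

/-- The two-sided Laplace transform. -/
noncomputable def laplace (κ : ℝ → ℂ) (z : ℂ) : ℂ := ∫ v : ℝ, κ v * cexp (v * z)

variable {κ : ℝ → ℂ}

theorem integrable_mul_exp (hκ : Continuous κ) (hc : HasCompactSupport κ) (z : ℂ) :
    Integrable fun v : ℝ => κ v * cexp (v * z) :=
  (hκ.mul (by fun_prop)).integrable_of_hasCompactSupport hc.mul_right

theorem laplace_deriv (hκ : ContDiff ℝ ∞ κ) (hc : HasCompactSupport κ) (z : ℂ) :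
    laplace (deriv κ) z = -z * laplace κ z := by
  have hd : ∀ v, HasDerivAt κ (deriv κ v) v := fun v =>
    (hκ.differentiable (by simp) v).hasDerivAt
  have hcd : Continuous (deriv κ) := hκ.continuous_deriv (by simp)
  have hu : ∀ v : ℝ, HasDerivAt (fun v : ℝ => cexp (v * z)) (cexp (v * z) * z) v := by
    intro v
    have := ((hasDerivAt_id v).ofReal_comp.mul_const z).cexp
    simpa using this
  have h1 := integral_mul_deriv_eq_deriv_mul_of_integrable (u := fun v : ℝ => cexp (v * z))
    (v := κ) (u' := fun v : ℝ => cexp (v * z) * z) (v' := deriv κ)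
    (fun v _ => hu v) (fun v _ => hd v)
    ((Continuous.mul (by fun_prop) hcd).integrable_of_hasCompactSupport hc.deriv.mul_left)
    ((Continuous.mul (by fun_prop) hκ.continuous).integrable_of_hasCompactSupport hc.mul_left)
    ((Continuous.mul (by fun_prop) hκ.continuous).integrable_of_hasCompactSupport hc.mul_left)
  unfold laplace
  have h2 : ∫ v : ℝ, deriv κ v * cexp (v * z) = ∫ v : ℝ, cexp (v * z) * deriv κ v := by
    simp_rw [mul_comm]
  rw [h2, h1, neg_mul, ← integral_const_mul]
  congr 2
  funext v
  ring

theorem norm_laplace_le (hκ : Continuous κ) (hc : HasCompactSupport κ) {z : ℂ}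
    (hz : |z.re| ≤ 1 / 2) :
    ‖laplace κ z‖ ≤ ∫ v : ℝ, ‖κ v‖ * Real.exp (|v| / 2) := by
  have hi : Integrable fun v : ℝ => ‖κ v‖ * Real.exp (|v| / 2) :=
    (hκ.norm.mul (by fun_prop)).integrable_of_hasCompactSupport hc.norm.mul_right
  refine norm_integral_le_of_norm_le hi (Eventually.of_forall fun v => ?_)
  rw [norm_mul, Complex.norm_exp]
  refine mul_le_mul_of_nonneg_left (Real.exp_le_exp.2 ?_) (norm_nonneg _)
  simp only [mul_re, ofReal_re, ofReal_im, zero_mul, sub_zero]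
  calc v * z.re ≤ |v * z.re| := le_abs_self _
    _ = |v| * |z.re| := abs_mul _ _
    _ ≤ |v| * (1 / 2) := by gcongr
    _ = _ := by ring

theorem exists_norm_laplace_le (hκ : ContDiff ℝ ∞ κ) (hc : HasCompactSupport κ) :
    ∃ C : ℝ, ∀ z : ℂ, |z.re| ≤ 1 / 2 → ‖laplace κ z‖ ≤ C / (1 + ‖z‖) ^ 2 := by
  have hκ1 : ContDiff ℝ ∞ (deriv κ) := ((contDiff_infty_iff_deriv (𝕜 := ℝ)).1 hκ).2
  have hκ2 : ContDiff ℝ ∞ (deriv (deriv κ)) := ((contDiff_infty_iff_deriv (𝕜 := ℝ)).1 hκ1).2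
  refine ⟨2 * ((∫ v : ℝ, ‖κ v‖ * Real.exp (|v| / 2)) +
    ∫ v : ℝ, ‖deriv (deriv κ) v‖ * Real.exp (|v| / 2)), fun z hz => ?_⟩
  have h0 := norm_laplace_le hκ.continuous hc hz
  have h2 := norm_laplace_le hκ2.continuous hc.deriv.deriv hz
  rw [laplace_deriv hκ1 hc.deriv, laplace_deriv hκ hc, norm_mul, norm_mul, norm_neg] at h2
  rw [le_div_iff₀ (by positivity)]
  have h3 : (1 + ‖z‖) ^ 2 ≤ 2 * (1 + ‖z‖ * ‖z‖) := by nlinarith [sq_nonneg (1 - ‖z‖)]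
  calc ‖laplace κ z‖ * (1 + ‖z‖) ^ 2 ≤ ‖laplace κ z‖ * (2 * (1 + ‖z‖ * ‖z‖)) := by gcongr
    _ = 2 * (‖laplace κ z‖ + ‖z‖ * (‖z‖ * ‖laplace κ z‖)) := by ring
    _ ≤ _ := by gcongr

theorem abs_re_sub_half_le {ρ : ℂ} (hρ : ρ ∈ nontrivialZeros) : |(ρ - 1 / 2).re| ≤ 1 / 2 := by
  obtain ⟨-, h0, h1⟩ := hρ
  rw [abs_le]
  simp
  constructor <;> linarith

theorem summable_laplace_zeros (hκ : ContDiff ℝ ∞ κ) (hc : HasCompactSupport κ) :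
    Summable fun ρ : nontrivialZeros => (multiplicity ρ : ℂ) * laplace κ (ρ - 1 / 2) := by
  obtain ⟨C, hC⟩ := exists_norm_laplace_le hκ hc
  have hC0 : 0 ≤ C := by
    have := (norm_nonneg _).trans (hC 0 (by simp))
    simpa using this
  refine Summable.of_norm_bounded (summable_multiplicity_div_sq.mul_left (4 * C)) fun ρ => ?_
  rw [norm_mul, Complex.norm_natCast]
  have h1 : 1 + ‖(ρ : ℂ)‖ ≤ 2 * (1 + ‖(ρ : ℂ) - 1 / 2‖) := by
    have h2 := norm_sub_norm_le (ρ : ℂ) (1 / 2)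
    have h3 : ‖(1 / 2 : ℂ)‖ = 1 / 2 := by simp
    rw [h3] at h2
    linarith [norm_nonneg ((ρ : ℂ) - 1 / 2)]
  have h4 : C / (1 + ‖(ρ : ℂ) - 1 / 2‖) ^ 2 ≤ 4 * C / (1 + ‖(ρ : ℂ)‖) ^ 2 := by
    rw [div_le_div_iff₀ (by positivity) (by positivity)]
    calc C * (1 + ‖(ρ : ℂ)‖) ^ 2 ≤ C * (2 * (1 + ‖(ρ : ℂ) - 1 / 2‖)) ^ 2 := by gcongr
      _ = _ := by ring
  calc (multiplicity ρ : ℝ) * ‖laplace κ (ρ - 1 / 2)‖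
      ≤ (multiplicity ρ : ℝ) * (4 * C / (1 + ‖(ρ : ℂ)‖) ^ 2) := by
        gcongr
        exact (hC _ (abs_re_sub_half_le ρ.2)).trans h4
    _ = _ := by ring

/-- The Laplace transform over the positive half-line. -/
noncomputable def laplacePos (κ : ℝ → ℂ) (z : ℂ) : ℂ := ∫ v in Ioi (0 : ℝ), κ v * cexp (v * z)

theorem laplacePos_add_laplacePos_neg (hκ : Continuous κ) (hc : HasCompactSupport κ) (z : ℂ) :
    laplacePos κ z + laplacePos (fun v => κ (-v)) (-z) = laplace κ z := by
  have hi := integrable_mul_exp hκ hc z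
  have h1 := integral_comp_neg_Ioi (0 : ℝ) (fun v : ℝ => κ v * cexp (v * z))
  rw [neg_zero] at h1
  have h2 : laplacePos (fun v => κ (-v)) (-z) = ∫ v in Iic (0 : ℝ), κ v * cexp (v * z) := by
    rw [← h1, laplacePos]
    congr 1
    funext v
    congr 2
    push_cast
    ring
  rw [h2, laplacePos, laplace, add_comm, intervalIntegral.integral_Iic_add_Ioi hi.integrableOn
    hi.integrableOn]

theorem laplacePos_add_laplacePos_reflect (hκ : Continuous κ) (hc : HasCompactSupport κ) (a : ℝ) :
    laplacePos κ (-a) + laplacePos (fun v => κ (-v)) (-a)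
      = ∫ v : ℝ, κ v * Real.exp (-a * |v|) := by
  have hi : Integrable fun v : ℝ => κ v * (Real.exp (-a * |v|) : ℂ) :=
    (hκ.mul (by fun_prop)).integrable_of_hasCompactSupport hc.mul_right
  have h1 := integral_comp_neg_Ioi (0 : ℝ) (fun v : ℝ => κ v * (Real.exp (-a * |v|) : ℂ))
  rw [neg_zero] at h1
  have h2 : laplacePos (fun v => κ (-v)) (-a)
      = ∫ v in Iic (0 : ℝ), κ v * (Real.exp (-a * |v|) : ℂ) := by
    rw [← h1, laplacePos]
    refine setIntegral_congr_fun measurableSet_Ioi fun v hv => ?_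
    have hv' : 0 < v := hv
    simp only [abs_neg, abs_of_pos hv']
    push_cast
    ring_nf
  have h3 : laplacePos κ (-a) = ∫ v in Ioi (0 : ℝ), κ v * (Real.exp (-a * |v|) : ℂ) := by
    refine setIntegral_congr_fun measurableSet_Ioi fun v hv => ?_
    have hv' : 0 < v := hv
    simp only [abs_of_pos hv']
    push_cast
    ring_nf
  rw [h2, h3, add_comm, intervalIntegral.integral_Iic_add_Ioi hi.integrableOn hi.integrableOn]

/-- The exponents `2n + 1/2` of the archimedean term. -/
noncomputable def archExp (n : ℕ) : ℝ := 2 * n + 1 / 2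

theorem hasSum_laplacePos_zeros (hκ : ContDiff ℝ ∞ κ) (hc : HasCompactSupport κ) :
    (Summable fun n : ℕ => κ 0 / (2 * ((n : ℂ) + 1)) - laplacePos κ (-archExp n)) ∧
    (Summable fun n : ℕ => (ArithmeticFunction.vonMangoldt n : ℂ) / (Real.sqrt n : ℂ) *
      κ (Real.log n)) ∧
    HasSum (fun ρ : nontrivialZeros => (multiplicity ρ : ℂ) *
      (laplacePos κ (ρ - 1 / 2) + laplacePos κ (-(ρ - 1 / 2))))
      (2 * (laplacePos κ (-(1 / 2)) + laplacePos κ (1 / 2)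
        - (Real.log Real.pi + Real.eulerMascheroniConstant) / 2 * κ 0
        + ∑' n : ℕ, (κ 0 / (2 * ((n : ℂ) + 1)) - laplacePos κ (-archExp n))
        - ∑' n : ℕ, (ArithmeticFunction.vonMangoldt n : ℂ) / (Real.sqrt n : ℂ) *
            κ (Real.log n))) := by
  have hsm : ContDiff ℝ ∞ fun v : ℝ => κ v * cexp (3 / 2 * v) := by
    refine hκ.mul ?_
    exact (contDiff_const.mul ofRealCLM.contDiff).cexp
  have hcm : HasCompactSupport fun v : ℝ => κ v * cexp (3 / 2 * v) := hc.mul_right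
  let φ : 𝓢(ℝ, ℂ) := hcm.toSchwartzMap hsm
  have hφ : ∀ v, φ v = κ v * cexp (3 / 2 * v) := fun v => rfl
  have hhalf : ∀ b : ℂ, halfLaplace φ b = laplacePos κ (3 / 2 - b) := by
    intro b
    unfold halfLaplace laplacePos
    congr 1
    funext v
    rw [hφ, mul_assoc, ← Complex.exp_add]
    congr 2
    ring
  have hφ0 : φ 0 = κ 0 := by simp [hφ]
  have hΛ : ∀ n : ℕ, (ArithmeticFunction.vonMangoldt n : ℂ) / (n : ℂ) ^ 2 * φ (Real.log n)
      = (ArithmeticFunction.vonMangoldt n : ℂ) / (Real.sqrt n : ℂ) * κ (Real.log n) := by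
    intro n
    rcases eq_or_ne n 0 with rfl | hn
    · simp
    · have hn0 : (0 : ℝ) < n := by positivity
      have hs0 : 0 < Real.sqrt n := Real.sqrt_pos.2 hn0
      have h1 : cexp (3 / 2 * (Real.log n : ℂ)) = ((Real.sqrt n) ^ 3 : ℝ) := by
        rw [show (3 / 2 * (Real.log n : ℂ)) = ((3 / 2 * Real.log n : ℝ) : ℂ) by push_cast; ring,
          ← ofReal_exp]
        congr 1
        rw [Real.sqrt_eq_rpow, ← Real.rpow_natCast, ← Real.rpow_mul hn0.le,
          Real.rpow_def_of_pos hn0]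
        norm_num
        ring_nf
      have h2 : (n : ℂ) = ((Real.sqrt n) ^ 2 : ℝ) := by
        rw [Real.sq_sqrt hn0.le]
        simp
      rw [hφ, h1]
      have h3 : (Real.sqrt n : ℂ) ≠ 0 := by exact_mod_cast hs0.ne'
      have h4 : (n : ℂ) ^ 2 = (Real.sqrt n : ℂ) ^ 4 := by
        rw [h2]
        push_cast
        ring
      rw [h4]
      push_cast
      field_simp
  have harch : ∀ n : ℕ, halfLaplace φ (2 + 2 * n) = laplacePos κ (-archExp n) := by
    intro n
    rw [hhalf]
    congr 1
    rw [archExp]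
    push_cast
    ring
  have hz := hasSum_halfLaplace_zeros φ
  rw [integral_logDeriv_xi_eq φ] at hz
  have hd := (hasSum_digamma_line φ).2.summable
  have hv := (hasSum_vonMangoldt_line φ).2.summable
  simp_rw [hΛ, harch, hφ0] at hz hd hv
  refine ⟨hd, hv, ?_⟩
  rw [hhalf, hhalf, show (3 / 2 - 2 : ℂ) = -(1 / 2) by norm_num,
    show (3 / 2 - 1 : ℂ) = 1 / 2 by norm_num] at hz
  refine hz.congr_fun fun ρ => ?_
  rw [hhalf, hhalf]
  congr 3 <;> ring

/-- The explicit formula. -/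
theorem hasSum_explicit_formula (hκ : ContDiff ℝ ∞ κ) (hc : HasCompactSupport κ) :
    (Summable fun n : ℕ => κ 0 / ((n : ℂ) + 1) - ∫ v : ℝ, κ v * Real.exp (-archExp n * |v|)) ∧
    HasSum (fun ρ : nontrivialZeros => (multiplicity ρ : ℂ) * laplace κ (ρ - 1 / 2))
      (laplace κ (1 / 2) + laplace κ (-(1 / 2))
        - (Real.log Real.pi + Real.eulerMascheroniConstant) * κ 0
        + ∑' n : ℕ, (κ 0 / ((n : ℂ) + 1) - ∫ v : ℝ, κ v * Real.exp (-archExp n * |v|))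
        - ∑' n : ℕ, (ArithmeticFunction.vonMangoldt n : ℂ) / (Real.sqrt n : ℂ) *
            (κ (Real.log n) + κ (-Real.log n))) := by
  let κ' : ℝ → ℂ := fun v => κ (-v)
  have hκ' : ContDiff ℝ ∞ κ' := hκ.comp contDiff_neg
  have hc' : HasCompactSupport κ' := hc.comp_homeomorph (Homeomorph.neg ℝ)
  obtain ⟨hd, hv, hz⟩ := hasSum_laplacePos_zeros hκ hc
  obtain ⟨hd', hv', hz'⟩ := hasSum_laplacePos_zeros hκ' hc'
  have h0 : κ' 0 = κ 0 := by simp [κ']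
  have hterm : ∀ n : ℕ, κ 0 / ((n : ℂ) + 1) - ∫ v : ℝ, κ v * Real.exp (-archExp n * |v|)
      = (κ 0 / (2 * ((n : ℂ) + 1)) - laplacePos κ (-archExp n))
        + (κ' 0 / (2 * ((n : ℂ) + 1)) - laplacePos κ' (-archExp n)) := by
    intro n
    rw [← laplacePos_add_laplacePos_reflect hκ.continuous hc, h0]
    have : (n : ℂ) + 1 ≠ 0 := by exact_mod_cast Nat.succ_ne_zero n
    field_simp
    ring
  have hterm' : ∀ n : ℕ, (ArithmeticFunction.vonMangoldt n : ℂ) / (Real.sqrt n : ℂ) *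
      (κ (Real.log n) + κ (-Real.log n))
      = (ArithmeticFunction.vonMangoldt n : ℂ) / (Real.sqrt n : ℂ) * κ (Real.log n)
        + (ArithmeticFunction.vonMangoldt n : ℂ) / (Real.sqrt n : ℂ) * κ' (Real.log n) :=
    fun n => mul_add _ _ _
  have hL : ∀ z, laplacePos κ z + laplacePos κ' (-z) = laplace κ z :=
    laplacePos_add_laplacePos_neg hκ.continuous hc
  refine ⟨(hd.add hd').congr fun n => (hterm n).symm, ?_⟩
  simp_rw [hterm, hterm']
  rw [hd.tsum_add hd', hv.tsum_add hv']
  have hS := summable_laplace_zeros hκ hc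
  obtain ⟨S, hSS⟩ := hS
  have hSr : HasSum (fun ρ : nontrivialZeros =>
      (multiplicity ρ : ℂ) * laplace κ (-(ρ - 1 / 2))) S := by
    have := (reflectZero.hasSum_iff).2 hSS
    refine this.congr_fun fun ρ => ?_
    simp only [Function.comp_apply, reflectZero, Equiv.coe_fn_mk]
    rw [multiplicity_one_sub ρ.2]
    congr 2
    ring
  have h2 := hSS.add hSr
  have h3 := hz.add hz'
  have h4 : S + S = _ := h2.unique (h3.congr_fun fun ρ => by
    rw [← hL, ← hL, neg_neg]
    ring)
  have h5 : S = laplace κ (1 / 2) + laplace κ (-(1 / 2))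
        - (Real.log Real.pi + Real.eulerMascheroniConstant) * κ 0
        + (∑' n : ℕ, (κ 0 / (2 * ((n : ℂ) + 1)) - laplacePos κ (-archExp n))
          + ∑' n : ℕ, (κ' 0 / (2 * ((n : ℂ) + 1)) - laplacePos κ' (-archExp n)))
        - (∑' n : ℕ, (ArithmeticFunction.vonMangoldt n : ℂ) / (Real.sqrt n : ℂ) * κ (Real.log n)
          + ∑' n : ℕ, (ArithmeticFunction.vonMangoldt n : ℂ) / (Real.sqrt n : ℂ) *
            κ' (Real.log n)) := by
    rw [← hL, ← hL, neg_neg]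
    rw [h0] at h4 ⊢
    linear_combination h4 / 2
  rw [← h5]
  exact hSS

end ExplicitFormula

end LinearStatistics

namespace LinearStatistics

section ArchimedeanDensity

open Complex Topology Set

theorem archExp_pos (n : ℕ) : 0 < archExp n := by
  unfold archExp
  positivity

theorem half_succ_le_archExp (n : ℕ) : ((n : ℝ) + 1) / 2 ≤ archExp n := by
  unfold archExp
  have : (0 : ℝ) ≤ n := n.cast_nonneg
  linarith

theorem archExp_le_two_succ (n : ℕ) : archExp n ≤ 2 * ((n : ℝ) + 1) := by
  unfold archExp
  linarith

/-- The terms of the series for the archimedean density. -/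
noncomputable def archTerm (n : ℕ) (y : ℝ) : ℝ :=
  1 / ((n : ℝ) + 1) - 2 * archExp n / (archExp n ^ 2 + y ^ 2)

/-- The archimedean density `Re (Γ'/Γ)(1/4 + iy/2)` up to an additive constant. -/
noncomputable def archDensity (y : ℝ) : ℝ := ∑' n, archTerm n y

/-- The nonnegative part of `archTerm`. -/
noncomputable def archPart (n : ℕ) (y : ℝ) : ℝ :=
  y ^ 2 / (((n : ℝ) + 1) * (archExp n ^ 2 + y ^ 2))

theorem archTerm_eq (n : ℕ) (y : ℝ) : archTerm n y =
    archPart n y - 3 / 2 * archExp n / (((n : ℝ) + 1) * (archExp n ^ 2 + y ^ 2)) := by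
  have h1 : (n : ℝ) + 1 ≠ 0 := by positivity
  have h2 : archExp n ^ 2 + y ^ 2 ≠ 0 := by
    have := archExp_pos n
    positivity
  unfold archTerm archPart
  field_simp
  unfold archExp
  ring

theorem continuous_archTerm (n : ℕ) : Continuous (archTerm n) := by
  unfold archTerm
  refine continuous_const.sub (continuous_const.div (by fun_prop) fun y => ?_)
  have := archExp_pos n
  positivity

theorem archPart_nonneg (n : ℕ) (y : ℝ) : 0 ≤ archPart n y := by
  unfold archPart
  positivity

theorem archPart_le (n : ℕ) (y : ℝ) : archPart n y ≤ 4 * y ^ 2 / ((n : ℝ) + 1) ^ 3 := by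
  have h1 : (0 : ℝ) < (n : ℝ) + 1 := by positivity
  have h2 := half_succ_le_archExp n
  have h3 : ((n : ℝ) + 1) ^ 2 / 4 ≤ archExp n ^ 2 + y ^ 2 := by nlinarith [sq_nonneg y]
  unfold archPart
  calc y ^ 2 / (((n : ℝ) + 1) * (archExp n ^ 2 + y ^ 2))
      ≤ y ^ 2 / (((n : ℝ) + 1) * (((n : ℝ) + 1) ^ 2 / 4)) := by gcongr
    _ = _ := by field_simp

theorem abs_archTerm_sub_archPart_le (n : ℕ) (y : ℝ) :
    |archTerm n y - archPart n y| ≤ 3 * (1 / ((n : ℝ) + 1) ^ 2) := by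
  have h1 : (0 : ℝ) < (n : ℝ) + 1 := by positivity
  have ha := archExp_pos n
  have h2 := half_succ_le_archExp n
  rw [archTerm_eq, sub_sub_cancel_left, abs_neg, abs_of_nonneg (by positivity)]
  calc 3 / 2 * archExp n / (((n : ℝ) + 1) * (archExp n ^ 2 + y ^ 2))
      ≤ 3 / 2 * archExp n / (((n : ℝ) + 1) * (archExp n * (((n : ℝ) + 1) / 2))) := by
        gcongr
        nlinarith [sq_nonneg y]
    _ = _ := by field_simp

theorem abs_archTerm_le (n : ℕ) (y : ℝ) :
    |archTerm n y| ≤ (1 / ((n : ℝ) + 1) ^ 2) * (4 * y ^ 2 + 3) := by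
  have h1 := abs_archTerm_sub_archPart_le n y
  have h2 := archPart_le n y
  have h3 := archPart_nonneg n y
  have h4 : 4 * y ^ 2 / ((n : ℝ) + 1) ^ 3 ≤ 4 * y ^ 2 / ((n : ℝ) + 1) ^ 2 := by
    gcongr 4 * y ^ 2 / ?_
    exact pow_le_pow_right₀ (by linarith [n.cast_nonneg (α := ℝ)]) (by norm_num)
  have h5 : |archTerm n y| ≤ |archTerm n y - archPart n y| + |archPart n y| := by
    simpa using abs_add_le (archTerm n y - archPart n y) (archPart n y)
  rw [abs_of_nonneg h3] at h5
  calc |archTerm n y| ≤ 3 * (1 / ((n : ℝ) + 1) ^ 2) + 4 * y ^ 2 / ((n : ℝ) + 1) ^ 2 := by linarith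
    _ = _ := by ring

theorem summable_archTerm (y : ℝ) : Summable fun n => archTerm n y :=
  Summable.of_norm_bounded (summable_one_div_succ_sq.mul_right (4 * y ^ 2 + 3)) fun n => by
    simpa only [Real.norm_eq_abs] using abs_archTerm_le n y

theorem summable_archPart (y : ℝ) : Summable fun n => archPart n y := by
  have h : Summable fun n => archTerm n y - archPart n y :=
    Summable.of_norm_bounded (summable_one_div_succ_sq.mul_left 3) fun n => by
      simpa only [Real.norm_eq_abs] using abs_archTerm_sub_archPart_le n y
  refine ((summable_archTerm y).sub h).congr fun n => ?_
  ring

theorem tsum_one_div_succ_sq_tail_le {N : ℕ} (hN : 0 < N) :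
    ∑' k : ℕ, 1 / (((k + N : ℕ) : ℝ) + 1) ^ 2 ≤ (1 / N : ℝ) := by
  refine Real.tsum_le_of_sum_range_le (fun k => by positivity) fun m => ?_
  have h : ∀ m : ℕ, ∑ k ∈ Finset.range m, 1 / (((k + N : ℕ) : ℝ) + 1) ^ 2
      ≤ 1 / N - 1 / ((m + N : ℕ) : ℝ) := by
    intro m
    induction m with
    | zero => simp
    | succ m ih =>
      rw [Finset.sum_range_succ]
      have h0 : (0 : ℝ) < ((m + N : ℕ) : ℝ) := by positivity
      have h1 : 1 / (((m + N : ℕ) : ℝ) + 1) ^ 2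
          ≤ 1 / ((m + N : ℕ) : ℝ) - 1 / (((m + N : ℕ) : ℝ) + 1) := by
        rw [div_sub_div _ _ h0.ne' (by positivity), div_le_div_iff₀ (by positivity) (by positivity)]
        nlinarith
      have h2 : ((m + 1 + N : ℕ) : ℝ) = ((m + N : ℕ) : ℝ) + 1 := by push_cast; ring
      rw [h2]
      linarith
  refine (h m).trans ?_
  have : (0 : ℝ) ≤ 1 / ((m + N : ℕ) : ℝ) := by positivity
  linarith

theorem sum_one_div_succ_eq_harmonic (N : ℕ) :
    ∑ n ∈ Finset.range N, 1 / ((n : ℝ) + 1) = (harmonic N : ℝ) := by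
  simp [harmonic]

theorem tsum_archPart_tail_le {N : ℕ} {y : ℝ} (hN : 0 < N) (hy : |y| ≤ N) :
    ∑' k : ℕ, archPart (k + N) y ≤ 4 := by
  have h1 : ∀ k : ℕ, archPart (k + N) y
      ≤ 4 * y ^ 2 / N * (1 / (((k + N : ℕ) : ℝ) + 1) ^ 2) := by
    intro k
    refine (archPart_le _ _).trans ?_
    rw [div_mul_div_comm, mul_one]
    gcongr 4 * y ^ 2 / ?_
    have : (N : ℝ) ≤ ((k + N : ℕ) : ℝ) + 1 := by
      push_cast
      linarith [k.cast_nonneg (α := ℝ)]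
    calc (N : ℝ) * (((k + N : ℕ) : ℝ) + 1) ^ 2
        ≤ (((k + N : ℕ) : ℝ) + 1) * (((k + N : ℕ) : ℝ) + 1) ^ 2 := by gcongr
      _ = _ := by ring
  have hs : Summable fun k : ℕ => 1 / (((k + N : ℕ) : ℝ) + 1) ^ 2 :=
    (summable_nat_add_iff (f := fun n : ℕ => 1 / ((n : ℝ) + 1) ^ 2) N).2 summable_one_div_succ_sq
  have hp : Summable fun k : ℕ => archPart (k + N) y :=
    (summable_nat_add_iff (f := fun n => archPart n y) N).2 (summable_archPart y)
  calc ∑' k : ℕ, archPart (k + N) y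
      ≤ ∑' k : ℕ, 4 * y ^ 2 / N * (1 / (((k + N : ℕ) : ℝ) + 1) ^ 2) :=
        Summable.tsum_le_tsum h1 hp
          (hs.mul_left _)
    _ = 4 * y ^ 2 / N * ∑' k : ℕ, 1 / (((k + N : ℕ) : ℝ) + 1) ^ 2 := tsum_mul_left
    _ ≤ 4 * y ^ 2 / N * (1 / N) := by
        gcongr
        exact tsum_one_div_succ_sq_tail_le hN
    _ = 4 * (|y| / N) ^ 2 := by
        rw [div_pow, sq_abs]
        field_simp
    _ ≤ 4 * 1 ^ 2 := by
        gcongr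
        exact (div_le_one (by positivity)).2 hy
    _ = 4 := by norm_num

theorem abs_tsum_archPart_sub_log_le (y : ℝ) :
    |∑' n, archPart n y - Real.log (1 + |y|)| ≤ 40 := by
  set N : ℕ := ⌊|y|⌋₊ + 1 with hNdef
  have hy := abs_nonneg y
  have hN1 : (N : ℝ) ≤ |y| + 1 := by
    rw [hNdef]
    push_cast
    linarith [Nat.floor_le hy]
  have hN2 : |y| ≤ N := by
    rw [hNdef]
    push_cast
    exact (Nat.lt_floor_add_one _).le
  have hN0 : 0 < N := Nat.succ_pos _
  rw [← (summable_archPart y).sum_add_tsum_nat_add N]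
  have htail := tsum_archPart_tail_le hN0 hN2
  have htail0 : 0 ≤ ∑' k : ℕ, archPart (k + N) y := tsum_nonneg fun k => archPart_nonneg _ _
  have hupper : ∑ n ∈ Finset.range N, archPart n y ≤ (harmonic N : ℝ) := by
    rw [← sum_one_div_succ_eq_harmonic]
    refine Finset.sum_le_sum fun n _ => ?_
    have ha := archExp_pos n
    unfold archPart
    rw [div_le_div_iff₀ (by positivity) (by positivity)]
    have : (0 : ℝ) < (n : ℝ) + 1 := by positivity
    nlinarith [mul_pos this (pow_pos ha 2)]
  have hlower : (harmonic N : ℝ) - 32 ≤ ∑ n ∈ Finset.range N, archPart n y := by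
    rw [← sum_one_div_succ_eq_harmonic]
    have h1 : ∀ n ∈ Finset.range N, 1 / ((n : ℝ) + 1) - 4 * N / (y ^ 2 + 1 / 4)
        ≤ archPart n y := by
      intro n hn
      have hnN : (n : ℝ) + 1 ≤ N := by exact_mod_cast Finset.mem_range.1 hn
      have hn1 : (0 : ℝ) < (n : ℝ) + 1 := by positivity
      have ha := archExp_pos n
      have ha2 := archExp_le_two_succ n
      have ha3 : 1 / 2 ≤ archExp n := by
        unfold archExp
        linarith [n.cast_nonneg (α := ℝ)]
      have h2 : 1 / ((n : ℝ) + 1) - archPart n y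
          = archExp n ^ 2 / (((n : ℝ) + 1) * (archExp n ^ 2 + y ^ 2)) := by
        unfold archPart
        field_simp
        ring
      have h3 : archExp n ^ 2 / (((n : ℝ) + 1) * (archExp n ^ 2 + y ^ 2))
          ≤ (2 * ((n : ℝ) + 1)) ^ 2 / (((n : ℝ) + 1) * (y ^ 2 + 1 / 4)) := by
        refine div_le_div₀ (by positivity) (by gcongr) (by positivity) ?_
        refine mul_le_mul_of_nonneg_left ?_ hn1.le
        nlinarith
      have h4 : (2 * ((n : ℝ) + 1)) ^ 2 / (((n : ℝ) + 1) * (y ^ 2 + 1 / 4))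
          = 4 * ((n : ℝ) + 1) / (y ^ 2 + 1 / 4) := by
        field_simp
        ring
      have h5 : 4 * ((n : ℝ) + 1) / (y ^ 2 + 1 / 4) ≤ 4 * N / (y ^ 2 + 1 / 4) := by gcongr
      linarith
    have h2 := Finset.sum_le_sum h1
    rw [Finset.sum_sub_distrib, Finset.sum_const, Finset.card_range, nsmul_eq_mul] at h2
    have h3 : (N : ℝ) * (4 * N / (y ^ 2 + 1 / 4)) ≤ 32 := by
      rw [mul_div_assoc', div_le_iff₀ (by positivity)]
      have h4 : (N : ℝ) ^ 2 ≤ (|y| + 1) ^ 2 := by gcongr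
      nlinarith [sq_abs y, sq_nonneg (|y| - 1)]
    linarith
  have hh1 := log_add_one_le_harmonic N
  have hh2 := harmonic_le_one_add_log N
  have hl1 : Real.log (1 + |y|) ≤ Real.log ((N + 1 : ℕ) : ℝ) := by
    apply Real.log_le_log (by positivity)
    push_cast
    linarith
  have hl2 : Real.log N ≤ Real.log (1 + |y|) := by
    apply Real.log_le_log (by positivity)
    linarith
  rw [abs_le]
  constructor <;> linarith

theorem exists_abs_archDensity_sub_log_le :
    ∃ C : ℝ, ∀ y, |archDensity y - Real.log (1 + |y|)| ≤ C := by
  refine ⟨(∑' n : ℕ, 3 * (1 / ((n : ℝ) + 1) ^ 2)) + 40, fun y => ?_⟩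
  have h1 : |archDensity y - ∑' n, archPart n y| ≤ ∑' n : ℕ, 3 * (1 / ((n : ℝ) + 1) ^ 2) := by
    rw [archDensity, ← (summable_archTerm y).tsum_sub (summable_archPart y), ← Real.norm_eq_abs]
    refine tsum_of_norm_bounded (summable_one_div_succ_sq.mul_left 3).hasSum fun n => ?_
    simpa only [Real.norm_eq_abs] using abs_archTerm_sub_archPart_le n y
  refine (abs_sub_le _ (∑' n, archPart n y) _).trans ?_
  exact add_le_add h1 (abs_tsum_archPart_sub_log_le y)

theorem abs_log_one_add_abs_sub_le (a b : ℝ) :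
    |Real.log (1 + |a|) - Real.log (1 + |b|)| ≤ |a - b| := by
  have key : ∀ a b : ℝ, Real.log (1 + |a|) - Real.log (1 + |b|) ≤ |a - b| := by
    intro a b
    have ha : 0 < 1 + |a| := by positivity
    have hb : 0 < 1 + |b| := by positivity
    rw [← Real.log_div ha.ne' hb.ne']
    refine (Real.log_le_sub_one_of_pos (by positivity)).trans ?_
    rw [div_sub_one hb.ne', div_le_iff₀ hb]
    have h1 := abs_sub_abs_le_abs_sub a b
    nlinarith [abs_nonneg (a - b), abs_nonneg b, mul_nonneg (abs_nonneg (a - b)) (abs_nonneg b)]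
  rw [abs_le]
  constructor
  · have := key b a
    rw [abs_sub_comm] at this
    linarith
  · exact key a b

end ArchimedeanDensity

end LinearStatistics

namespace LinearStatistics

section LinearStatisticFormula

open Complex Topology Set
open scoped SchwartzMap

theorem integrable_and_integral_exp_abs {b : ℝ} (hb : 0 < b) (t : ℝ) :
    (Integrable fun u : ℝ => cexp (-(b * |u| : ℝ) - I * (t * u))) ∧
    ∫ u : ℝ, cexp (-(b * |u| : ℝ) - I * (t * u)) = ((2 * b / (b ^ 2 + t ^ 2) : ℝ) : ℂ) := by
  have hre1 : 0 < ((b : ℂ) - I * t).re := by simpa using hb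
  have hre2 : (-(b : ℂ) - I * t).re < 0 := by simpa using hb
  have e1 : EqOn (fun u : ℝ => cexp (((b : ℂ) - I * t) * u))
      (fun u : ℝ => cexp (-(b * |u| : ℝ) - I * (t * u))) (Iic 0) := by
    intro u hu
    simp only [abs_of_nonpos (mem_Iic.1 hu)]
    congr 1
    push_cast
    ring
  have e2 : EqOn (fun u : ℝ => cexp ((-(b : ℂ) - I * t) * u))
      (fun u : ℝ => cexp (-(b * |u| : ℝ) - I * (t * u))) (Ioi 0) := by
    intro u hu
    simp only [abs_of_pos (mem_Ioi.1 hu)]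
    congr 1
    push_cast
    ring
  have i1 := (integrableOn_exp_mul_complex_Iic hre1 0).congr_fun e1 measurableSet_Iic
  have i2 := (integrableOn_exp_mul_complex_Ioi hre2 0).congr_fun e2 measurableSet_Ioi
  constructor
  · rw [← integrableOn_univ, ← Iic_union_Ioi (a := (0 : ℝ))]
    exact i1.union i2
  · rw [← intervalIntegral.integral_Iic_add_Ioi i1 i2, ← setIntegral_congr_fun measurableSet_Iic e1,
      ← setIntegral_congr_fun measurableSet_Ioi e2, integral_exp_mul_complex_Iic hre1,
      integral_exp_mul_complex_Ioi hre2]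
    have n1 : (b : ℂ) - I * t ≠ 0 := fun h => by rw [h] at hre1; simp at hre1
    have n2 : -(b : ℂ) - I * t ≠ 0 := fun h => by rw [h] at hre2; simp at hre2
    have n3 : (b : ℂ) ^ 2 + (t : ℂ) ^ 2 ≠ 0 := by
      have : b ^ 2 + t ^ 2 ≠ 0 := by positivity
      exact_mod_cast this
    push_cast
    simp only [mul_zero, Complex.exp_zero]
    rw [div_add_div _ _ n1 n2, div_eq_div_iff (mul_ne_zero n1 n2) n3]
    linear_combination (-2 * (b : ℂ) * (t : ℂ) ^ 2) * I_sq

variable {f : ℝ → ℂ}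

/-- The kernel to which the explicit formula is applied. -/
noncomputable def zeroKernel (f : ℝ → ℂ) (L τ v : ℝ) : ℂ :=
  1 / L * (𝓕 f (v / L) * cexp (-(I * (τ * v))))

theorem zeroKernel_zero (L τ : ℝ) : zeroKernel f L τ 0 = 1 / L * ∫ x, f x := by
  simp [zeroKernel, Real.fourier_eq']

theorem contDiff_zeroKernel (hf : IsTestFunction f) (L τ : ℝ) :
    ContDiff ℝ ∞ (zeroKernel f L τ) := by
  refine contDiff_const.mul ((hf.smooth_fourier.comp (contDiff_id.div_const L)).mul ?_)
  exact (contDiff_const.mul (contDiff_const.mul ofRealCLM.contDiff)).neg.cexp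

theorem hasCompactSupport_zeroKernel (hf : IsTestFunction f) {L : ℝ} (hL : 0 < L) (τ : ℝ) :
    HasCompactSupport (zeroKernel f L τ) := by
  refine HasCompactSupport.mul_left (HasCompactSupport.mul_right ?_)
  have := hf.compact_fourier.comp_homeomorph (Homeomorph.mulRight₀ L⁻¹ (inv_ne_zero hL.ne'))
  simpa [Function.comp_def, div_eq_mul_inv] using this

theorem zeroTerm_eq {T : ℝ} (hT : 1 < T) (τ : ℝ) (ρ : nontrivialZeros) :
    zeroTerm f T τ ρ = (multiplicity ρ : ℂ) * laplace (zeroKernel f (Real.log T) τ) (ρ - 1 / 2) := by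
  set L := Real.log T
  have hL : 0 < L := Real.log_pos hT
  have hLc : (L : ℂ) ≠ 0 := by exact_mod_cast hL.ne'
  unfold zeroTerm
  congr 1
  let k : ℝ → ℂ := fun u => 1 / L * (𝓕 f u * cexp (u * L * ((ρ : ℂ) - 1 / 2) - I * τ * (u * L)))
  have h1 : laplace (zeroKernel f L τ) (ρ - 1 / 2) = ∫ v : ℝ, k (v / L) := by
    unfold laplace zeroKernel
    congr 1
    funext v
    simp only [k]
    rw [mul_assoc, mul_assoc, ← Complex.exp_add]
    congr 3
    push_cast
    field_simp
    ring
  rw [h1, Measure.integral_comp_div, abs_of_pos hL, ← integral_smul]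
  unfold entireExt
  congr 1
  funext u
  simp only [k, real_smul]
  rw [← mul_assoc (L : ℂ), mul_one_div_cancel hLc, one_mul]
  congr 2
  unfold ordinate
  push_cast
  have hpi : (Real.pi : ℂ) ≠ 0 := by exact_mod_cast Real.pi_ne_zero
  field_simp
  ring

theorem summable_zeroTerm (hf : IsTestFunction f) {T : ℝ} (hT : 1 < T) (τ : ℝ) :
    Summable (zeroTerm f T τ) := by
  have h := (hasSum_explicit_formula (contDiff_zeroKernel hf (Real.log T) τ)
    (hasCompactSupport_zeroKernel hf (Real.log_pos hT) τ)).2.summable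
  exact h.congr fun ρ => (zeroTerm_eq hT τ ρ).symm

theorem IsTestFunction.integrable_one_add_cube_mul (hf : IsTestFunction f) :
    Integrable fun x : ℝ => (1 + ‖x‖) ^ 3 * ‖f x‖ := by
  let g : 𝓢(ℝ, ℂ) := hf.compact_fourier.toSchwartzMap hf.smooth_fourier
  have hint : Integrable (𝓕 f) :=
    hf.smooth_fourier.continuous.integrable_of_hasCompactSupport hf.compact_fourier
  have h := hf.continuous.fourierInv_fourier_eq hf.integrable hint
  have h2 : ∀ x, (𝓕⁻ g) x = f x := by
    intro x
    rw [SchwartzMap.fourierInv_coe, ← congrFun h x]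
    rfl
  have := integrable_cube_mul_norm (𝓕⁻ g)
  simpa only [h2] using this

theorem integral_zeroKernel_mul_exp (hf : IsTestFunction f) {L : ℝ} (hL : 0 < L) (τ : ℝ)
    {a : ℝ} (ha : 0 < a) :
    ∫ v : ℝ, zeroKernel f L τ v * Real.exp (-a * |v|)
      = 1 / L * ∫ x : ℝ, f x * ((2 * a / (a ^ 2 + (τ + 2 * Real.pi * x / L) ^ 2) : ℝ) : ℂ) := by
  have hLc : (L : ℂ) ≠ 0 := by exact_mod_cast hL.ne'
  let m : ℝ → ℂ := fun u => cexp (-((a * L) * |u| : ℝ) - I * ((τ * L : ℝ) * u))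
  have hm : Integrable m := (integrable_and_integral_exp_abs (mul_pos ha hL) (τ * L)).1
  have hmF : ∀ x, 𝓕 m x = ((1 / L * (2 * a / (a ^ 2 + (τ + 2 * Real.pi * x / L) ^ 2)) : ℝ) : ℂ) := by
    intro x
    have h := (integrable_and_integral_exp_abs (mul_pos ha hL) (τ * L + 2 * Real.pi * x)).2
    rw [Real.fourier_real_eq_integral_exp_smul]
    have h1 : ∀ v : ℝ, cexp (↑(-2 * Real.pi * v * x) * I) • m v
        = cexp (-((a * L) * |v| : ℝ) - I * ((τ * L + 2 * Real.pi * x : ℝ) * v)) := by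
      intro v
      simp only [m, smul_eq_mul]
      rw [← Complex.exp_add]
      congr 1
      push_cast
      ring
    simp_rw [h1]
    rw [h]
    congr 1
    have h3 : a ^ 2 + (τ + 2 * Real.pi * x / L) ^ 2 ≠ 0 := by positivity
    have h4 : (a * L) ^ 2 + (τ * L + 2 * Real.pi * x) ^ 2
        = L ^ 2 * (a ^ 2 + (τ + 2 * Real.pi * x / L) ^ 2) := by
      field_simp
    rw [h4]
    field_simp
  have hflip := VectorFourier.integral_fourierIntegral_smul_eq_flip (L := innerₗ ℝ)
    (μ := volume) (ν := volume) Real.continuous_fourierChar continuous_inner hf.integrable hm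
  have hflip' : ∫ ξ, 𝓕 f ξ * m ξ = ∫ x, f x * 𝓕 m x := by
    simpa using! hflip
  let k : ℝ → ℂ := fun u => 1 / L * (𝓕 f u * m u)
  have h1 : ∫ v : ℝ, zeroKernel f L τ v * Real.exp (-a * |v|) = ∫ v : ℝ, k (v / L) := by
    congr 1
    funext v
    simp only [k, m, zeroKernel]
    rw [mul_assoc, mul_assoc, ofReal_exp, ← Complex.exp_add, abs_div, abs_of_pos hL]
    congr 3
    push_cast
    field_simp
    ring
  rw [h1, Measure.integral_comp_div, abs_of_pos hL, ← integral_smul]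
  have h2 : ∀ u, L • k u = 𝓕 f u * m u := by
    intro u
    simp only [k, real_smul]
    rw [← mul_assoc, mul_one_div_cancel hLc, one_mul]
  simp_rw [h2]
  rw [hflip', ← integral_const_mul]
  congr 1
  funext x
  rw [hmF]
  push_cast
  ring

theorem four_mul_shift_sq_le (L τ x : ℝ) :
    4 * (τ + 2 * Real.pi * x / L) ^ 2 + 3
      ≤ (3 + 8 * τ ^ 2 + 8 * (2 * Real.pi / L) ^ 2) * (1 + ‖x‖) ^ 3 := by
  have h1 : (τ + 2 * Real.pi * x / L) ^ 2 ≤ 2 * τ ^ 2 + 2 * (2 * Real.pi / L) ^ 2 * ‖x‖ ^ 2 := by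
    rw [Real.norm_eq_abs, sq_abs]
    have : 2 * Real.pi * x / L = 2 * Real.pi / L * x := by ring
    rw [this]
    nlinarith [sq_nonneg (τ - 2 * Real.pi / L * x)]
  have hx := norm_nonneg x
  have h2 : 1 ≤ (1 + ‖x‖) ^ 3 := one_le_pow₀ (by linarith)
  have h3 : ‖x‖ ^ 2 ≤ (1 + ‖x‖) ^ 3 :=
    calc ‖x‖ ^ 2 ≤ (1 + ‖x‖) ^ 2 := by gcongr; linarith
      _ ≤ (1 + ‖x‖) ^ 3 := pow_le_pow_right₀ (by linarith) (by norm_num)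
  have h4 := mul_le_mul_of_nonneg_left h3 (sq_nonneg (2 * Real.pi / L))
  have h5 := mul_le_mul_of_nonneg_left h2 (sq_nonneg τ)
  linarith

/-- The archimedean contribution to the linear statistic. -/
noncomputable def archAverage (f : ℝ → ℂ) (L τ : ℝ) : ℂ :=
  1 / L * ∫ x : ℝ, f x * (archDensity (τ + 2 * Real.pi * x / L) : ℂ)

theorem integrable_and_hasSum_archAverage (hf : IsTestFunction f) {L : ℝ} (hL : 0 < L) (τ : ℝ) :
    (Integrable fun x : ℝ => f x * (archDensity (τ + 2 * Real.pi * x / L) : ℂ)) ∧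
    HasSum (fun n : ℕ => zeroKernel f L τ 0 / ((n : ℂ) + 1)
      - ∫ v : ℝ, zeroKernel f L τ v * Real.exp (-archExp n * |v|)) (archAverage f L τ) := by
  have h := integrable_and_hasSum_integral
    (F := fun (n : ℕ) (x : ℝ) => f x * (archTerm n (τ + 2 * Real.pi * x / L) : ℂ))
    (G := fun x : ℝ => f x * (archDensity (τ + 2 * Real.pi * x / L) : ℂ))
    (u := fun n : ℕ => 1 / ((n : ℝ) + 1) ^ 2)
    (B := fun x => (3 + 8 * τ ^ 2 + 8 * (2 * Real.pi / L) ^ 2) * ((1 + ‖x‖) ^ 3 * ‖f x‖))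
    (fun n => hf.continuous.mul (continuous_ofReal.comp ((continuous_archTerm n).comp
      (by fun_prop)))) summable_one_div_succ_sq
    (hf.integrable_one_add_cube_mul.const_mul _)
    (fun n x => by
      rw [norm_mul, Complex.norm_real, Real.norm_eq_abs]
      have h1 := abs_archTerm_le n (τ + 2 * Real.pi * x / L)
      have h2 := four_mul_shift_sq_le L τ x
      calc ‖f x‖ * |archTerm n (τ + 2 * Real.pi * x / L)|
          ≤ ‖f x‖ * (1 / ((n : ℝ) + 1) ^ 2 *
            ((3 + 8 * τ ^ 2 + 8 * (2 * Real.pi / L) ^ 2) * (1 + ‖x‖) ^ 3)) := by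
            refine mul_le_mul_of_nonneg_left (h1.trans ?_) (norm_nonneg _)
            exact mul_le_mul_of_nonneg_left h2 (by positivity)
        _ = _ := by ring)
    (fun x => ((hasSum_ofReal.2 (summable_archTerm _).hasSum).mul_left (f x)))
  refine ⟨h.1, (h.2.mul_left (1 / (L : ℂ))).congr_fun fun n => ?_⟩
  rw [integral_zeroKernel_mul_exp hf hL τ (archExp_pos n), zeroKernel_zero, mul_div_assoc, ← mul_sub]
  congr 1
  have hi2 : Integrable fun x : ℝ => f x *
      ((2 * archExp n / (archExp n ^ 2 + (τ + 2 * Real.pi * x / L) ^ 2) : ℝ) : ℂ) := by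
    have ha := archExp_pos n
    refine hf.integrable.mul_bdd (c := 2 / archExp n) ?_ (Eventually.of_forall fun x => ?_)
    · refine (continuous_ofReal.comp (continuous_const.div (by fun_prop) fun y => ?_)).aestronglyMeasurable
      positivity
    · rw [Complex.norm_real, Real.norm_of_nonneg (by positivity),
        div_le_div_iff₀ (by positivity) ha]
      nlinarith [sq_nonneg (τ + 2 * Real.pi * x / L)]
  rw [← integral_div, ← integral_sub (hf.integrable.div_const _) hi2]
  congr 1
  funext x
  unfold archTerm
  push_cast
  ring

/-- The contribution of the poles to the linear statistic. -/
noncomputable def poleTerm (f : ℝ → ℂ) (L τ : ℝ) : ℂ :=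
  laplace (zeroKernel f L τ) (1 / 2) + laplace (zeroKernel f L τ) (-(1 / 2))

/-- The contribution of a prime power to the linear statistic. -/
noncomputable def primeTerm (f : ℝ → ℂ) (L : ℝ) (n : ℕ) (τ : ℝ) : ℂ :=
  (ArithmeticFunction.vonMangoldt n : ℂ) / (Real.sqrt n : ℂ) *
    (zeroKernel f L τ (Real.log n) + zeroKernel f L τ (-Real.log n))

theorem exists_primeTerm_eq_zero (hf : IsTestFunction f) {L : ℝ} (hL : 0 < L) :
    ∃ N : ℕ, ∀ n, N ≤ n → ∀ τ, primeTerm f L n τ = 0 := by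
  obtain ⟨B, hB⟩ := hf.compact_fourier.isCompact.isBounded.subset_closedBall 0
  have hz : ∀ u, B < |u| → 𝓕 f u = 0 := by
    intro u hu
    refine image_eq_zero_of_notMem_tsupport fun h => ?_
    have := hB h
    rw [mem_closedBall_zero_iff, Real.norm_eq_abs] at this
    linarith
  have hlim : Tendsto (fun n : ℕ => Real.log n / L) atTop atTop :=
    (Real.tendsto_log_atTop.comp tendsto_natCast_atTop_atTop).atTop_div_const hL
  obtain ⟨N, hN⟩ := eventually_atTop.1 (hlim.eventually_gt_atTop B)
  refine ⟨N, fun n hn τ => ?_⟩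
  have h1 := hN n hn
  unfold primeTerm zeroKernel
  rw [hz _ (h1.trans_le (le_abs_self _)), hz (-Real.log n / L)
    (by rw [neg_div, abs_neg]; exact h1.trans_le (le_abs_self _))]
  simp

theorem linearStatistic_eq (hf : IsTestFunction f) {T : ℝ} (hT : 1 < T) {N : ℕ}
    (hN : ∀ n, N ≤ n → ∀ τ, primeTerm f (Real.log T) n τ = 0) (τ : ℝ) :
    linearStatistic f T τ = poleTerm f (Real.log T) τ
      - (Real.log Real.pi + Real.eulerMascheroniConstant) * (1 / Real.log T * ∫ x, f x)
      + archAverage f (Real.log T) τ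
      - ∑ n ∈ Finset.range N, primeTerm f (Real.log T) n τ := by
  have hL := Real.log_pos hT
  have h := (hasSum_explicit_formula (contDiff_zeroKernel hf (Real.log T) τ)
    (hasCompactSupport_zeroKernel hf hL τ)).2.tsum_eq
  unfold linearStatistic
  simp_rw [zeroTerm_eq hT τ]
  rw [h, (integrable_and_hasSum_archAverage hf hL τ).2.tsum_eq, zeroKernel_zero]
  congr 1
  exact tsum_eq_sum fun n hn => hN n (by simpa using hn) τ

end LinearStatisticFormula

end LinearStatistics

namespace LinearStatistics

section Weights

open Complex Topology Set
open scoped SchwartzMap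

variable {w : ℝ → ℝ}

theorem integrable_averageIntegrand_iff {T H : ℝ} (hH : 0 < H) (W : ℝ → ℂ) :
    Integrable (averageIntegrand w T H W) ↔
      Integrable fun y : ℝ => W (T + H * y) * (w y : ℂ) := by
  have hHc : (H : ℂ) ≠ 0 := by exact_mod_cast hH.ne'
  have h1 : (fun y : ℝ => W (T + H * y) * (w y : ℂ))
      = fun y => (H : ℂ) * averageIntegrand w T H W (T + H * y) := by
    funext y
    unfold averageIntegrand
    rw [add_sub_cancel_left, mul_div_cancel_left₀ _ hH.ne']
    push_cast
    field_simp
  rw [h1, integrable_const_mul_iff (IsUnit.mk0 _ hHc),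
    integrable_comp_mul_left_iff (fun x => averageIntegrand w T H W (T + x)) hH.ne']
  exact ⟨fun h => h.comp_add_left T, fun h => by simpa using h.comp_add_left (-T)⟩

theorem average_eq {T H : ℝ} (hH : 0 < H) (W : ℝ → ℂ) :
    average w T H W = ∫ y : ℝ, W (T + H * y) * (w y : ℂ) := by
  have hHc : (H : ℂ) ≠ 0 := by exact_mod_cast hH.ne'
  have h1 : (fun y : ℝ => W (T + H * y) * (w y : ℂ))
      = fun y => (H : ℂ) * averageIntegrand w T H W (T + H * y) := by
    funext y
    unfold averageIntegrand
    rw [add_sub_cancel_left, mul_div_cancel_left₀ _ hH.ne']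
    push_cast
    field_simp
  rw [h1, integral_const_mul,
    Measure.integral_comp_mul_left (fun x => averageIntegrand w T H W (T + x)) H,
    integral_add_left_eq_self (averageIntegrand w T H W) T, abs_of_pos (inv_pos.2 hH), real_smul,
    ofReal_inv, mul_inv_cancel_left₀ hHc]
  rfl

theorem continuous_fourier_of_integrable {φ : ℝ → ℂ} (hφ : Integrable φ) : Continuous (𝓕 φ) :=
  VectorFourier.fourierIntegral_continuous Real.continuous_fourierChar continuous_inner hφ

theorem integral_fourier_mul_eq_flip {φ ψ : ℝ → ℂ} (hφ : Integrable φ) (hψ : Integrable ψ) :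
    ∫ ξ, 𝓕 φ ξ * ψ ξ = ∫ x, φ x * 𝓕 ψ x := by
  have h := VectorFourier.integral_fourierIntegral_smul_eq_flip (L := innerₗ ℝ)
    (μ := volume) (ν := volume) Real.continuous_fourierChar continuous_inner hφ hψ
  simpa using! h

/-- An integrable function with integrable Fourier transform is essentially bounded. -/
theorem ae_norm_le_integral_norm_fourier {φ : ℝ → ℂ} (hφ : Integrable φ)
    (hφF : Integrable (𝓕 φ)) : ∀ᵐ x, ‖φ x‖ ≤ ∫ ξ, ‖𝓕 φ ξ‖ := by
  have hc : Continuous (fun x => 𝓕 (𝓕 φ) (-x)) :=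
    (continuous_fourier_of_integrable hφF).comp continuous_neg
  have h : ∀ᵐ x, φ x = 𝓕 (𝓕 φ) (-x) := by
    refine ae_eq_of_integral_contDiff_smul_eq hφ.locallyIntegrable hc.locallyIntegrable
      fun g hg hgc => ?_
    have hgs : ContDiff ℝ ∞ fun x => ((g (-x) : ℝ) : ℂ) :=
      ofRealCLM.contDiff.comp (hg.comp contDiff_neg)
    have hgcs : HasCompactSupport fun x => ((g (-x) : ℝ) : ℂ) :=
      (hgc.comp_homeomorph (Homeomorph.neg ℝ)).comp_left ofReal_zero
    let G : 𝓢(ℝ, ℂ) := hgcs.toSchwartzMap hgs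
    have h1 : ∫ x, g x • 𝓕 (𝓕 φ) (-x) = ∫ x, 𝓕 (𝓕 φ) x * G x := by
      rw [← integral_neg_eq_self]
      congr 1
      funext x
      rw [neg_neg, real_smul, mul_comm]
      rfl
    have h2 : ∀ x, 𝓕 (𝓕 (G : ℝ → ℂ)) x = (g x : ℂ) := by
      intro x
      have := fourier_fourier_apply G x
      rw [← SchwartzMap.fourier_coe]
      rw [fourier_schwartz_eq] at this
      rw [this]
      change ((g (- -x) : ℝ) : ℂ) = _
      rw [neg_neg]
    have hGi : Integrable (𝓕 (G : ℝ → ℂ)) := by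
      rw [← SchwartzMap.fourier_coe]
      exact (𝓕 G).integrable
    rw [h1, integral_fourier_mul_eq_flip hφF G.integrable, integral_fourier_mul_eq_flip hφ hGi]
    congr 1
    funext x
    rw [h2, real_smul, mul_comm]
  filter_upwards [h] with x hx
  rw [hx]
  exact VectorFourier.norm_fourierIntegral_le_integral_norm _ _ _ _ _

/-- The function `max(-log |z|, 0)`. -/
noncomputable def logDip (z : ℝ) : ℝ := (Icc (-1 : ℝ) 1).indicator (fun z => -Real.log z) z

theorem logDip_nonneg (z : ℝ) : 0 ≤ logDip z := by
  refine indicator_nonneg (fun z hz => ?_) z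
  rw [← Real.log_abs]
  exact neg_nonneg.2 (Real.log_nonpos (abs_nonneg z) (abs_le.2 hz))

theorem integrable_logDip : Integrable logDip := by
  unfold logDip
  rw [integrable_indicator_iff measurableSet_Icc, integrableOn_Icc_iff_integrableOn_Ioc]
  exact ((intervalIntegrable_iff_integrableOn_Ioc_of_le (by norm_num)).1
    intervalIntegral.intervalIntegrable_log').neg

theorem logDip_eq (z : ℝ) : logDip z = -Real.log (min |z| 1) := by
  unfold logDip
  by_cases h : |z| ≤ 1
  · rw [indicator_of_mem (show z ∈ Icc (-1 : ℝ) 1 from abs_le.1 h), min_eq_left h, Real.log_abs]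
  · rw [indicator_of_notMem (show z ∉ Icc (-1 : ℝ) 1 from fun h' => h (abs_le.2 h')), min_eq_right (not_le.1 h).le,
      Real.log_one, neg_zero]

theorem abs_log_shift_sub_log_le {T H c y : ℝ} (hT : 1 ≤ T) (hH : 0 < H) (hc : 0 ≤ c)
    (hHT : H ≤ c * T) (hy : y + T / H ≠ 0) :
    |Real.log (1 + |T + H * y|) - Real.log T|
      ≤ Real.log (2 + c) + Real.log (1 + |y|) + logDip (y + T / H) := by
  have hT0 : 0 < T := by linarith
  have hy0 := abs_nonneg y
  have hlogc : 0 ≤ Real.log (2 + c) := Real.log_nonneg (by linarith)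
  have hd := logDip_nonneg (y + T / H)
  have hS : 0 < 1 + |T + H * y| := by positivity
  rw [abs_le]
  constructor
  · rw [logDip_eq]
    set z := y + T / H with hz
    have hzT : T + H * y = H * z := by
      rw [hz]
      field_simp
      ring
    have hz0 : 0 < |z| := abs_pos.2 hy
    have hmin : 0 < min |z| 1 := lt_min hz0 one_pos
    have h1 : T ≤ H * |z| + H * |y| := by
      have h2 : T = H * z - H * y := by linarith
      have h3 := abs_sub (H * z) (H * y)
      rw [← h2, abs_mul, abs_mul, abs_of_pos hH] at h3
      exact (le_abs_self T).trans h3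
    have h2 : T * min |z| 1 ≤ (1 + |T + H * y|) * (1 + |y|) := by
      rw [hzT, abs_mul, abs_of_pos hH]
      have h4 : min |z| 1 ≤ |z| := min_le_left _ _
      have h5 : min |z| 1 ≤ 1 := min_le_right _ _
      have h6 : H * |z| * min |z| 1 ≤ H * |z| * 1 := by gcongr
      have h7 : H * |y| * min |z| 1 ≤ H * |y| * |z| := by gcongr
      have h8 := mul_le_mul_of_nonneg_right h1 hmin.le
      nlinarith
    have h3 := Real.log_le_log (mul_pos hT0 hmin) h2
    rw [Real.log_mul hT0.ne' hmin.ne', Real.log_mul hS.ne' (by positivity)] at h3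
    linarith
  · have h2 : 1 + |T + H * y| ≤ T * (2 + c) * (1 + |y|) := by
      have h3 := abs_add_le T (H * y)
      rw [abs_mul, abs_of_pos hH, abs_of_pos hT0] at h3
      have h4 : H * |y| ≤ c * T * |y| := by gcongr
      have h5 : 0 ≤ T * |y| := by positivity
      have h6 : 0 ≤ c * T := by positivity
      nlinarith
    have h3 := Real.log_le_log hS h2
    rw [Real.log_mul (by positivity) (by positivity), Real.log_mul (by positivity) (by positivity)]
      at h3
    linarith

theorem log_shift_le (T H y : ℝ) :
    Real.log (1 + |T + H * y|)
      ≤ Real.log (1 + |T|) + Real.log (1 + |H|) + Real.log (1 + |y|) := by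
  rw [← Real.log_mul (by positivity) (by positivity), ← Real.log_mul (by positivity) (by positivity)]
  apply Real.log_le_log (by positivity)
  have h1 := abs_add_le T (H * y)
  rw [abs_mul] at h1
  have hT := abs_nonneg T
  have hH := abs_nonneg H
  have hy := abs_nonneg y
  have h2 : (1 + |T|) * (1 + |H|) * (1 + |y|) = 1 + |T| + |H| * |y|
    + (|H| + |y| + |T| * |H| + |T| * |y| + |T| * |H| * |y|) := by ring
  have h3 : 0 ≤ |H| + |y| + |T| * |H| + |T| * |y| + |T| * |H| * |y| := by positivity
  linarith

theorem IsWeight.integrable_log_shift (hw : IsWeight w) (T H : ℝ) :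
    Integrable fun y : ℝ => Real.log (1 + |T + H * y|) * w y := by
  have hc : Continuous fun y : ℝ => Real.log (1 + |T + H * y|) :=
    Continuous.log (by fun_prop) fun y => by positivity
  refine ((hw.integrable.const_mul (Real.log (1 + |T|) + Real.log (1 + |H|))).add
    hw.log_moment).mono' (hc.aestronglyMeasurable.mul hw.integrable.aestronglyMeasurable)
    (Eventually.of_forall fun y => ?_)
  have h0 : 0 ≤ Real.log (1 + |T + H * y|) := Real.log_nonneg (by linarith [abs_nonneg (T + H * y)])
  rw [Real.norm_of_nonneg (mul_nonneg h0 (hw.nonneg y))]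
  have := mul_le_mul_of_nonneg_right (log_shift_le T H y) (hw.nonneg y)
  simp only [Pi.add_apply]
  linarith

theorem IsWeight.integrable_ofReal (hw : IsWeight w) : Integrable fun x : ℝ => (w x : ℂ) :=
  hw.integrable.ofReal

theorem IsWeight.ae_le (hw : IsWeight w) : ∃ M : ℝ, ∀ᵐ x, w x ≤ M := by
  have hF : Integrable (𝓕 (fun x : ℝ => (w x : ℂ))) :=
    (continuous_fourier_of_integrable hw.integrable_ofReal).integrable_of_hasCompactSupport
      hw.compact_fourier
  refine ⟨∫ ξ, ‖𝓕 (fun x : ℝ => (w x : ℂ)) ξ‖,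
    (ae_norm_le_integral_norm_fourier hw.integrable_ofReal hF).mono fun x hx => ?_⟩
  rw [Complex.norm_real, Real.norm_of_nonneg (hw.nonneg x)] at hx
  exact hx

theorem IsWeight.exists_integral_log_shift_le (hw : IsWeight w) {c : ℝ} (hc : 0 ≤ c) :
    ∃ C : ℝ, ∀ T H : ℝ, 1 ≤ T → 0 < H → H ≤ c * T →
      ∫ y, |Real.log (1 + |T + H * y|) - Real.log T| * w y ≤ C := by
  obtain ⟨M, hM⟩ := hw.ae_le
  refine ⟨Real.log (2 + c) + (∫ y, w y * Real.log (1 + |y|)) + M * ∫ y, logDip y,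
    fun T H hT hH hHT => ?_⟩
  have hshift : Integrable fun y => M * logDip (y + T / H) :=
    (integrable_logDip.comp_add_right (T / H)).const_mul M
  have hB' : Integrable fun y => Real.log (2 + c) * w y + w y * Real.log (1 + |y|) :=
    (hw.integrable.const_mul _).add hw.log_moment
  have hB : Integrable fun y => (Real.log (2 + c) * w y + w y * Real.log (1 + |y|))
      + M * logDip (y + T / H) :=
    hB'.add hshift
  have hle : ∫ y, |Real.log (1 + |T + H * y|) - Real.log T| * w y
      ≤ ∫ y, ((Real.log (2 + c) * w y + w y * Real.log (1 + |y|)) + M * logDip (y + T / H)) := by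
    refine integral_mono_of_nonneg (Eventually.of_forall fun y =>
      mul_nonneg (abs_nonneg _) (hw.nonneg y)) hB ?_
    have hne : ∀ᵐ y : ℝ, y ≠ -(T / H) := Measure.ae_ne volume _
    filter_upwards [hM, hne] with y hy1 hy2
    have h1 := abs_log_shift_sub_log_le hT hH hc hHT (y := y)
      fun h => hy2 (eq_neg_of_add_eq_zero_left h)
    have h2 := mul_le_mul_of_nonneg_right h1 (hw.nonneg y)
    have h3 := mul_le_mul_of_nonneg_left hy1 (logDip_nonneg (y + T / H))
    linarith
  refine hle.trans (le_of_eq ?_)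
  rw [integral_add hB' hshift,
    integral_add (hw.integrable.const_mul _) hw.log_moment, integral_const_mul, integral_const_mul,
    hw.integral_eq_one, integral_add_right_eq_self (fun y => logDip y), mul_one]

end Weights

end LinearStatistics

namespace LinearStatistics

section Averages

open Complex Topology Set

variable {f : ℝ → ℂ} {w : ℝ → ℝ}

theorem norm_zeroKernel (L τ v : ℝ) : ‖zeroKernel f L τ v‖ = ‖1 / (L : ℂ) * 𝓕 f (v / L)‖ := by
  unfold zeroKernel
  rw [norm_mul, norm_mul, norm_mul, Complex.norm_exp]
  simp

theorem continuous_zeroKernel (hf : IsTestFunction f) (L : ℝ) :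
    Continuous fun p : ℝ × ℝ => zeroKernel f L p.1 p.2 := by
  have h := hf.smooth_fourier.continuous
  unfold zeroKernel
  fun_prop

theorem integrable_norm_zeroKernel_mul_exp (hf : IsTestFunction f) {L : ℝ} (hL : 0 < L) (z : ℂ) :
    Integrable fun v : ℝ => ‖1 / (L : ℂ) * 𝓕 f (v / L)‖ * ‖cexp (v * z)‖ := by
  have h := (integrable_mul_exp (contDiff_zeroKernel hf L 0).continuous
    (hasCompactSupport_zeroKernel hf hL 0) z).norm
  refine h.congr (Eventually.of_forall fun v => ?_)
  simp only [norm_mul (zeroKernel f L 0 v), norm_zeroKernel]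

theorem continuous_laplace_zeroKernel (hf : IsTestFunction f) {L : ℝ} (hL : 0 < L) (z : ℂ) :
    Continuous fun τ : ℝ => laplace (zeroKernel f L τ) z := by
  unfold laplace
  refine continuous_of_dominated (fun τ => ?_) (fun τ => Eventually.of_forall fun v => ?_)
    (integrable_norm_zeroKernel_mul_exp hf hL z) (Eventually.of_forall fun v => ?_)
  · exact (integrable_mul_exp (contDiff_zeroKernel hf L τ).continuous
      (hasCompactSupport_zeroKernel hf hL τ) z).aestronglyMeasurable
  · rw [norm_mul, norm_zeroKernel]
  · exact ((continuous_zeroKernel hf L).comp (by fun_prop : Continuous fun τ : ℝ => (τ, v))).mul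
      continuous_const

theorem norm_laplace_zeroKernel_le (L τ : ℝ) (z : ℂ) :
    ‖laplace (zeroKernel f L τ) z‖ ≤ ∫ v : ℝ, ‖1 / (L : ℂ) * 𝓕 f (v / L)‖ * ‖cexp (v * z)‖ := by
  unfold laplace
  refine (norm_integral_le_integral_norm _).trans (le_of_eq ?_)
  simp_rw [norm_mul (zeroKernel f L τ _), norm_zeroKernel]

theorem measurable_linearStatistic (hf : IsTestFunction f) {T : ℝ} (hT : 1 < T) :
    Measurable (linearStatistic f T) := by
  refine measurable_of_tendsto_metrizable' (atTop : Filter (Finset nontrivialZeros))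
    (f := fun s τ => ∑ ρ ∈ s, zeroTerm f T τ ρ) (fun s => ?_)
    (tendsto_pi_nhds.2 fun τ => (summable_zeroTerm hf hT τ).hasSum)
  refine (continuous_finsetSum s fun ρ _ => ?_).measurable
  simp_rw [zeroTerm_eq hT]
  exact continuous_const.mul (continuous_laplace_zeroKernel hf (Real.log_pos hT) _)

theorem integrable_and_integral_zeroKernel_mul (hw : IsWeight w) (L T H v : ℝ) :
    (Integrable fun y : ℝ => zeroKernel f L (T + H * y) v * (w y : ℂ)) ∧
    ∫ y : ℝ, zeroKernel f L (T + H * y) v * (w y : ℂ)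
      = zeroKernel f L T v * 𝓕 (fun x : ℝ => (w x : ℂ)) (H * v / (2 * Real.pi)) := by
  have h1 : ∀ y : ℝ, zeroKernel f L (T + H * y) v * (w y : ℂ)
      = zeroKernel f L T v * (cexp (↑(-2 * Real.pi * y * (H * v / (2 * Real.pi))) * I) • (w y : ℂ)) := by
    intro y
    have h2 : -2 * Real.pi * y * (H * v / (2 * Real.pi)) = -(H * y * v) := by
      field_simp
    rw [h2, zeroKernel, zeroKernel, smul_eq_mul]
    have h3 : cexp (-(I * (((T + H * y : ℝ) : ℂ) * v)))
        = cexp (-(I * (T * v))) * cexp (((-(H * y * v) : ℝ) : ℂ) * I) := by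
      rw [← Complex.exp_add]
      congr 1
      push_cast
      ring
    rw [h3]
    ring
  simp_rw [h1]
  constructor
  · refine Integrable.const_mul ?_ _
    refine hw.integrable_ofReal.bdd_mul (c := 1) (Continuous.aestronglyMeasurable (by fun_prop))
      (Eventually.of_forall fun y => ?_)
    rw [Complex.norm_exp_ofReal_mul_I]
  · rw [integral_const_mul, Real.fourier_real_eq_integral_exp_smul]

theorem integrable_laplace_zeroKernel_mul (hf : IsTestFunction f) (hw : IsWeight w) {L : ℝ}
    (hL : 0 < L) (T H : ℝ) (z : ℂ) :
    Integrable fun y : ℝ => laplace (zeroKernel f L (T + H * y)) z * (w y : ℂ) :=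
  hw.integrable_ofReal.bdd_mul
    ((continuous_laplace_zeroKernel hf hL z).comp
      (by fun_prop : Continuous fun y : ℝ => T + H * y)).aestronglyMeasurable
    (Eventually.of_forall fun _ => norm_laplace_zeroKernel_le _ _ _)

theorem integral_laplace_zeroKernel_mul (hf : IsTestFunction f) (hw : IsWeight w) {L : ℝ}
    (hL : 0 < L) (T H : ℝ) (z : ℂ) :
    ∫ y : ℝ, laplace (zeroKernel f L (T + H * y)) z * (w y : ℂ)
      = ∫ v : ℝ, zeroKernel f L T v * 𝓕 (fun x : ℝ => (w x : ℂ)) (H * v / (2 * Real.pi)) *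
          cexp (v * z) := by
  let F : ℝ → ℝ → ℂ := fun y v => zeroKernel f L (T + H * y) v * cexp (v * z) * (w y : ℂ)
  have hF : Integrable (Function.uncurry F) (volume.prod volume) := by
    have hb := (hw.integrable.mul_prod (integrable_norm_zeroKernel_mul_exp hf hL z))
    refine hb.mono' ?_ (Eventually.of_forall fun p => ?_)
    · refine AEStronglyMeasurable.mul (Continuous.aestronglyMeasurable ?_)
        hw.integrable_ofReal.aestronglyMeasurable.comp_fst
      exact ((continuous_zeroKernel hf L).comp
        (by fun_prop : Continuous fun p : ℝ × ℝ => (T + H * p.1, p.2))).mul (by fun_prop)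
    · simp only [Function.uncurry, F]
      rw [norm_mul, norm_mul, norm_zeroKernel, Complex.norm_real, Real.norm_of_nonneg (hw.nonneg _),
        mul_comm]
  have h := integral_integral_swap hF
  simp only [F, laplace] at h ⊢
  simp_rw [← integral_mul_const]
  rw [h]
  congr 1
  funext v
  rw [← (integrable_and_integral_zeroKernel_mul hw L T H v).2, ← integral_mul_const]
  congr 1
  funext y
  ring

theorem IsWeight.exists_fourier_eq_zero (hw : IsWeight w) :
    ∃ B : ℝ, 0 ≤ B ∧ ∀ ξ, B < |ξ| → 𝓕 (fun x : ℝ => (w x : ℂ)) ξ = 0 := by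
  obtain ⟨B, hB⟩ := hw.compact_fourier.isCompact.isBounded.subset_closedBall 0
  refine ⟨max B 0, le_max_right _ _, fun u hu => ?_⟩
  refine image_eq_zero_of_notMem_tsupport fun h => ?_
  have := hB h
  rw [mem_closedBall_zero_iff, Real.norm_eq_abs] at this
  exact absurd (this.trans (le_max_left B 0)) (not_le.2 hu)

theorem IsWeight.norm_fourier_le (hw : IsWeight w) (ξ : ℝ) :
    ‖𝓕 (fun x : ℝ => (w x : ℂ)) ξ‖ ≤ 1 := by
  refine (VectorFourier.norm_fourierIntegral_le_integral_norm _ _ _ _ _).trans (le_of_eq ?_)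
  rw [← hw.integral_eq_one]
  congr 1
  funext x
  rw [Complex.norm_real, Real.norm_of_nonneg (hw.nonneg x)]

theorem exists_norm_integral_laplace_zeroKernel_le (hf : IsTestFunction f) (hw : IsWeight w) :
    ∃ C : ℝ, ∀ L T H : ℝ, 0 < L → 1 ≤ H → ∀ z : ℂ, |z.re| ≤ 1 / 2 →
      ‖∫ y : ℝ, laplace (zeroKernel f L (T + H * y)) z * (w y : ℂ)‖ ≤ C / L := by
  obtain ⟨B, hB0, hB⟩ := hw.exists_fourier_eq_zero
  obtain ⟨M, hM⟩ := hf.compact_fourier.exists_bound_of_continuous hf.smooth_fourier.continuous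
  set R := 2 * Real.pi * B with hR
  have hR0 : 0 ≤ R := by positivity
  refine ⟨2 * R * (M * Real.exp (R / 2)), fun L T H hL hH z hz => ?_⟩
  have hM0 : 0 ≤ M := (norm_nonneg _).trans (hM 0)
  rw [integral_laplace_zeroKernel_mul hf hw hL]
  let K : ℝ := M / L * Real.exp (R / 2)
  have hle : ∀ v : ℝ, ‖zeroKernel f L T v * 𝓕 (fun x : ℝ => (w x : ℂ)) (H * v / (2 * Real.pi)) *
      cexp (v * z)‖ ≤ (Icc (-R) R).indicator (fun _ => K) v := by
    intro v
    by_cases hv : v ∈ Icc (-R) R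
    · rw [indicator_of_mem hv, norm_mul, norm_mul, norm_zeroKernel, norm_mul, norm_div, norm_one,
        Complex.norm_real, Real.norm_of_nonneg hL.le, Complex.norm_exp]
      have h1 : (v * z).re ≤ R / 2 := by
        simp only [mul_re, ofReal_re, ofReal_im, zero_mul, sub_zero]
        calc v * z.re ≤ |v| * |z.re| := by rw [← abs_mul]; exact le_abs_self _
          _ ≤ R * (1 / 2) := by
              gcongr
              exact abs_le.2 hv
          _ = R / 2 := by ring
      calc 1 / L * ‖𝓕 f (v / L)‖ * ‖𝓕 (fun x : ℝ => (w x : ℂ)) (H * v / (2 * Real.pi))‖ *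
            Real.exp (v * z).re
          ≤ 1 / L * M * 1 * Real.exp (R / 2) := by
            gcongr
            · exact hM _
            · exact hw.norm_fourier_le _
        _ = K := by
            simp only [K]
            ring
    · rw [indicator_of_notMem hv, hB, mul_zero, zero_mul, norm_zero]
      have h1 : R < |v| := not_le.1 fun h => hv (abs_le.1 h)
      rw [abs_div, abs_mul, abs_of_pos (by linarith : 0 < H), abs_of_pos (by positivity : 0 < 2 * Real.pi),
        lt_div_iff₀ (by positivity)]
      nlinarith [abs_nonneg v]
  refine (norm_integral_le_of_norm_le ?_ (Eventually.of_forall hle)).trans (le_of_eq ?_)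
  · rw [integrable_indicator_iff measurableSet_Icc]
    exact integrableOn_const (by simp)
  · rw [integral_indicator measurableSet_Icc, setIntegral_const, Real.volume_real_Icc_of_le
      (by linarith), smul_eq_mul]
    simp only [K]
    ring

theorem integrable_primeTerm_mul (hw : IsWeight w) (L T H : ℝ) (n : ℕ) :
    Integrable fun y : ℝ => primeTerm f L n (T + H * y) * (w y : ℂ) := by
  have h := ((integrable_and_integral_zeroKernel_mul (f := f) hw L T H (Real.log n)).1.add
    (integrable_and_integral_zeroKernel_mul (f := f) hw L T H (-Real.log n)).1).const_mul
      ((ArithmeticFunction.vonMangoldt n : ℂ) / (Real.sqrt n : ℂ))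
  refine h.congr (Eventually.of_forall fun y => ?_)
  simp only [primeTerm, Pi.add_apply]
  ring

theorem integral_primeTerm_mul_eq_zero (hw : IsWeight w) {B : ℝ}
    (hB : ∀ ξ, B < |ξ| → 𝓕 (fun x : ℝ => (w x : ℂ)) ξ = 0) {H : ℝ} (hH0 : 0 < H)
    (hH : B < H * Real.log 2 / (2 * Real.pi)) (L T : ℝ) (n : ℕ) :
    ∫ y : ℝ, primeTerm f L n (T + H * y) * (w y : ℂ) = 0 := by
  rcases lt_or_ge n 2 with hn | hn
  · have : ArithmeticFunction.vonMangoldt n = 0 := by interval_cases n <;> simp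
    simp [primeTerm, this]
  · obtain ⟨i1, e1⟩ := integrable_and_integral_zeroKernel_mul (f := f) hw L T H (Real.log n)
    obtain ⟨i2, e2⟩ := integrable_and_integral_zeroKernel_mul (f := f) hw L T H (-Real.log n)
    have hlog : Real.log 2 ≤ Real.log n :=
      Real.log_le_log two_pos (by exact_mod_cast hn)
    have hξ : B < H * Real.log n / (2 * Real.pi) := hH.trans_le (by gcongr)
    rw [hB _ (hξ.trans_le (le_abs_self _)), mul_zero] at e1
    rw [hB _ (by rw [mul_neg, neg_div, abs_neg]; exact hξ.trans_le (le_abs_self _)), mul_zero] at e2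
    have h : (fun y : ℝ => primeTerm f L n (T + H * y) * (w y : ℂ))
        = fun y => (ArithmeticFunction.vonMangoldt n : ℂ) / (Real.sqrt n : ℂ) *
          (zeroKernel f L (T + H * y) (Real.log n) * (w y : ℂ)
            + zeroKernel f L (T + H * y) (-Real.log n) * (w y : ℂ)) := by
      funext y
      simp only [primeTerm]
      ring
    rw [h, integral_const_mul, integral_add i1 i2, e1, e2, add_zero, mul_zero]

theorem exists_norm_archAverage_sub_le (hf : IsTestFunction f) :
    ∃ A F : ℝ, 0 ≤ F ∧ ∀ L τ : ℝ, 0 < L → ‖archAverage f L τ - ∫ x, f x‖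
      ≤ 1 / L * ((A + 2 * Real.pi / L + |Real.log (1 + |τ|) - L|) * F) := by
  obtain ⟨C, hC⟩ := exists_abs_archDensity_sub_log_le
  have hC0 : 0 ≤ C := (abs_nonneg _).trans (hC 0)
  refine ⟨C, ∫ x : ℝ, (1 + ‖x‖) ^ 3 * ‖f x‖, integral_nonneg fun x => by positivity,
    fun L τ hL => ?_⟩
  have hLc : (L : ℂ) ≠ 0 := by exact_mod_cast hL.ne'
  have hi := (integrable_and_hasSum_archAverage hf hL τ).1
  have h1 : archAverage f L τ - ∫ x, f x
      = 1 / L * ∫ x, (f x * (archDensity (τ + 2 * Real.pi * x / L) : ℂ) - f x * L) := by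
    rw [integral_sub hi (hf.integrable.mul_const _), integral_mul_const, archAverage]
    field_simp
  rw [h1, norm_mul, norm_div, norm_one, Complex.norm_real, Real.norm_of_nonneg hL.le,
    ← integral_const_mul]
  refine mul_le_mul_of_nonneg_left ?_ (by positivity)
  refine norm_integral_le_of_norm_le (hf.integrable_one_add_cube_mul.const_mul _)
    (Eventually.of_forall fun x => ?_)
  set D := |Real.log (1 + |τ|) - L| with hD
  have hD0 : 0 ≤ D := abs_nonneg _
  have h2 : |archDensity (τ + 2 * Real.pi * x / L) - L| ≤ C + 2 * Real.pi / L * ‖x‖ + D := by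
    have h3 := hC (τ + 2 * Real.pi * x / L)
    have h4 := abs_log_one_add_abs_sub_le (τ + 2 * Real.pi * x / L) τ
    have h5 : |τ + 2 * Real.pi * x / L - τ| = 2 * Real.pi / L * ‖x‖ := by
      rw [add_sub_cancel_left, Real.norm_eq_abs, abs_div, abs_mul, abs_of_pos hL,
        abs_of_pos (by positivity : 0 < 2 * Real.pi)]
      ring
    rw [h5] at h4
    have h6 := abs_sub_le (archDensity (τ + 2 * Real.pi * x / L))
      (Real.log (1 + |τ + 2 * Real.pi * x / L|)) L
    have h7 := abs_sub_le (Real.log (1 + |τ + 2 * Real.pi * x / L|)) (Real.log (1 + |τ|)) L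
    linarith
  have hx := norm_nonneg x
  have h3 : C + 2 * Real.pi / L * ‖x‖ + D ≤ (C + 2 * Real.pi / L + D) * (1 + ‖x‖) ^ 3 := by
    have h4 : 1 ≤ (1 + ‖x‖) ^ 3 := one_le_pow₀ (by linarith)
    have h5 : ‖x‖ ≤ (1 + ‖x‖) ^ 3 := by
      calc ‖x‖ ≤ 1 + ‖x‖ := by linarith
        _ ≤ (1 + ‖x‖) ^ 3 := le_self_pow₀ (by linarith) (by norm_num)
    have h6 := mul_le_mul_of_nonneg_left h5 (by positivity : 0 ≤ 2 * Real.pi / L)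
    nlinarith
  rw [← mul_sub, norm_mul, ← ofReal_sub, Complex.norm_real, Real.norm_eq_abs]
  calc ‖f x‖ * |archDensity (τ + 2 * Real.pi * x / L) - L|
      ≤ ‖f x‖ * ((C + 2 * Real.pi / L + D) * (1 + ‖x‖) ^ 3) := by
        gcongr
        exact h2.trans h3
    _ = _ := by ring

theorem IsWeight.integrable_abs_log_shift_sub_mul (hw : IsWeight w) (T H L : ℝ) :
    Integrable fun y => |Real.log (1 + |T + H * y|) - L| * w y := by
  refine (((hw.integrable_log_shift T H).sub (hw.integrable.const_mul L)).abs).congr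
    (Eventually.of_forall fun y => ?_)
  simp only [Pi.sub_apply]
  rw [← sub_mul, abs_mul, abs_of_nonneg (hw.nonneg y)]

end Averages

section MainTheorem

open Complex Topology Set

variable {f : ℝ → ℂ} {w : ℝ → ℝ}

theorem integrable_poleTerm_mul (hf : IsTestFunction f) (hw : IsWeight w) {L : ℝ} (hL : 0 < L)
    (T H : ℝ) : Integrable fun y : ℝ => poleTerm f L (T + H * y) * (w y : ℂ) := by
  simp only [poleTerm, add_mul]
  exact (integrable_laplace_zeroKernel_mul hf hw hL T H _).add
    (integrable_laplace_zeroKernel_mul hf hw hL T H _)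

theorem measurable_archAverage (hf : IsTestFunction f) {T : ℝ} (hT : 1 < T) :
    Measurable (archAverage f (Real.log T)) := by
  have hL := Real.log_pos hT
  obtain ⟨N, hN⟩ := exists_primeTerm_eq_zero hf hL
  have hp : ∀ n, Measurable (primeTerm f (Real.log T) n) := by
    intro n
    have hk : ∀ v : ℝ, Continuous fun τ : ℝ => zeroKernel f (Real.log T) τ v := by
      intro v
      unfold zeroKernel
      fun_prop
    have h : Continuous fun τ => primeTerm f (Real.log T) n τ := by
      unfold primeTerm
      exact continuous_const.mul ((hk _).add (hk _))
    exact h.measurable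
  have hpole : Continuous fun τ => poleTerm f (Real.log T) τ := by
    unfold poleTerm
    exact (continuous_laplace_zeroKernel hf hL _).add (continuous_laplace_zeroKernel hf hL _)
  have h : archAverage f (Real.log T) = fun τ => linearStatistic f T τ - poleTerm f (Real.log T) τ
      + (Real.log Real.pi + Real.eulerMascheroniConstant) * (1 / Real.log T * ∫ x, f x)
      + ∑ n ∈ Finset.range N, primeTerm f (Real.log T) n τ := by
    funext τ
    rw [linearStatistic_eq hf hT hN]
    ring
  rw [h]
  exact (((measurable_linearStatistic hf hT).sub hpole.measurable).add_const _).add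
    (Finset.measurable_fun_sum _ fun n _ => hp n)

theorem integrable_archAverage_sub_mul (hf : IsTestFunction f) (hw : IsWeight w) {T₀ : ℝ}
    (hT₀ : 1 < T₀) (T H : ℝ) :
    Integrable fun y : ℝ => (archAverage f (Real.log T₀) (T + H * y) - ∫ x, f x) * (w y : ℂ) := by
  have hL := Real.log_pos hT₀
  set L := Real.log T₀
  obtain ⟨A, F, hF, hA⟩ := exists_norm_archAverage_sub_le hf
  have hB : Integrable fun y => 1 / L * (((A + 2 * Real.pi / L) * F) * w y
      + F * (|Real.log (1 + |T + H * y|) - L| * w y)) :=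
    ((hw.integrable.const_mul _).add
      ((hw.integrable_abs_log_shift_sub_mul T H L).const_mul F)).const_mul _
  refine hB.mono' ?_ (Eventually.of_forall fun y => ?_)
  · refine AEStronglyMeasurable.mul (Measurable.aestronglyMeasurable ?_)
      hw.integrable_ofReal.aestronglyMeasurable
    exact ((measurable_archAverage hf hT₀).comp (by fun_prop)).sub_const _
  · rw [norm_mul, Complex.norm_real, Real.norm_of_nonneg (hw.nonneg y)]
    refine (mul_le_mul_of_nonneg_right (hA L (T + H * y) hL) (hw.nonneg y)).trans (le_of_eq ?_)
    ring

theorem linearStatistic_mul_eq (hf : IsTestFunction f) {T : ℝ} (hT : 1 < T) {N : ℕ}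
    (hN : ∀ n, N ≤ n → ∀ τ, primeTerm f (Real.log T) n τ = 0) (H y : ℝ) :
    linearStatistic f T (T + H * y) * (w y : ℂ)
      = poleTerm f (Real.log T) (T + H * y) * (w y : ℂ)
        + ((∫ x, f x) - (Real.log Real.pi + Real.eulerMascheroniConstant) *
            (1 / Real.log T * ∫ x, f x)) * (w y : ℂ)
        + (archAverage f (Real.log T) (T + H * y) - ∫ x, f x) * (w y : ℂ)
        - ∑ n ∈ Finset.range N, primeTerm f (Real.log T) n (T + H * y) * (w y : ℂ) := by
  rw [linearStatistic_eq hf hT hN, ← Finset.sum_mul]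
  ring

theorem integrable_averageIntegrand_linearStatistic (hf : IsTestFunction f) (hw : IsWeight w)
    {T H : ℝ} (hT : 1 < T) (hH : 0 < H) :
    Integrable (averageIntegrand w T H (linearStatistic f T)) := by
  have hL := Real.log_pos hT
  obtain ⟨N, hN⟩ := exists_primeTerm_eq_zero hf hL
  rw [integrable_averageIntegrand_iff hH]
  simp_rw [linearStatistic_mul_eq hf hT hN]
  exact (((integrable_poleTerm_mul hf hw hL T H).add (hw.integrable_ofReal.const_mul _)).add
    (integrable_archAverage_sub_mul hf hw hT T H)).sub
    (integrable_finsetSum _ fun n _ => integrable_primeTerm_mul hw _ T H n)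

theorem average_linearStatistic_sub_eq (hf : IsTestFunction f) (hw : IsWeight w)
    {B : ℝ} (hB : ∀ ξ, B < |ξ| → 𝓕 (fun x : ℝ => (w x : ℂ)) ξ = 0)
    {T H : ℝ} (hT : 1 < T) (hH : 0 < H) (hHB : B < H * Real.log 2 / (2 * Real.pi)) :
    average w T H (linearStatistic f T) - ∫ x, f x
      = (∫ y : ℝ, laplace (zeroKernel f (Real.log T) (T + H * y)) (1 / 2) * (w y : ℂ))
        + (∫ y : ℝ, laplace (zeroKernel f (Real.log T) (T + H * y)) (-(1 / 2)) * (w y : ℂ))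
        - (Real.log Real.pi + Real.eulerMascheroniConstant) * (1 / Real.log T * ∫ x, f x)
        + ∫ y : ℝ, (archAverage f (Real.log T) (T + H * y) - ∫ x, f x) * (w y : ℂ) := by
  have hL := Real.log_pos hT
  obtain ⟨N, hN⟩ := exists_primeTerm_eq_zero hf hL
  have hw1 : ∫ y, (w y : ℂ) = 1 := by
    rw [integral_complex_ofReal, hw.integral_eq_one, ofReal_one]
  have i1 := integrable_poleTerm_mul hf hw hL T H
  have i2 := hw.integrable_ofReal.const_mul ((∫ x, f x) -
    (Real.log Real.pi + Real.eulerMascheroniConstant) * (1 / Real.log T * ∫ x, f x))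
  have i3 := integrable_archAverage_sub_mul hf hw hT T H
  have i4 := fun n => integrable_primeTerm_mul (f := f) hw (Real.log T) T H n
  have hpole : ∫ y : ℝ, poleTerm f (Real.log T) (T + H * y) * (w y : ℂ)
      = (∫ y : ℝ, laplace (zeroKernel f (Real.log T) (T + H * y)) (1 / 2) * (w y : ℂ))
        + ∫ y : ℝ, laplace (zeroKernel f (Real.log T) (T + H * y)) (-(1 / 2)) * (w y : ℂ) := by
    simp only [poleTerm, add_mul]
    exact integral_add (integrable_laplace_zeroKernel_mul hf hw hL T H _)
      (integrable_laplace_zeroKernel_mul hf hw hL T H _)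
  rw [average_eq hH]
  simp_rw [linearStatistic_mul_eq hf hT hN]
  rw [integral_sub (by simpa only [Pi.add_apply] using! (i1.add i2).add i3)
      (integrable_finsetSum _ fun n _ => i4 n),
    integral_add (by simpa only [Pi.add_apply] using! i1.add i2) i3, integral_add i1 i2, integral_const_mul, hw1,
    integral_finsetSum _ fun n _ => i4 n, hpole,
    Finset.sum_eq_zero fun n _ => integral_primeTerm_mul_eq_zero hw hB hH hHB _ T n]
  ring

theorem exists_norm_integral_archAverage_sub_le (hf : IsTestFunction f) (hw : IsWeight w)
    {c : ℝ} (hc : 0 ≤ c) :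
    ∃ C : ℝ, ∀ T H : ℝ, 1 ≤ Real.log T → 1 ≤ T → 0 < H → H ≤ c * T →
      ‖∫ y : ℝ, (archAverage f (Real.log T) (T + H * y) - ∫ x, f x) * (w y : ℂ)‖
        ≤ C / Real.log T := by
  obtain ⟨A, F, hF, hA⟩ := exists_norm_archAverage_sub_le hf
  obtain ⟨C, hC⟩ := hw.exists_integral_log_shift_le hc
  refine ⟨(A + 2 * Real.pi) * F + F * C, fun T H hL1 hT hH hHT => ?_⟩
  set L := Real.log T
  have hL : 0 < L := by linarith
  have hB : Integrable fun y => 1 / L * (((A + 2 * Real.pi) * F) * w y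
      + F * (|Real.log (1 + |T + H * y|) - L| * w y)) :=
    ((hw.integrable.const_mul _).add
      ((hw.integrable_abs_log_shift_sub_mul T H L).const_mul F)).const_mul _
  refine (norm_integral_le_of_norm_le hB (Eventually.of_forall fun y => ?_)).trans ?_
  · rw [norm_mul, Complex.norm_real, Real.norm_of_nonneg (hw.nonneg y)]
    have h2 : 2 * Real.pi / L ≤ 2 * Real.pi := div_le_self (by positivity) hL1
    calc _ ≤ 1 / L * ((A + 2 * Real.pi / L + |Real.log (1 + |T + H * y|) - L|) * F) * w y :=
          mul_le_mul_of_nonneg_right (hA L (T + H * y) hL) (hw.nonneg y)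
      _ ≤ 1 / L * ((A + 2 * Real.pi + |Real.log (1 + |T + H * y|) - L|) * F) * w y := by
          have := hw.nonneg y
          gcongr
      _ = _ := by ring
  · rw [integral_const_mul, integral_add (hw.integrable.const_mul _)
      ((hw.integrable_abs_log_shift_sub_mul T H L).const_mul F), integral_const_mul,
      integral_const_mul, hw.integral_eq_one, mul_one, one_div_mul_eq_div]
    gcongr
    exact hC T H hT hH hHT

end MainTheorem

end LinearStatistics

theorem mainTheorem3
    (f : ℝ → ℂ) (hf : LinearStatistics.IsTestFunction f)
    (w : ℝ → ℝ) (hw : LinearStatistics.IsWeight w) :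
    (∀ T : ℝ, 1 < T → ∀ τ : ℝ, Summable (LinearStatistics.zeroTerm f T τ)) ∧
    (∀ T : ℝ, 1 < T → ∀ H : ℝ, 0 < H →
      Integrable (LinearStatistics.averageIntegrand w T H
        (LinearStatistics.linearStatistic f T))) ∧
    (∀ H : ℝ → ℝ, Tendsto H atTop atTop → H =O[atTop] (fun T : ℝ => T) →
      (fun T : ℝ =>
          LinearStatistics.average w T (H T) (LinearStatistics.linearStatistic f T)
            - ∫ x : ℝ, f x)
        =O[atTop] (fun T : ℝ => 1 / Real.log T)) := by
  refine ⟨fun T hT τ => LinearStatistics.summable_zeroTerm hf hT τ,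
    fun T hT H hH => LinearStatistics.integrable_averageIntegrand_linearStatistic hf hw hT hH,
    fun H hH hHO => ?_⟩
  obtain ⟨c, hc, hcT⟩ := hHO.exists_pos
  obtain ⟨B, -, hB⟩ := hw.exists_fourier_eq_zero
  obtain ⟨C₁, hC₁⟩ := LinearStatistics.exists_norm_integral_laplace_zeroKernel_le hf hw
  obtain ⟨C₂, hC₂⟩ := LinearStatistics.exists_norm_integral_archAverage_sub_le hf hw hc.le
  have hHlim : Tendsto (fun T => H T * Real.log 2 / (2 * Real.pi)) atTop atTop :=
    (hH.atTop_mul_const (Real.log_pos one_lt_two)).atTop_div_const (by positivity)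
  refine IsBigO.of_bound (C₁ + C₁ + ‖(Real.log Real.pi + Real.eulerMascheroniConstant : ℂ)‖ *
    ‖∫ x, f x‖ + C₂) ?_
  filter_upwards [hcT.bound, hHlim.eventually_gt_atTop B, hH.eventually_ge_atTop 1,
    eventually_gt_atTop 1, Real.tendsto_log_atTop.eventually_ge_atTop 1]
    with T h1 h2 h3 h4 h5
  have hL : 0 < Real.log T := by linarith
  have hH0 : 0 < H T := by linarith
  rw [Real.norm_of_nonneg hH0.le, Real.norm_of_nonneg (by linarith)] at h1
  rw [LinearStatistics.average_linearStatistic_sub_eq hf hw hB h4 hH0 h2]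
  have e1 := hC₁ (Real.log T) T (H T) hL h3 (1 / 2) (by simp)
  have e2 := hC₁ (Real.log T) T (H T) hL h3 (-(1 / 2)) (by simp)
  have e3 := hC₂ T (H T) h5 h4.le hH0 h1
  have e4 : ‖(Real.log Real.pi + Real.eulerMascheroniConstant : ℂ) *
      (1 / Real.log T * ∫ x, f x)‖ = ‖(Real.log Real.pi + Real.eulerMascheroniConstant : ℂ)‖ *
        ‖∫ x, f x‖ / Real.log T := by
    rw [norm_mul, norm_mul, norm_div, norm_one, Complex.norm_real, Real.norm_of_nonneg hL.le]
    ring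
  rw [Real.norm_of_nonneg (by positivity)]
  refine (norm_add_le _ _).trans ?_
  refine (add_le_add ((norm_sub_le _ _).trans (add_le_add ((norm_add_le _ _).trans
    (add_le_add e1 e2)) e4.le)) e3).trans (le_of_eq ?_)
  ring
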